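/- **Corollary 7.** Let $d\ge 2$ and let $\mathcal H=\mathbb C^d$ with its computational basis. Let $\mathscr D^{\mathrm R}(\mathcal H)$ be the set of density matrices on $\mathcal H$ with real entries in this basis, and $\mathscr P^{\mathrm R}(\mathcal H)$ the set of pure states in it. For a set $\mathscr S$ of states on $\mathcal H$, a *masker* for $\mathscr S$ is an isometry $M:\mathcal H\to\mathcal H_A\otimes\mathcal H_B$ into a bipartite system of arbitrary finite dimension such that neither of the reduced states $\operatorname{tr}_B(M\rho M^\dagger)$, $\operatorname{tr}_A(M\rho M^\dagger)$ depends on $\rho\in\mathscr S$; it is *real* if $M\rho M^\dagger$ is a real density matrix (in the product of the computational bases) for every $\rho\in\mathscr S$. An *entanglement monotone* $E$ is a real-valued function of the states of all finite-dimensional bipartite systems that does not increase under local operations and classical communication (LOCC). The *entanglement of masking* of $\mathscr S$ is $$E(\mathscr S)=\min_M\ \max_{\rho\in\mathscr S}E(M\rho M^\dagger),$$ with the minimum over all maskers $M$ for $\mathscr S$; $E^{\mathrm R}(\mathscr S)$ is defined in the same way with the minimum over all real maskers. Let $$\kappa(d)=2^{\lfloor (d-1)/2\rfloor},\qquad \tilde\kappa(d)=\max\{\kappa(d),2\},\qquad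 \kappa^{\mathrm R}(d)=\begin{cases}\kappa(d), & d\equiv 0,1,7 \pmod 8,\\ 2\kappa(d), & d\equiv 2,3,4,5,6 \pmod 8,\end{cases}$$ and let $|\Phi(m)\rangle$ denote any maximally entangled state of Schmidt rank $m$. Then, for every entanglement monotone $E$, the minima and maxima above exist and $$E(\mathscr D^{\mathrm R}(\mathcal H))=E(\mathscr P^{\mathrm R}(\mathcal H))=E(|\Phi(\tilde\kappa(d))\rangle),\qquad E^{\mathrm R}(\mathscr D^{\mathrm R}(\mathcal H))=E^{\mathrm R}(\mathscr P^{\mathrm R}(\mathcal H))=E(|\Phi(\kappa^{\mathrm R}(d))\rangle).$$ In particular, let $E_{\mathrm C}$ be the entanglement cost: $E_{\mathrm C}(\rho)$ is the infimum of the rates $r\ge 0$ for which there are LOCC maps $\Lambda_n$ with $\|\Lambda_n(|\Phi(2^{\lfloor rn\rfloor})\rangle\langle\Phi(2^{\lfloor rn\rfloor})|)-\rho^{\otimes n}\|_1\to 0$ as $n\to\infty$. Then $$E_{\mathrm C}(\mathscr D^{\mathrm R}(\mathcal H))=E_{\mathrm C}(\mathscr P^{\mathrm R}(\mathcal H))=\begin{cases}1,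 & d=2,\\ \lfloor (d-1)/2\rfloor, & d\ge 3,\end{cases}$$ $$E_{\mathrm C}^{\mathrm R}(\mathscr D^{\mathrm R}(\mathcal H))=E_{\mathrm C}^{\mathrm R}(\mathscr P^{\mathrm R}(\mathcal H))=\begin{cases}\lfloor (d-1)/2\rfloor, & d\equiv 0,1,7 \pmod 8,\\ \lfloor (d-1)/2\rfloor+1, & d\equiv 2,3,4,5,6 \pmod 8.\end{cases}$$ -/

import Mathlib

namespace RealMasking

open scoped ComplexOrder Kronecker Matrix Topology

noncomputable section

/-! ### States

A finite-dimensional Hilbert space with its computational basis is `ι → ℂ` for a finite type `ι`;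
the bipartite space of `A` and `B` has the product basis, indexed by `A × B`. -/

/-- Density matrices. -/
def IsDensity {ι : Type} [Fintype ι] (ρ : Matrix ι ι ℂ) : Prop :=
  ρ.PosSemidef ∧ ρ.trace = 1

/-- The operator `|ψ⟩⟨ψ|`. -/
def ketBra {ι : Type} (ψ : ι → ℂ) : Matrix ι ι ℂ :=
  Matrix.vecMulVec ψ (star ψ)

/-- Pure states: the density matrices of the form `|ψ⟩⟨ψ|` (rank-one projectors). -/
def IsPure {ι : Type} [Fintype ι] (ρ : Matrix ι ι ℂ) : Prop :=
  IsDensity ρ ∧ ∃ ψ : ι → ℂ, ρ = ketBra ψ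

/-- The set of real states: density matrices with real entries in the computational basis. -/
def realStates (ι : Type) [Fintype ι] : Set (Matrix ι ι ℂ) :=
  {ρ | IsDensity ρ ∧ ∀ i j, (ρ i j).im = 0}

/-- The set of real pure states. -/
def realPureStates (ι : Type) [Fintype ι] : Set (Matrix ι ι ℂ) :=
  {ρ | ρ ∈ realStates ι ∧ IsPure ρ}

/-- Partial trace over the second factor: the reduced state of `A`. -/
def traceB {A B : Type} [Fintype B] (ρ : Matrix (A × B) (A × B) ℂ) : Matrix A A ℂ :=
  Matrix.of fun a a' => ∑ b, ρ (a, b) (a', b)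

/-- Partial trace over the first factor: the reduced state of `B`. -/
def traceA {A B : Type} [Fintype A] (ρ : Matrix (A × B) (A × B) ℂ) : Matrix B B ℂ :=
  Matrix.of fun b b' => ∑ a, ρ (a, b) (a, b')

/-- `Ψ` is a maximally entangled ket of Schmidt rank `m`, that is,
`Ψ = m ^ (-1/2) ∑ j, |u_j⟩ ⊗ |v_j⟩` for orthonormal families `u_1, …, u_m` and `v_1, …, v_m`
(the columns of the matrices `u` and `v`). -/
def IsMaxEntangled {A B : Type} [Fintype A] [Fintype B] (m : ℕ) (Ψ : A × B → ℂ) : Prop :=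
  ∃ (u : Matrix A (Fin m) ℂ) (v : Matrix B (Fin m) ℂ), uᴴ * u = 1 ∧ vᴴ * v = 1 ∧
    ∀ a b, Ψ (a, b) = ((1 / √(m : ℝ) : ℝ) : ℂ) * ∑ j, u a j * v b j

/-- The standard maximally entangled ket `m ^ (-1/2) ∑ j, |j j⟩` of Schmidt rank `m`. -/
def stdMaxEntangled (m : ℕ) : Fin m × Fin m → ℂ :=
  fun p => if p.1 = p.2 then ((1 / √(m : ℝ) : ℝ) : ℂ) else 0

/-! ### Local operations and classical communication -/

/-- `IsLOCC Λ`: the map `Λ`, from operators on `A ⊗ B` to operators on `A' ⊗ B'`, is implemented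
by an LOCC protocol with finitely many rounds. Either the protocol is over, or one party applies a
local quantum measurement with Kraus operators `K i`, announces the outcome `i`, and both parties
go on with an LOCC protocol that depends on `i`; the outcomes are forgotten at the end.
Local channels (isometries, partial traces, ...) are measurements whose outcome is not used. -/
inductive IsLOCC {A' B' : Type} [Fintype A'] [DecidableEq A'] [Fintype B'] [DecidableEq B'] :
    {A B : Type} → [Fintype A] → [DecidableEq A] → [Fintype B] → [DecidableEq B] →
    (Matrix (A × B) (A × B) ℂ → Matrix (A' × B') (A' × B') ℂ) → Prop
  | done : IsLOCC (A := A') (B := B') fun ρ => ρ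
  | alice {A B : Type} [Fintype A] [DecidableEq A] [Fintype B] [DecidableEq B]
      {ι : Type} [Fintype ι] (A₁ : ι → Type) [∀ i, Fintype (A₁ i)] [∀ i, DecidableEq (A₁ i)]
      (K : ∀ i, Matrix (A₁ i) A ℂ) (hK : ∑ i, (K i)ᴴ * K i = 1)
      (Λ : ∀ i, Matrix (A₁ i × B) (A₁ i × B) ℂ → Matrix (A' × B') (A' × B') ℂ)
      (hΛ : ∀ i, IsLOCC (Λ i)) :
      IsLOCC (A := A) (B := B) fun ρ =>
        ∑ i, Λ i ((K i ⊗ₖ (1 : Matrix B B ℂ)) * ρ * (K i ⊗ₖ (1 : Matrix B B ℂ))ᴴ)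
  | bob {A B : Type} [Fintype A] [DecidableEq A] [Fintype B] [DecidableEq B]
      {ι : Type} [Fintype ι] (B₁ : ι → Type) [∀ i, Fintype (B₁ i)] [∀ i, DecidableEq (B₁ i)]
      (K : ∀ i, Matrix (B₁ i) B ℂ) (hK : ∑ i, (K i)ᴴ * K i = 1)
      (Λ : ∀ i, Matrix (A × B₁ i) (A × B₁ i) ℂ → Matrix (A' × B') (A' × B') ℂ)
      (hΛ : ∀ i, IsLOCC (Λ i)) :
      IsLOCC (A := A) (B := B) fun ρ =>
        ∑ i, Λ i (((1 : Matrix A A ℂ) ⊗ₖ K i) * ρ * ((1 : Matrix A A ℂ) ⊗ₖ K i)ᴴ)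

/-! ### Entanglement monotones -/

/-- Real-valued functions of the states of all bipartite systems `ℂ^m ⊗ ℂ^n`. -/
abbrev BipartiteFunctional : Type :=
  ∀ m n : ℕ, Matrix (Fin m × Fin n) (Fin m × Fin n) ℂ → ℝ

/-- An entanglement monotone does not increase under LOCC. No convexity, normalization or
monotonicity on average is required. -/
def IsEntanglementMonotone (E : BipartiteFunctional) : Prop :=
  ∀ (m n m' n' : ℕ)
    (Λ : Matrix (Fin m × Fin n) (Fin m × Fin n) ℂ → Matrix (Fin m' × Fin n') (Fin m' × Fin n') ℂ),
    IsLOCC Λ → ∀ ρ, IsDensity ρ → E m' n' (Λ ρ) ≤ E m n ρ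

/-! ### Maskers and the entanglement of masking -/

/-- The isometry `M : ℂ^d → ℂ^m ⊗ ℂ^n` masks the set `S`: both reduced states of `M ρ M†` are
the same for all `ρ ∈ S`. -/
def IsMasker {d m n : ℕ} (S : Set (Matrix (Fin d) (Fin d) ℂ))
    (M : Matrix (Fin m × Fin n) (Fin d) ℂ) : Prop :=
  Mᴴ * M = 1 ∧ ∃ (τA : Matrix (Fin m) (Fin m) ℂ) (τB : Matrix (Fin n) (Fin n) ℂ),
    ∀ ρ ∈ S, traceB (M * ρ * Mᴴ) = τA ∧ traceA (M * ρ * Mᴴ) = τB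

/-- A masker for `S` is real if it maps `S` to real states. -/
def IsRealMasker {d m n : ℕ} (S : Set (Matrix (Fin d) (Fin d) ℂ))
    (M : Matrix (Fin m × Fin n) (Fin d) ℂ) : Prop :=
  IsMasker S M ∧ ∀ ρ ∈ S, M * ρ * Mᴴ ∈ realStates (Fin m × Fin n)

/-- `E(S, M) = e`, where `E(S, M)` is the maximum of `E(M ρ M†)` over `ρ ∈ S`. -/
def MaskerEntanglementEq (E : BipartiteFunctional) {d m n : ℕ}
    (S : Set (Matrix (Fin d) (Fin d) ℂ)) (M : Matrix (Fin m × Fin n) (Fin d) ℂ) (e : ℝ) : Prop :=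
  IsGreatest {x | ∃ ρ ∈ S, x = E m n (M * ρ * Mᴴ)} e

/-- `E(S) = e`, where the entanglement of masking `E(S)` is the minimum of `E(S, M)` over all
maskers `M` for `S`, into bipartite systems of arbitrary dimensions. The maximum that defines
`E(S, M)` is asserted to exist for every masker, and the minimum is asserted to exist. -/
def MaskingEntanglementEq (E : BipartiteFunctional) {d : ℕ}
    (S : Set (Matrix (Fin d) (Fin d) ℂ)) (e : ℝ) : Prop :=
  (∀ (m n : ℕ) (M : Matrix (Fin m × Fin n) (Fin d) ℂ), IsMasker S M →
    ∃ x, MaskerEntanglementEq E S M x) ∧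
  IsLeast {x | ∃ (m n : ℕ) (M : Matrix (Fin m × Fin n) (Fin d) ℂ),
    IsMasker S M ∧ MaskerEntanglementEq E S M x} e

/-- `E^R(S) = e`: the same with the minimum over all real maskers for `S`. -/
def RealMaskingEntanglementEq (E : BipartiteFunctional) {d : ℕ}
    (S : Set (Matrix (Fin d) (Fin d) ℂ)) (e : ℝ) : Prop :=
  (∀ (m n : ℕ) (M : Matrix (Fin m × Fin n) (Fin d) ℂ), IsRealMasker S M →
    ∃ x, MaskerEntanglementEq E S M x) ∧
  IsLeast {x | ∃ (m n : ℕ) (M : Matrix (Fin m × Fin n) (Fin d) ℂ),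
    IsRealMasker S M ∧ MaskerEntanglementEq E S M x} e

/-! ### Entanglement cost -/

/-- The trace norm `tr √(X† X)`, the sum of the singular values of `X`. -/
def traceNorm {ι : Type} [Fintype ι] [DecidableEq ι] (X : Matrix ι ι ℂ) : ℝ :=
  ∑ i, √((Matrix.isHermitian_conjTranspose_mul_self X).eigenvalues i)

/-- The `n`-fold tensor power of a bipartite operator, as an operator on `A^n ⊗ B^n`. -/
def tensorPower {A B : Type} (ρ : Matrix (A × B) (A × B) ℂ) (n : ℕ) :
    Matrix ((Fin n → A) × (Fin n → B)) ((Fin n → A) × (Fin n → B)) ℂ :=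
  Matrix.of fun x y => ∏ k, ρ (x.1 k, x.2 k) (y.1 k, y.2 k)

/-- `r` is an achievable rate for `ρ`: LOCC protocols turn maximally entangled states of Schmidt
rank `2 ^ ⌊r n⌋` into states whose trace distance from `ρ^{⊗ n}` tends to `0`. -/
def IsAchievableRate {A B : Type} [Fintype A] [DecidableEq A] [Fintype B] [DecidableEq B]
    (ρ : Matrix (A × B) (A × B) ℂ) (r : ℝ) : Prop :=
  0 ≤ r ∧ ∃ Λ : ∀ n : ℕ,
      Matrix (Fin (2 ^ ⌊r * n⌋₊) × Fin (2 ^ ⌊r * n⌋₊)) (Fin (2 ^ ⌊r * n⌋₊) × Fin (2 ^ ⌊r * n⌋₊)) ℂ →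
      Matrix ((Fin n → A) × (Fin n → B)) ((Fin n → A) × (Fin n → B)) ℂ,
    (∀ n, IsLOCC (Λ n)) ∧
    Filter.Tendsto
      (fun n => traceNorm (Λ n (ketBra (stdMaxEntangled (2 ^ ⌊r * n⌋₊))) - tensorPower ρ n))
      Filter.atTop (𝓝 0)

/-- The entanglement cost: the infimum of the achievable rates. -/
def entanglementCost : BipartiteFunctional :=
  fun _ _ ρ => sInf {r : ℝ | IsAchievableRate ρ r}

/-! ### The Hurwitz-Radon numbers -/

/-- `κ(d) = 2 ^ ⌊(d - 1) / 2⌋`. -/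
def kappa (d : ℕ) : ℕ := 2 ^ ((d - 1) / 2)

/-- `κ^R(d)` is `κ(d)` if `d = 0, 1, 7 mod 8` and `2 κ(d)` otherwise. -/
def kappaReal (d : ℕ) : ℕ :=
  if d % 8 = 0 ∨ d % 8 = 1 ∨ d % 8 = 7 then kappa d else 2 * kappa d

end

end RealMasking

open RealMasking

/-!
Write `M |j⟩` as a coefficient matrix `X j`. By polarization, `M` masks the real states if and only
if `X j * (X j)ᴴ = τ` and `(X j)ᴴ * X j = τ'` for all `j`, and the matrices `X j * (X k)ᴴ` and
`(X j)ᴴ * X k` are antisymmetric in `j ≠ k`. On an eigenspace of `τ` with eigenvalue `c > 0`, the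
matrices `c⁻¹ • X k * (X 0)ᴴ`, `k ≠ 0`, are then anticommuting complex structures, so the dimension
of the eigenspace is at least that of a representation of the Clifford algebra with `d - 1`
generators: `κ(d)` over `ℂ`, and `κ^R(d)` over `ℝ`, where the reduced states and generators of a
real masker are real. Hence no Schmidt coefficient of an output exceeds the inverse of this
dimension, nor `1 / 2` because the output kets are orthogonal, and a pure state with this property
can be converted by LOCC to the maximally entangled state of that Schmidt rank. All pure outputs
have the same reduced states, so that every output, pure or mixed, can be converted by LOCC from
`M |0⟩`. Conversely, the kets `Φ, (J 1 ⊗ 1) Φ, …, (J (d - 1) ⊗ 1) Φ`, for a Clifford family `J` of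
least size and `Φ` maximally entangled, define a masker with maximally entangled outputs. Finally,
the entanglement cost is a monotone, and `log₂ m` is its value at the maximally entangled state of
Schmidt rank `m = 2 ^ p`: conversion cannot increase the overlap with a maximally entangled state
beyond the ratio of the Schmidt ranks.
-/

namespace RealMasking

open scoped ComplexOrder Kronecker Matrix Topology

noncomputable section

/-! ### LOCC maps -/

section KrausFamilies

variable {R : Type*} [CommRing R] [StarRing R]

theorem sum_sigma_conjTranspose_mul_self {ι p q : Type*} {κ r : ι → Type*} [Fintype ι] [Fintype p]
    [DecidableEq q] [∀ i, Fintype (κ i)] [∀ i, Fintype (r i)] [∀ i, DecidableEq (r i)]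
    {F : ∀ i, Matrix (r i) q R} {G : ∀ i, κ i → Matrix p (r i) R}
    (hF : ∑ i, (F i)ᴴ * F i = 1) (hG : ∀ i, ∑ s, (G i s)ᴴ * G i s = 1) :
    ∑ x : Σ i, κ i, (G x.1 x.2 * F x.1)ᴴ * (G x.1 x.2 * F x.1) = 1 := by
  have inner_sum (i : ι) : ∑ s, (G i s * F i)ᴴ * (G i s * F i) = (F i)ᴴ * F i :=
    calc ∑ s, (G i s * F i)ᴴ * (G i s * F i)
        = (F i)ᴴ * (∑ s, (G i s)ᴴ * G i s) * F i := by
          simp only [Matrix.conjTranspose_mul, Matrix.mul_sum, Matrix.sum_mul, Matrix.mul_assoc]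
      _ = (F i)ᴴ * F i := by rw [hG, Matrix.mul_one]
  rw [Fintype.sum_sigma, ← hF]
  exact Finset.sum_congr rfl fun i _ => inner_sum i

variable {ι m n : Type*} [Fintype ι] [Fintype n] [DecidableEq m] [DecidableEq n] {p : ι → Type*}
  [∀ i, Fintype (p i)] {K : ∀ i, Matrix (p i) m R}

theorem sum_kronecker_one_conjTranspose_mul_self (hK : ∑ i, (K i)ᴴ * K i = 1) :
    ∑ i, (K i ⊗ₖ (1 : Matrix n n R))ᴴ * (K i ⊗ₖ (1 : Matrix n n R)) = 1 := by
  simp only [Matrix.conjTranspose_kronecker, Matrix.conjTranspose_one, ← Matrix.mul_kronecker_mul,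
    Matrix.one_mul]
  rw [← Matrix.one_kronecker_one, ← hK]
  exact (map_sum ((Matrix.kroneckerBilinear (R := R)).flip (1 : Matrix n n R)) _ _).symm

theorem sum_one_kronecker_conjTranspose_mul_self (hK : ∑ i, (K i)ᴴ * K i = 1) :
    ∑ i, ((1 : Matrix n n R) ⊗ₖ K i)ᴴ * ((1 : Matrix n n R) ⊗ₖ K i) = 1 := by
  simp only [Matrix.conjTranspose_kronecker, Matrix.conjTranspose_one, ← Matrix.mul_kronecker_mul,
    Matrix.one_mul]
  rw [← Matrix.one_kronecker_one, ← hK]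
  exact (map_sum (Matrix.kroneckerBilinear (R := R) (1 : Matrix n n R)) _ _).symm

end KrausFamilies

section LOCC

variable {A B A' B' A'' B'' : Type} [Fintype A] [DecidableEq A] [Fintype B] [DecidableEq B]
  [Fintype A'] [DecidableEq A'] [Fintype B'] [DecidableEq B']
  [Fintype A''] [DecidableEq A''] [Fintype B''] [DecidableEq B'']
  {Λ : Matrix (A × B) (A × B) ℂ → Matrix (A' × B') (A' × B') ℂ}

theorem IsLOCC.exists_product_kraus (h : IsLOCC Λ) :
    ∃ (ι : Type) (_ : Fintype ι) (a : ι → Matrix A' A ℂ) (b : ι → Matrix B' B ℂ),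
      ∑ s, (a s ⊗ₖ b s)ᴴ * (a s ⊗ₖ b s) = 1 ∧
      ∀ ρ, Λ ρ = ∑ s, (a s ⊗ₖ b s) * ρ * (a s ⊗ₖ b s)ᴴ := by
  induction h with
  | done => exact ⟨Unit, inferInstance, fun _ => 1, fun _ => 1, by simp, by simp⟩
  | @alice A B _ _ _ _ ι _ A₁ _ _ K hK Λ _ ih =>
    choose κ hκ a b hab hΛ' using ih
    have factor (i s) : (a i s * K i) ⊗ₖ b i s =
        (a i s ⊗ₖ b i s) * (K i ⊗ₖ (1 : Matrix B B ℂ)) := by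
      rw [← Matrix.mul_kronecker_mul, Matrix.mul_one]
    refine ⟨Σ i, κ i, inferInstance, fun x => a x.1 x.2 * K x.1, fun x => b x.1 x.2, ?_,
      fun ρ => ?_⟩
    · simpa only [factor] using sum_sigma_conjTranspose_mul_self (G := fun i s => a i s ⊗ₖ b i s)
        (sum_kronecker_one_conjTranspose_mul_self (n := B) hK) hab
    · simp only [factor, Fintype.sum_sigma, Matrix.conjTranspose_mul, hΛ', Matrix.mul_assoc]
  | @bob A B _ _ _ _ ι _ B₁ _ _ K hK Λ _ ih =>
    choose κ hκ a b hab hΛ' using ih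
    have factor (i s) : a i s ⊗ₖ (b i s * K i) =
        (a i s ⊗ₖ b i s) * ((1 : Matrix A A ℂ) ⊗ₖ K i) := by
      rw [← Matrix.mul_kronecker_mul, Matrix.mul_one]
    refine ⟨Σ i, κ i, inferInstance, fun x => a x.1 x.2, fun x => b x.1 x.2 * K x.1, ?_,
      fun ρ => ?_⟩
    · simpa only [factor] using sum_sigma_conjTranspose_mul_self (G := fun i s => a i s ⊗ₖ b i s)
        (sum_one_kronecker_conjTranspose_mul_self (n := A) hK) hab
    · simp only [factor, Fintype.sum_sigma, Matrix.conjTranspose_mul, hΛ', Matrix.mul_assoc]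

theorem IsLOCC.map_sum (h : IsLOCC Λ) {ι : Type*} (s : Finset ι)
    (ρ : ι → Matrix (A × B) (A × B) ℂ) : Λ (∑ i ∈ s, ρ i) = ∑ i ∈ s, Λ (ρ i) := by
  obtain ⟨κ, _, a, b, -, hΛ⟩ := h.exists_product_kraus
  simp only [hΛ, Matrix.mul_sum, Matrix.sum_mul]
  exact Finset.sum_comm

theorem IsLOCC.map_zero (h : IsLOCC Λ) : Λ 0 = 0 := by
  simpa using h.map_sum (∅ : Finset Unit) 0

theorem IsLOCC.map_sub (h : IsLOCC Λ) (ρ σ : Matrix (A × B) (A × B) ℂ) :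
    Λ (ρ - σ) = Λ ρ - Λ σ := by
  obtain ⟨κ, _, a, b, -, hΛ⟩ := h.exists_product_kraus
  simp only [hΛ, Matrix.mul_sub, Matrix.sub_mul, Finset.sum_sub_distrib]

theorem IsLOCC.posSemidef (h : IsLOCC Λ) {ρ : Matrix (A × B) (A × B) ℂ} (hρ : ρ.PosSemidef) :
    (Λ ρ).PosSemidef := by
  obtain ⟨κ, _, a, b, -, hΛ⟩ := h.exists_product_kraus
  rw [hΛ]
  exact Matrix.posSemidef_sum _ fun s _ => hρ.mul_mul_conjTranspose_same _

theorem IsLOCC.trace_apply (h : IsLOCC Λ) (ρ : Matrix (A × B) (A × B) ℂ) :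
    (Λ ρ).trace = ρ.trace := by
  obtain ⟨κ, _, a, b, hab, hΛ⟩ := h.exists_product_kraus
  calc (Λ ρ).trace = ∑ s, ((a s ⊗ₖ b s)ᴴ * (a s ⊗ₖ b s) * ρ).trace := by
        rw [hΛ, Matrix.trace_sum]
        exact Finset.sum_congr rfl fun s _ => by rw [Matrix.trace_mul_comm, Matrix.mul_assoc]
    _ = ρ.trace := by rw [← Matrix.trace_sum, ← Matrix.sum_mul, hab, Matrix.one_mul]

theorem IsLOCC.isDensity (h : IsLOCC Λ) {ρ : Matrix (A × B) (A × B) ℂ} (hρ : IsDensity ρ) :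
    IsDensity (Λ ρ) :=
  ⟨h.posSemidef hρ.1, (h.trace_apply ρ).trans hρ.2⟩

theorem IsLOCC.comp {Λ' : Matrix (A' × B') (A' × B') ℂ → Matrix (A'' × B'') (A'' × B'') ℂ}
    (h' : IsLOCC Λ') (h : IsLOCC Λ) : IsLOCC fun ρ => Λ' (Λ ρ) := by
  induction h with
  | done => exact h'
  | alice A₁ K hK Λ _ ih =>
    simp only [h'.map_sum]
    exact IsLOCC.alice A₁ K hK (fun i ρ => Λ' (Λ i ρ)) ih
  | bob B₁ K hK Λ _ ih =>
    simp only [h'.map_sum]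
    exact IsLOCC.bob B₁ K hK (fun i ρ => Λ' (Λ i ρ)) ih

theorem isLOCC_alice_isometry {u : Matrix A' A ℂ} (hu : uᴴ * u = 1) :
    IsLOCC fun ρ : Matrix (A × B) (A × B) ℂ =>
      (u ⊗ₖ (1 : Matrix B B ℂ)) * ρ * (u ⊗ₖ (1 : Matrix B B ℂ))ᴴ := by
  simpa using IsLOCC.alice (B := B) (fun _ : Unit => A') (fun _ => u) (by simpa using hu)
    (fun _ ρ => ρ) fun _ => .done

theorem isLOCC_bob_isometry {v : Matrix B' B ℂ} (hv : vᴴ * v = 1) :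
    IsLOCC fun ρ : Matrix (A × B) (A × B) ℂ =>
      ((1 : Matrix A A ℂ) ⊗ₖ v) * ρ * ((1 : Matrix A A ℂ) ⊗ₖ v)ᴴ := by
  simpa using IsLOCC.bob (A := A) (fun _ : Unit => B') (fun _ => v) (by simpa using hv)
    (fun _ ρ => ρ) fun _ => .done

/-- The state `ρ` can be converted to `σ` by LOCC: the preorder that every entanglement monotone
respects. -/
def LOCCConvertible (ρ : Matrix (A × B) (A × B) ℂ) (σ : Matrix (A' × B') (A' × B') ℂ) : Prop :=
  ∃ Λ : Matrix (A × B) (A × B) ℂ → Matrix (A' × B') (A' × B') ℂ, IsLOCC Λ ∧ Λ ρ = σ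

theorem IsLOCC.convertible (h : IsLOCC Λ) (ρ : Matrix (A × B) (A × B) ℂ) :
    LOCCConvertible ρ (Λ ρ) :=
  ⟨Λ, h, rfl⟩

namespace LOCCConvertible

variable {ρ : Matrix (A × B) (A × B) ℂ} {σ : Matrix (A' × B') (A' × B') ℂ}

theorem refl (ρ : Matrix (A × B) (A × B) ℂ) : LOCCConvertible ρ ρ :=
  IsLOCC.done.convertible ρ

theorem trans {τ : Matrix (A'' × B'') (A'' × B'') ℂ} (h : LOCCConvertible ρ σ)
    (h' : LOCCConvertible σ τ) : LOCCConvertible ρ τ := by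
  obtain ⟨Λ, hΛ, rfl⟩ := h
  obtain ⟨Λ', hΛ', rfl⟩ := h'
  exact (hΛ'.comp hΛ).convertible ρ

theorem isDensity (h : LOCCConvertible ρ σ) (hρ : IsDensity ρ) : IsDensity σ := by
  obtain ⟨Λ, hΛ, rfl⟩ := h
  exact hΛ.isDensity hρ

theorem local_isometry {u : Matrix A' A ℂ} {v : Matrix B' B ℂ} (hu : uᴴ * u = 1)
    (hv : vᴴ * v = 1) (ρ : Matrix (A × B) (A × B) ℂ) :
    LOCCConvertible ρ ((u ⊗ₖ v) * ρ * (u ⊗ₖ v)ᴴ) := by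
  have factor : u ⊗ₖ v = ((1 : Matrix A' A' ℂ) ⊗ₖ v) * (u ⊗ₖ (1 : Matrix B B ℂ)) := by
    rw [← Matrix.mul_kronecker_mul, Matrix.one_mul, Matrix.mul_one]
  rw [factor]
  simpa only [Matrix.conjTranspose_mul, Matrix.mul_assoc] using
    ((isLOCC_bob_isometry hv).comp (isLOCC_alice_isometry hu)).convertible ρ

end LOCCConvertible

end LOCC

section PureOp

variable {A B A' B' : Type}

/-- The operator `|ψ⟩⟨ψ|` of the bipartite ket `ψ = ∑ a b, X a b |a b⟩`. A ket is handled through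
its coefficient matrix `X`, so that local operators act on `X` by matrix multiplication. -/
def pureOp (X : Matrix A B ℂ) : Matrix (A × B) (A × B) ℂ :=
  ketBra fun p => X p.1 p.2

theorem pureOp_smul (c : ℂ) (X : Matrix A B ℂ) :
    pureOp (c • X) = (c * star c) • pureOp X := by
  ext x y
  simp only [pureOp, ketBra, Matrix.vecMulVec_apply, Matrix.smul_apply, Pi.star_apply,
    smul_eq_mul, star_mul']
  ring

@[simp]
theorem pureOp_zero : pureOp (0 : Matrix A B ℂ) = 0 := by
  ext x y
  simp [pureOp, ketBra, Matrix.vecMulVec_apply]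

variable [Fintype A] [Fintype B]

theorem kronecker_mul_pureOp_mul (a : Matrix A' A ℂ) (b : Matrix B' B ℂ) (X : Matrix A B ℂ) :
    (a ⊗ₖ b) * pureOp X * (a ⊗ₖ b)ᴴ = pureOp (a * X * bᵀ) := by
  have act : (a ⊗ₖ b) *ᵥ (fun p => X p.1 p.2) = fun p => (a * X * bᵀ) p.1 p.2 := by
    rw [show (fun p : A × B => X p.1 p.2) = Xᵀ.vec from rfl, Matrix.kronecker_mulVec_vec,
      ← Matrix.transpose_transpose b, ← Matrix.transpose_mul, ← Matrix.transpose_mul,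
      Matrix.transpose_transpose, ← Matrix.mul_assoc]
    rfl
  rw [pureOp, ketBra, Matrix.mul_vecMulVec, Matrix.vecMulVec_mul, ← Matrix.star_mulVec, act]
  rfl

theorem kronecker_one_mul_pureOp_mul [DecidableEq B] (K : Matrix A' A ℂ) (X : Matrix A B ℂ) :
    (K ⊗ₖ (1 : Matrix B B ℂ)) * pureOp X * (K ⊗ₖ (1 : Matrix B B ℂ))ᴴ = pureOp (K * X) := by
  rw [kronecker_mul_pureOp_mul, Matrix.transpose_one, Matrix.mul_one]

theorem one_kronecker_mul_pureOp_mul [DecidableEq A] (K : Matrix B' B ℂ) (X : Matrix A B ℂ) :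
    ((1 : Matrix A A ℂ) ⊗ₖ K) * pureOp X * ((1 : Matrix A A ℂ) ⊗ₖ K)ᴴ = pureOp (X * Kᵀ) := by
  rw [kronecker_mul_pureOp_mul, Matrix.one_mul]

theorem trace_pureOp (X : Matrix A B ℂ) : (pureOp X).trace = (X * Xᴴ).trace := by
  simp [pureOp, ketBra, Matrix.trace, Matrix.vecMulVec_apply, Matrix.mul_apply,
    Fintype.sum_prod_type]

theorem isDensity_pureOp {X : Matrix A B ℂ} (hX : (X * Xᴴ).trace = 1) : IsDensity (pureOp X) :=
  ⟨Matrix.posSemidef_vecMulVec_self_star _, (trace_pureOp X).trans hX⟩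

end PureOp

section IncompleteMeasurement

variable {A B A' B' A₁ B₁ : Type} [Fintype A] [DecidableEq A] [Fintype B] [DecidableEq B]
  [Fintype A'] [DecidableEq A'] [Fintype B'] [DecidableEq B']
  [Fintype A₁] [DecidableEq A₁] [Fintype B₁] [DecidableEq B₁]

-- The added Kraus operators are `|x₀⟩⟨x| (1 - P)`, where `P` is the projection `∑ i, (K i)ᴴ * K i`.
theorem sum_elim_single_mul_conjTranspose_mul_self {ι : Type*} [Fintype ι] (x₀ : A₁)
    {K : ι → Matrix A₁ A ℂ} {P : Matrix A A ℂ} (hK : ∑ i, (K i)ᴴ * K i = P)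
    (hP : IsIdempotentElem P) :
    ∑ i, (Sum.elim K (fun x : A => Matrix.single x₀ x (1 : ℂ) * (1 - P)) i)ᴴ *
      (Sum.elim K (fun x : A => Matrix.single x₀ x (1 : ℂ) * (1 - P)) i) = 1 := by
  have hermitian : (1 - P).IsHermitian := by
    rw [← hK]
    exact Matrix.isHermitian_one.sub
      (isSelfAdjoint_sum _ fun i _ => Matrix.isHermitian_conjTranspose_mul_self (K i))
  have added (x : A) : (Matrix.single x₀ x (1 : ℂ) * (1 - P))ᴴ *
      (Matrix.single x₀ x (1 : ℂ) * (1 - P)) = (1 - P) * Matrix.single x x 1 * (1 - P) := by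
    rw [Matrix.conjTranspose_mul, hermitian.eq, Matrix.conjTranspose_single, star_one,
      Matrix.mul_assoc, ← Matrix.mul_assoc (Matrix.single x x₀ _), Matrix.single_mul_single_same,
      mul_one, Matrix.mul_assoc]
  simp only [Fintype.sum_sum_type, Sum.elim_inl, Sum.elim_inr, hK, added]
  rw [← Matrix.sum_mul, ← Matrix.mul_sum, Matrix.sum_single_one, Matrix.mul_one, hP.one_sub.eq,
    add_sub_cancel]

theorem LOCCConvertible.of_alice_measurement {ι : Type} [Fintype ι] [Nonempty A₁]
    {K : ι → Matrix A₁ A ℂ} {P : Matrix A A ℂ} (hK : ∑ i, (K i)ᴴ * K i = P)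
    (hP : IsIdempotentElem P) {X : Matrix A B ℂ} (hX : P * X = X)
    {Λ : ι → Matrix (A₁ × B) (A₁ × B) ℂ → Matrix (A' × B') (A' × B') ℂ} (hΛ : ∀ i, IsLOCC (Λ i))
    {Λ₀ : Matrix (A₁ × B) (A₁ × B) ℂ → Matrix (A' × B') (A' × B') ℂ} (hΛ₀ : IsLOCC Λ₀) :
    LOCCConvertible (pureOp X) (∑ i, Λ i (pureOp (K i * X))) := by
  let x₀ : A₁ := Classical.arbitrary _
  refine ⟨_, IsLOCC.alice (fun _ => A₁) _ (sum_elim_single_mul_conjTranspose_mul_self x₀ hK hP)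
    (Sum.elim Λ fun _ => Λ₀) ?_, ?_⟩
  · rintro (i | _)
    exacts [hΛ i, hΛ₀]
  · simp only [kronecker_one_mul_pureOp_mul, Fintype.sum_sum_type, Sum.elim_inl, Sum.elim_inr,
      Matrix.mul_assoc _ (1 - P), Matrix.sub_mul, Matrix.one_mul, hX, sub_self, Matrix.mul_zero,
      pureOp_zero, hΛ₀.map_zero, Finset.sum_const_zero, add_zero]

theorem LOCCConvertible.of_bob_measurement [Nonempty B₁] {K : Matrix B₁ B ℂ}
    (hP : IsIdempotentElem (Kᴴ * K)) {X : Matrix A B ℂ} (hX : X * (Kᴴ * K)ᵀ = X) :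
    LOCCConvertible (pureOp X) (pureOp (X * Kᵀ)) := by
  let x₀ : B₁ := Classical.arbitrary _
  have hK : ∑ _ : Unit, Kᴴ * K = Kᴴ * K := by simp
  have vanish (x : B) : X * (Matrix.single x₀ x (1 : ℂ) * (1 - Kᴴ * K))ᵀ = 0 := by
    rw [Matrix.transpose_mul, ← Matrix.mul_assoc, Matrix.transpose_sub, Matrix.transpose_one,
      Matrix.mul_sub, Matrix.mul_one, hX, sub_self, Matrix.zero_mul]
  refine ⟨_, IsLOCC.bob (fun _ => B₁) _ (sum_elim_single_mul_conjTranspose_mul_self x₀ hK hP)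
    (fun _ ρ => ρ) fun _ => .done, ?_⟩
  simp only [one_kronecker_mul_pureOp_mul, Fintype.sum_sum_type, Sum.elim_inl, Sum.elim_inr,
    vanish, pureOp_zero, Finset.sum_const_zero, add_zero, Finset.univ_unique,
    Finset.sum_singleton]

end IncompleteMeasurement

/-! ### One-way protocols on pure states -/

theorem mul_eq_self_of_sum_mul_conjTranspose_eq {A C ι : Type*} [Fintype A] [Fintype C]
    [Fintype ι] {τ : Matrix A A ℂ} {S : ι → Matrix A C ℂ} {P : Matrix A A ℂ} (hP : P * τ = τ)
    (hS : ∑ i, S i * (S i)ᴴ = τ) (i : ι) : P * S i = S i := by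
  classical
  have sum_eq_zero : ∑ i, ((1 - P) * S i) * ((1 - P) * S i)ᴴ = 0 := by
    calc ∑ i, ((1 - P) * S i) * ((1 - P) * S i)ᴴ
        = (1 - P) * (∑ i, S i * (S i)ᴴ) * (1 - P)ᴴ := by
          simp only [Matrix.conjTranspose_mul, Matrix.mul_sum, Matrix.sum_mul, Matrix.mul_assoc]
      _ = 0 := by rw [hS, Matrix.sub_mul, Matrix.one_mul, hP, sub_self, Matrix.zero_mul]
  have eq_zero : ((1 - P) * S i) * ((1 - P) * S i)ᴴ = 0 := by
    open scoped MatrixOrder in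
    exact (Finset.sum_eq_zero_iff_of_nonneg fun i _ =>
      (Matrix.posSemidef_self_mul_conjTranspose ((1 - P) * S i)).nonneg).1 sum_eq_zero i
        (Finset.mem_univ i)
  rw [Matrix.self_mul_conjTranspose_eq_zero, Matrix.sub_mul, Matrix.one_mul, sub_eq_zero]
    at eq_zero
  exact eq_zero.symm

section InverseSqrt

variable {A : Type*} [Fintype A] [DecidableEq A] {τ : Matrix A A ℂ}

theorem cfc_mul_cfc (f g : ℝ → ℝ) (τ : Matrix A A ℂ) :
    cfc f τ * cfc g τ = cfc (fun x => f x * g x) τ :=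
  (cfc_mul f g τ (τ.finite_real_spectrum.continuousOn f)
    (τ.finite_real_spectrum.continuousOn g)).symm

/-- The projection onto the support of a Hermitian matrix `τ`. -/
def supportProj (τ : Matrix A A ℂ) : Matrix A A ℂ :=
  cfc (fun x : ℝ => if x = 0 then 0 else 1) τ

/-- The Moore-Penrose inverse of the square root of a positive semidefinite matrix `τ`. -/
def invSqrt (τ : Matrix A A ℂ) : Matrix A A ℂ :=
  cfc (fun x : ℝ => (√x)⁻¹) τ

theorem isIdempotentElem_supportProj (τ : Matrix A A ℂ) : IsIdempotentElem (supportProj τ) := by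
  rw [IsIdempotentElem, supportProj, cfc_mul_cfc]
  exact congrArg (cfc · τ) (funext fun x => by split_ifs <;> simp)

theorem supportProj_mul_self (hτ : τ.IsHermitian) : supportProj τ * τ = τ := by
  have hsa : IsSelfAdjoint τ := hτ
  calc supportProj τ * τ = supportProj τ * cfc id τ := by rw [cfc_id ℝ τ]
    _ = cfc id τ := by
        rw [supportProj, cfc_mul_cfc]
        exact congrArg (cfc · τ) (funext fun x => by split_ifs with h <;> simp [h])
    _ = τ := cfc_id ℝ τ

theorem isHermitian_invSqrt (τ : Matrix A A ℂ) : (invSqrt τ).IsHermitian :=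
  cfc_predicate _ τ

theorem commute_invSqrt (τ : Matrix A A ℂ) : Commute (invSqrt τ) τ :=
  (Commute.refl τ).cfc_real _

theorem supportProj_mul_invSqrt (τ : Matrix A A ℂ) : supportProj τ * invSqrt τ = invSqrt τ := by
  rw [supportProj, invSqrt, cfc_mul_cfc]
  exact congrArg (cfc · τ) (funext fun x => by split_ifs with h <;> simp [h])

theorem invSqrt_mul_mul_invSqrt (hτ : τ.PosSemidef) :
    invSqrt τ * τ * invSqrt τ = supportProj τ := by
  have hsa : IsSelfAdjoint τ := hτ.isHermitian
  calc invSqrt τ * τ * invSqrt τ = invSqrt τ * cfc id τ * invSqrt τ := by rw [cfc_id ℝ τ]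
    _ = cfc (fun x : ℝ => (√x)⁻¹ * x * (√x)⁻¹) τ := by
        rw [invSqrt, cfc_mul_cfc, cfc_mul_cfc]
        rfl
    _ = supportProj τ := cfc_congr fun x hx => by
        have nonneg : 0 ≤ x := by
          open scoped MatrixOrder in exact spectrum_nonneg_of_nonneg hτ.nonneg hx
        have sq : √x * √x = x := Real.mul_self_sqrt nonneg
        split_ifs with h
        · simp [h]
        · have := Real.sqrt_ne_zero'.2 (nonneg.lt_of_ne' h)
          field_simp
          rw [pow_two, sq]

theorem mul_invSqrt_mul_invSqrt (hτ : τ.PosSemidef) :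
    τ * invSqrt τ * invSqrt τ = supportProj τ := by
  rw [← (commute_invSqrt τ).eq, invSqrt_mul_mul_invSqrt hτ]

theorem supportProj_mul_eq_self {B : Type*} [Fintype B] {Z : Matrix A B ℂ} (hZ : Z * Zᴴ = τ) :
    supportProj τ * Z = Z :=
  mul_eq_self_of_sum_mul_conjTranspose_eq (S := fun _ : Unit => Z)
    (supportProj_mul_self (hZ ▸ Matrix.isHermitian_mul_conjTranspose_self Z))
    (by rw [Fintype.sum_unique, hZ]) ()

theorem mul_conjTranspose_mul_invSqrt_mul_eq_self {B C : Type*} [Fintype B] [Fintype C]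
    {Y : Matrix A B ℂ} {Z : Matrix A C ℂ} (h : Z * Zᴴ = Y * Yᴴ) :
    Y * (Yᴴ * invSqrt (Y * Yᴴ) * invSqrt (Y * Yᴴ) * Z) = Z := by
  rw [← Matrix.mul_assoc, ← Matrix.mul_assoc, ← Matrix.mul_assoc,
    mul_invSqrt_mul_invSqrt (Matrix.posSemidef_self_mul_conjTranspose Y),
    supportProj_mul_eq_self h]

end InverseSqrt

-- The partial isometry is `W = Yᴴ τ⁻¹ T`, where `τ = Y * Yᴴ`.
theorem exists_mul_eq_of_mul_conjTranspose_eq {A B C : Type*} [Finite A] [Fintype B] [Fintype C]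
    {Y : Matrix A B ℂ} {T : Matrix A C ℂ} (h : Y * Yᴴ = T * Tᴴ) :
    ∃ W : Matrix B C ℂ, Y * W = T ∧ IsIdempotentElem (W * Wᴴ) ∧ Y * (W * Wᴴ) = Y := by
  classical
  have := Fintype.ofFinite A
  set R := invSqrt (Y * Yᴴ) with hR
  have herm : Rᴴ = R := isHermitian_invSqrt _
  have mul_self : Y * (Yᴴ * R * R * Y) = Y := mul_conjTranspose_mul_invSqrt_mul_eq_self rfl
  have range_proj : (Yᴴ * R * R * T) * (Yᴴ * R * R * T)ᴴ = Yᴴ * R * R * Y :=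
    calc (Yᴴ * R * R * T) * (Yᴴ * R * R * T)ᴴ
        = Yᴴ * R * ((R * (T * Tᴴ) * R) * R) * Y := by
          simp only [Matrix.conjTranspose_mul, herm, Matrix.conjTranspose_conjTranspose,
            Matrix.mul_assoc]
      _ = Yᴴ * R * R * Y := by
          rw [← h, hR, invSqrt_mul_mul_invSqrt (Matrix.posSemidef_self_mul_conjTranspose Y),
            supportProj_mul_invSqrt]
  refine ⟨_, mul_conjTranspose_mul_invSqrt_mul_eq_self h.symm, ?_, ?_⟩
  · rw [range_proj, IsIdempotentElem, Matrix.mul_assoc _ Y, mul_self]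
  · rw [range_proj, mul_self]

namespace LOCCConvertible

variable {A B A' B' : Type} [Fintype A] [DecidableEq A] [Fintype B] [DecidableEq B]
  [Fintype A'] [DecidableEq A'] [Fintype B'] [DecidableEq B'] [Nonempty B']

theorem of_mul_conjTranspose_eq {Y : Matrix A B ℂ} {T : Matrix A B' ℂ} (h : Y * Yᴴ = T * Tᴴ) :
    LOCCConvertible (pureOp Y) (pureOp T) := by
  obtain ⟨W, rfl, idem, support⟩ := exists_mul_eq_of_mul_conjTranspose_eq h
  have transpose : Wᵀᴴ * Wᵀ = (W * Wᴴ)ᵀ := (Matrix.transpose_mul W Wᴴ).symm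
  simpa only [Matrix.transpose_transpose] using of_bob_measurement (K := Wᵀ) (X := Y)
    (by rw [transpose, IsIdempotentElem, ← Matrix.transpose_mul, idem.eq])
    (by rw [transpose, Matrix.transpose_transpose, support])

-- Alice measures with `K i = (S i)ᴴ τ⁻¹ᐟ²`, where `τ = X * Xᴴ`, and Bob adapts his purification.
theorem of_sum_mul_conjTranspose_eq [Nonempty A'] {ι : Type} [Fintype ι] {X : Matrix A B ℂ}
    {S : ι → Matrix A A' ℂ} {T : ι → Matrix A' B' ℂ} (hS : ∑ i, S i * (S i)ᴴ = X * Xᴴ)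
    (hT : ∀ i, T i * (T i)ᴴ = (S i)ᴴ * S i) :
    LOCCConvertible (pureOp X) (∑ i, pureOp (T i)) := by
  set τ := X * Xᴴ with hτ
  have psd : τ.PosSemidef := Matrix.posSemidef_self_mul_conjTranspose X
  have herm : (invSqrt τ)ᴴ = invSqrt τ := isHermitian_invSqrt τ
  have support_S (i : ι) : supportProj τ * S i = S i :=
    mul_eq_self_of_sum_mul_conjTranspose_eq (supportProj_mul_self psd.isHermitian) hS i
  let K (i : ι) : Matrix A' A ℂ := (S i)ᴴ * invSqrt τ
  have sum_K : ∑ i, (K i)ᴴ * K i = supportProj τ :=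
    calc ∑ i, (K i)ᴴ * K i = invSqrt τ * (∑ i, S i * (S i)ᴴ) * invSqrt τ := by
          simp only [K, Matrix.conjTranspose_mul, Matrix.conjTranspose_conjTranspose, herm,
            Matrix.mul_sum, Matrix.sum_mul, Matrix.mul_assoc]
      _ = supportProj τ := by rw [hS, invSqrt_mul_mul_invSqrt psd]
  have after_K (i : ι) : K i * X * (K i * X)ᴴ = T i * (T i)ᴴ :=
    calc K i * X * (K i * X)ᴴ = (S i)ᴴ * ((invSqrt τ * (X * Xᴴ) * invSqrt τ) * S i) := by
          simp only [K, Matrix.conjTranspose_mul, Matrix.conjTranspose_conjTranspose, herm,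
            Matrix.mul_assoc]
      _ = T i * (T i)ᴴ := by rw [← hτ, invSqrt_mul_mul_invSqrt psd, support_S, hT]
  choose Λ hΛ hΛT using fun i => of_mul_conjTranspose_eq (after_K i)
  obtain ⟨Λ₀, hΛ₀, -⟩ := of_mul_conjTranspose_eq (Y := (0 : Matrix A' B ℂ))
    (T := (0 : Matrix A' B' ℂ)) (by simp)
  simpa only [hΛT] using
    of_alice_measurement sum_K (isIdempotentElem_supportProj τ)
      (supportProj_mul_eq_self hτ.symm) hΛ hΛ₀

end LOCCConvertible

/-! ### Conversion to and from maximally entangled states -/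

section HypersimplexVertices

variable {A : Type*} [Fintype A] {s : Finset A} {x : A → ℝ}

theorem sum_const_div_card (h0 : ∀ i, 0 ≤ x i) (hs : ∑ i, x i = s.card) (i : A) :
    ∑ _a ∈ s, x i / s.card = x i := by
  rw [Finset.sum_const, nsmul_eq_mul]
  refine mul_div_cancel_of_imp' fun hcard => ?_
  rw [hcard] at hs
  exact (Finset.sum_eq_zero_iff_of_nonneg fun i _ => h0 i).1 hs i (Finset.mem_univ i)

theorem sum_div_card_of_mem (hs : ∑ i, x i = s.card) {a : A} (ha : a ∈ s) :
    ∑ i, x i / s.card = 1 := by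
  rw [← Finset.sum_div, hs, div_self (Nat.cast_ne_zero.2 (Finset.card_ne_zero_of_mem ha))]

variable [DecidableEq A]

theorem mem_doublyStochastic_of_sum_eq_card (h0 : ∀ i, 0 ≤ x i) (h1 : ∀ i, x i ≤ 1)
    (hs : ∑ i, x i = s.card) :
    Matrix.of (fun a i => if a ∈ s then x i / s.card else (1 - x i) / sᶜ.card) ∈
      doublyStochastic ℝ A := by
  have h0' (i : A) : 0 ≤ 1 - x i := sub_nonneg.2 (h1 i)
  have hs' : ∑ i, (1 - x i) = sᶜ.card := by
    rw [Finset.sum_sub_distrib, hs, Finset.card_compl, Nat.cast_sub s.card_le_univ]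
    simp
  rw [mem_doublyStochastic_iff_sum]
  refine ⟨fun a i => ?_, fun a => ?_, fun i => ?_⟩
  · rw [Matrix.of_apply]
    split_ifs
    exacts [div_nonneg (h0 i) (Nat.cast_nonneg _), div_nonneg (h0' i) (Nat.cast_nonneg _)]
  · simp only [Matrix.of_apply]
    split_ifs with ha
    exacts [sum_div_card_of_mem hs ha, sum_div_card_of_mem hs' (Finset.mem_compl.2 ha)]
  · simp only [Matrix.of_apply]
    rw [← Finset.sum_add_sum_compl s, Finset.sum_congr rfl fun a ha => if_pos ha,
      Finset.sum_congr rfl fun a ha => if_neg (Finset.mem_compl.1 ha),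
      sum_const_div_card h0 hs, sum_const_div_card h0' hs', add_sub_cancel]

-- By Birkhoff's theorem: `x` is the sum of the rows in `s` of a doubly stochastic matrix.
theorem exists_sum_perm_single_eq (h0 : ∀ i, 0 ≤ x i) (h1 : ∀ i, x i ≤ 1)
    (hs : ∑ i, x i = s.card) :
    ∃ w : Equiv.Perm A → ℝ, (∀ σ, 0 ≤ w σ) ∧ ∑ σ, w σ = 1 ∧
      ∑ σ, w σ • ∑ a ∈ s, Pi.single (σ a) 1 = x := by
  obtain ⟨w, hw0, hw1, hw⟩ :=
    exists_eq_sum_perm_of_mem_doublyStochastic (mem_doublyStochastic_of_sum_eq_card h0 h1 hs)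
  refine ⟨w, hw0, hw1, funext fun i => ?_⟩
  have row {a : A} (ha : a ∈ s) : ∑ σ, w σ * (Pi.single (σ a) 1 : A → ℝ) i = x i / s.card := by
    have entry := congrFun (congrFun hw a) i
    rw [Matrix.of_apply, if_pos ha, Matrix.sum_apply] at entry
    rw [← entry]
    refine Finset.sum_congr rfl fun σ _ => ?_
    simp [Equiv.Perm.permMatrix, PEquiv.toMatrix_apply, Pi.single_apply, eq_comm]
  simp only [Finset.sum_apply, Pi.smul_apply, smul_eq_mul, Finset.mul_sum]
  rw [Finset.sum_comm, Finset.sum_congr rfl fun a ha => row ha, sum_const_div_card h0 hs]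

end HypersimplexVertices

theorem conjTranspose_submatrix_one_mul_self {A C : Type*} [Fintype A] [DecidableEq A]
    [DecidableEq C] {e : C → A} (he : Function.Injective e) :
    ((1 : Matrix A A ℂ).submatrix id e)ᴴ * (1 : Matrix A A ℂ).submatrix id e = 1 := by
  rw [Matrix.conjTranspose_submatrix, Matrix.conjTranspose_one,
    ← Matrix.submatrix_mul _ _ e id e Function.bijective_id, Matrix.one_mul,
    Matrix.submatrix_one _ he]

theorem submatrix_one_mul_conjTranspose_self {A C : Type*} [DecidableEq A] [Fintype C]
    (e : C → A) :
    (1 : Matrix A A ℂ).submatrix id e * ((1 : Matrix A A ℂ).submatrix id e)ᴴ =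
      Matrix.diagonal (∑ c, Pi.single (e c) 1) := by
  ext a b
  rcases eq_or_ne a b with rfl | hab
  · rw [Matrix.diagonal_apply_eq, Finset.sum_apply]
    refine Finset.sum_congr rfl fun c _ => ?_
    by_cases hc : a = e c <;> simp [Matrix.one_apply, hc]
  · rw [Matrix.diagonal_apply_ne _ hab]
    refine Finset.sum_eq_zero fun c _ => ?_
    rcases eq_or_ne a (e c) with rfl | ha
    · simp [hab.symm]
    · simp [ha]

theorem eq_eigenvectorUnitary_mul_diagonal_mul {A : Type*} [Fintype A] [DecidableEq A]
    {τ : Matrix A A ℂ} (hτ : τ.IsHermitian) :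
    τ = (hτ.eigenvectorUnitary : Matrix A A ℂ) *
      Matrix.diagonal (fun i => (hτ.eigenvalues i : ℂ)) *
        (hτ.eigenvectorUnitary : Matrix A A ℂ)ᴴ := by
  conv_lhs => rw [hτ.spectral_theorem, Unitary.conjStarAlgAut_apply]
  rfl

section Hypersimplex

variable {A : Type*} [Fintype A] [DecidableEq A] {k : ℕ}

theorem exists_sum_isometry_eq_diagonal (hk : 0 < k) {l : A → ℝ} (h0 : ∀ i, 0 ≤ l i)
    (hle : ∀ i, l i ≤ 1 / k) (hl : ∑ i, l i = 1) :
    ∃ (w : Equiv.Perm A → ℝ) (V : Equiv.Perm A → Matrix A (Fin k) ℂ), (∀ σ, 0 ≤ w σ) ∧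
      ∑ σ, w σ = 1 ∧ (∀ σ, (V σ)ᴴ * V σ = 1) ∧
      ∑ σ, ((w σ / k : ℝ) : ℂ) • (V σ * (V σ)ᴴ) = Matrix.diagonal fun i => (l i : ℂ) := by
  have hk' : (0 : ℝ) < k := Nat.cast_pos.2 hk
  have le_one (i : A) : k * l i ≤ 1 := (le_div_iff₀' hk').1 (hle i)
  have sum_eq : ∑ i, k * l i = k := by rw [← Finset.mul_sum, hl, mul_one]
  have card_le : (k : ℝ) ≤ Fintype.card A := by
    simpa [sum_eq] using Finset.sum_le_sum fun i (_ : i ∈ Finset.univ) => le_one i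
  obtain ⟨f⟩ : Nonempty (Fin k ↪ A) :=
    Function.Embedding.nonempty_of_card_le (by simpa using card_le)
  obtain ⟨w, hw0, hw1, hw⟩ := exists_sum_perm_single_eq (s := Finset.univ.map f)
    (fun i => mul_nonneg hk'.le (h0 i)) le_one (by simpa using sum_eq)
  refine ⟨w, fun σ => (1 : Matrix A A ℂ).submatrix id (σ ∘ f), hw0, hw1,
    fun σ => conjTranspose_submatrix_one_mul_self (σ.injective.comp f.injective), ?_⟩
  have entry (i : A) : ∑ σ, w σ / k * ∑ c, (Pi.single (σ (f c)) 1 : A → ℝ) i = l i := by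
    have hi : ∑ σ, w σ * ∑ c, (Pi.single (σ (f c)) 1 : A → ℝ) i = k * l i := by
      simpa [Finset.sum_apply] using congrFun hw i
    simp only [div_mul_eq_mul_div, ← Finset.sum_div, hi]
    exact mul_div_cancel_left₀ _ hk'.ne'
  have sum_single : ∑ σ, ((w σ / k : ℝ) : ℂ) • ∑ c, Pi.single (σ (f c)) 1 =
      fun i => (l i : ℂ) := by
    ext i
    simp only [Finset.sum_apply, Pi.smul_apply, smul_eq_mul, ← entry, Pi.single_apply]
    push_cast [Nat.cast_ite]
    simp only [apply_ite Complex.ofReal, Complex.ofReal_one, Complex.ofReal_zero]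
  simp_rw [submatrix_one_mul_conjTranspose_self, ← sum_single, ← Matrix.diagonal_smul]
  exact (map_sum (Matrix.diagonalAddMonoidHom A ℂ) _ _).symm

theorem exists_sum_isometry_eq {τ : Matrix A A ℂ} (hτ : τ.PosSemidef) (htr : τ.trace = 1)
    (hk : 0 < k) (hle : ∀ x ∈ spectrum ℝ τ, x ≤ 1 / k) :
    ∃ (w : Equiv.Perm A → ℝ) (V : Equiv.Perm A → Matrix A (Fin k) ℂ), (∀ σ, 0 ≤ w σ) ∧
      ∑ σ, w σ = 1 ∧ (∀ σ, (V σ)ᴴ * V σ = 1) ∧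
      ∑ σ, ((w σ / k : ℝ) : ℂ) • (V σ * (V σ)ᴴ) = τ := by
  have hτ' := hτ.isHermitian
  have sum_eigenvalues : ∑ i, hτ'.eigenvalues i = 1 := by
    refine Complex.ofReal_injective ?_
    rw [Complex.ofReal_sum, Complex.ofReal_one, ← htr]
    exact hτ'.trace_eq_sum_eigenvalues.symm
  obtain ⟨w, V, hw0, hw1, hV, hsum⟩ := exists_sum_isometry_eq_diagonal hk hτ.eigenvalues_nonneg
    (fun i => hle _ (hτ'.eigenvalues_mem_spectrum_real i)) sum_eigenvalues
  let U : Matrix A A ℂ := (hτ'.eigenvectorUnitary : Matrix A A ℂ)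
  have hUU : Uᴴ * U = 1 := Unitary.coe_star_mul_self hτ'.eigenvectorUnitary
  refine ⟨w, fun σ => U * V σ, hw0, hw1, fun σ => ?_, ?_⟩
  · rw [Matrix.conjTranspose_mul, Matrix.mul_assoc, ← Matrix.mul_assoc Uᴴ, hUU, Matrix.one_mul, hV]
  · have conj (σ : Equiv.Perm A) : ((w σ / k : ℝ) : ℂ) • (U * V σ * (U * V σ)ᴴ) =
        U * ((w σ / k : ℝ) : ℂ) • (V σ * (V σ)ᴴ) * Uᴴ := by
      rw [Matrix.mul_smul, Matrix.smul_mul, Matrix.conjTranspose_mul]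
      simp only [Matrix.mul_assoc]
    rw [Finset.sum_congr rfl fun σ _ => conj σ]
    rw [← Finset.sum_mul, ← Finset.mul_sum, hsum]
    exact (eq_eigenvectorUnitary_mul_diagonal_mul hτ').symm

end Hypersimplex

section SqrtSMul

variable {A B : Type*} {x : ℝ}

theorem sqrt_mul_star_sqrt (hx : 0 ≤ x) : ((√x : ℝ) : ℂ) * star ((√x : ℝ) : ℂ) = (x : ℂ) := by
  rw [Complex.star_def, Complex.conj_ofReal, ← Complex.ofReal_mul, Real.mul_self_sqrt hx]

theorem sqrt_smul_mul_conjTranspose [Fintype B] (hx : 0 ≤ x) (X : Matrix A B ℂ) :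
    (((√x : ℝ) : ℂ) • X) * (((√x : ℝ) : ℂ) • X)ᴴ = (x : ℂ) • (X * Xᴴ) := by
  rw [Matrix.conjTranspose_smul, Matrix.smul_mul, Matrix.mul_smul, smul_smul,
    sqrt_mul_star_sqrt hx]

theorem conjTranspose_sqrt_smul_mul [Fintype A] (hx : 0 ≤ x) (X : Matrix A B ℂ) :
    (((√x : ℝ) : ℂ) • X)ᴴ * (((√x : ℝ) : ℂ) • X) = (x : ℂ) • (Xᴴ * X) := by
  rw [Matrix.conjTranspose_smul, Matrix.smul_mul, Matrix.mul_smul, smul_smul, mul_comm,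
    sqrt_mul_star_sqrt hx]

theorem pureOp_sqrt_smul {A B : Type} (hx : 0 ≤ x) (X : Matrix A B ℂ) :
    pureOp (((√x : ℝ) : ℂ) • X) = (x : ℂ) • pureOp X := by
  rw [pureOp_smul, sqrt_mul_star_sqrt hx]

end SqrtSMul

section MaxEntangled

variable {A B : Type} [Fintype A] [Fintype B]

/-- The coefficient matrix of the maximally entangled ket of Schmidt rank `card B` on `B ⊗ B`. -/
def uniformCoeff (B : Type) [Fintype B] [DecidableEq B] : Matrix B B ℂ :=
  ((1 / √(Fintype.card B : ℝ) : ℝ) : ℂ) • 1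

theorem uniformCoeff_mul_conjTranspose [DecidableEq B] :
    uniformCoeff B * (uniformCoeff B)ᴴ = ((Fintype.card B : ℝ)⁻¹ : ℂ) • 1 := by
  rw [uniformCoeff, Matrix.conjTranspose_smul, Matrix.conjTranspose_one, Matrix.smul_mul,
    Matrix.mul_smul, Matrix.mul_one, smul_smul, Complex.star_def, Complex.conj_ofReal,
    ← Complex.ofReal_mul, div_mul_div_comm, Real.mul_self_sqrt (Nat.cast_nonneg _)]
  simp

theorem ketBra_stdMaxEntangled (m : ℕ) :
    ketBra (stdMaxEntangled m) = pureOp (uniformCoeff (Fin m)) := by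
  refine congrArg ketBra (funext fun p => ?_)
  simp [stdMaxEntangled, uniformCoeff, Matrix.one_apply]

theorem IsMaxEntangled.exists_isometry {k : ℕ} {Φ : A × B → ℂ} (hΦ : IsMaxEntangled k Φ) :
    ∃ (u : Matrix A (Fin k) ℂ) (v : Matrix B (Fin k) ℂ), uᴴ * u = 1 ∧ vᴴ * v = 1 ∧
      ketBra Φ = pureOp (u * uniformCoeff (Fin k) * vᵀ) := by
  obtain ⟨u, v, hu, hv, h⟩ := hΦ
  refine ⟨u, v, hu, hv, congrArg ketBra (funext fun ⟨a, b⟩ => ?_)⟩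
  simp [h, uniformCoeff, Matrix.mul_apply, Finset.mul_sum, mul_assoc]

variable {A' B' : Type} [Fintype A'] [DecidableEq A'] [Fintype B'] [DecidableEq B']

-- `X * Xᴴ` is a mixture of normalized projections of rank `k`, one for each outcome of the
-- measurement.
theorem LOCCConvertible.maxEntangled [DecidableEq A] [DecidableEq B] {k : ℕ} (hk : 0 < k)
    {X : Matrix A B ℂ} (htr : (X * Xᴴ).trace = 1)
    (hle : ∀ x ∈ spectrum ℝ (X * Xᴴ), x ≤ 1 / k) {Φ : A' × B' → ℂ} (hΦ : IsMaxEntangled k Φ) :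
    LOCCConvertible (pureOp X) (ketBra Φ) := by
  have : NeZero k := ⟨hk.ne'⟩
  obtain ⟨w, V, hw0, hw1, hV, hsum⟩ :=
    exists_sum_isometry_eq (Matrix.posSemidef_self_mul_conjTranspose X) htr hk hle
  obtain ⟨u, v, hu, hv, hΦu⟩ := hΦ.exists_isometry
  have hw (σ : Equiv.Perm A) : 0 ≤ w σ / k := div_nonneg (hw0 σ) k.cast_nonneg
  have key : LOCCConvertible (pureOp X)
      (∑ σ, pureOp (((√(w σ) : ℝ) : ℂ) • uniformCoeff (Fin k))) := by
    refine .of_sum_mul_conjTranspose_eq (S := fun σ => ((√(w σ / k) : ℝ) : ℂ) • V σ) ?_ fun σ => ?_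
    · simp only [sqrt_smul_mul_conjTranspose (hw _), hsum]
    · rw [sqrt_smul_mul_conjTranspose (hw0 σ), conjTranspose_sqrt_smul_mul (hw σ), hV,
        uniformCoeff_mul_conjTranspose, smul_smul, Fintype.card_fin, div_eq_mul_inv]
      push_cast
      rfl
  have sum_eq : ∑ σ, pureOp (((√(w σ) : ℝ) : ℂ) • uniformCoeff (Fin k)) =
      pureOp (uniformCoeff (Fin k)) := by
    simp only [pureOp_sqrt_smul (hw0 _)]
    rw [← Finset.sum_smul, ← Complex.ofReal_sum, hw1, Complex.ofReal_one, one_smul]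
  rw [sum_eq] at key
  have local_isometry := LOCCConvertible.local_isometry hu hv (pureOp (uniformCoeff (Fin k)))
  rw [kronecker_mul_pureOp_mul, ← hΦu] at local_isometry
  exact key.trans local_isometry

end MaxEntangled

section Preparation

theorem exists_sum_pureOp_eq {A B : Type} [Finite A] [Finite B] {ρ : Matrix (A × B) (A × B) ℂ}
    (hρ : ρ.PosSemidef) : ∃ (m : ℕ) (Ξ : Fin m → Matrix A B ℂ), ∑ i, pureOp (Ξ i) = ρ := by
  have := Fintype.ofFinite A
  have := Fintype.ofFinite B
  obtain ⟨m, ξ, hξ⟩ := Matrix.posSemidef_iff_eq_sum_vecMulVec.1 hρ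
  exact ⟨m, fun i => Matrix.of fun a b => ξ i (a, b), hξ.symm⟩

variable {A B : Type} [Fintype A] [DecidableEq A] [Fintype B] [DecidableEq B]

-- Average over the powers of a cyclic permutation of an eigenbasis of `M`.
theorem exists_sum_unitary_conj_eq_trace_smul_one [AddCommGroup B] {M : Matrix B B ℂ}
    (hM : M.IsHermitian) :
    ∃ W : B → Matrix B B ℂ, (∀ t, (W t)ᴴ * W t = 1) ∧ ∑ t, W t * M * (W t)ᴴ = M.trace • 1 := by
  let U : Matrix B B ℂ := (hM.eigenvectorUnitary : Matrix B B ℂ)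
  have hU : U * Uᴴ = 1 := Unitary.coe_mul_star_self hM.eigenvectorUnitary
  have hU' : Uᴴ * U = 1 := Unitary.coe_star_mul_self hM.eigenvectorUnitary
  have hUM : Uᴴ * M * U = Matrix.diagonal fun i => (hM.eigenvalues i : ℂ) := by
    conv_lhs => rw [eq_eigenvectorUnitary_mul_diagonal_mul hM]
    simp only [Matrix.mul_assoc]
    rw [hU', Matrix.mul_one, ← Matrix.mul_assoc, hU', Matrix.one_mul]
  refine ⟨fun t => Uᴴ.submatrix (t + ·) id, fun t => ?_, ?_⟩
  · rw [Matrix.conjTranspose_submatrix, Matrix.conjTranspose_conjTranspose,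
      ← Matrix.submatrix_mul _ _ id (t + ·) id (Equiv.addLeft t).bijective, hU,
      Matrix.submatrix_id_id]
  · have conj (t : B) : Uᴴ.submatrix (t + ·) id * M * (Uᴴ.submatrix (t + ·) id)ᴴ =
        Matrix.diagonal fun i => (hM.eigenvalues (t + i) : ℂ) :=
      calc _ = (Uᴴ * M * U).submatrix (t + ·) (t + ·) := by
            rw [Matrix.conjTranspose_submatrix, Matrix.conjTranspose_conjTranspose]
            rfl
        _ = _ := by
            rw [hUM]
            exact Matrix.submatrix_diagonal_equiv _ (Equiv.addLeft t)
    have trace_eq (i : B) : ∑ t, (hM.eigenvalues (t + i) : ℂ) = M.trace := by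
      rw [hM.trace_eq_sum_eigenvalues]
      exact Equiv.sum_comp (Equiv.addRight i) fun j => (hM.eigenvalues j : ℂ)
    simp only [conj]
    rw [Matrix.smul_one_eq_diagonal]
    refine (map_sum (Matrix.diagonalAddMonoidHom B ℂ)
      (fun t i => (hM.eigenvalues (t + i) : ℂ)) _).symm.trans (congrArg Matrix.diagonal ?_)
    exact funext fun i => (Finset.sum_apply _ _ _).trans (trace_eq i)

theorem LOCCConvertible.of_uniformCoeff [AddCommGroup B] {ρ : Matrix (A × B) (A × B) ℂ}
    (hρ : IsDensity ρ) : LOCCConvertible (pureOp (uniformCoeff B)) ρ := by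
  obtain ⟨⟨a, -⟩⟩ : Nonempty (A × B) := by
    by_contra! h
    simpa [Matrix.trace] using hρ.2
  have : Nonempty A := ⟨a⟩
  obtain ⟨m, Ξ, sum_Ξ⟩ := exists_sum_pureOp_eq hρ.1
  have trace_sum : ∑ i, ((Ξ i)ᴴ * Ξ i).trace = 1 := by
    rw [← hρ.2, ← sum_Ξ, Matrix.trace_sum]
    exact Finset.sum_congr rfl fun i _ => by rw [trace_pureOp, Matrix.trace_mul_comm]
  choose W hW hWsum using fun i =>
    exists_sum_unitary_conj_eq_trace_smul_one (Matrix.isHermitian_conjTranspose_mul_self (Ξ i))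
  have hc : (0 : ℝ) ≤ (Fintype.card B : ℝ)⁻¹ := by positivity
  set c : ℝ := (Fintype.card B : ℝ)⁻¹ with hc_def
  have key : LOCCConvertible (pureOp (uniformCoeff B))
      (∑ y : Fin m × B, pureOp (((√c : ℝ) : ℂ) • Ξ y.1)) := by
    refine .of_sum_mul_conjTranspose_eq
      (S := fun y => ((√c : ℝ) : ℂ) • (W y.1 y.2 * (Ξ y.1)ᴴ)) ?_ fun y => ?_
    · have conj (y : Fin m × B) : W y.1 y.2 * (Ξ y.1)ᴴ * (W y.1 y.2 * (Ξ y.1)ᴴ)ᴴ =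
          W y.1 y.2 * ((Ξ y.1)ᴴ * Ξ y.1) * (W y.1 y.2)ᴴ := by
        simp only [Matrix.conjTranspose_mul, Matrix.conjTranspose_conjTranspose, Matrix.mul_assoc]
      simp only [sqrt_smul_mul_conjTranspose hc, conj]
      rw [← Finset.smul_sum, Fintype.sum_prod_type]
      simp only [hWsum]
      rw [← Finset.sum_smul, trace_sum, one_smul, uniformCoeff_mul_conjTranspose, hc_def]
      push_cast
      rfl
    · rw [sqrt_smul_mul_conjTranspose hc, conjTranspose_sqrt_smul_mul hc,
        Matrix.conjTranspose_mul, Matrix.conjTranspose_conjTranspose, Matrix.mul_assoc,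
        ← Matrix.mul_assoc _ (W y.1 y.2), hW, Matrix.one_mul]
  have sum_eq : ∑ y : Fin m × B, pureOp (((√c : ℝ) : ℂ) • Ξ y.1) = ρ := by
    simp only [pureOp_sqrt_smul hc]
    rw [Fintype.sum_prod_type, ← sum_Ξ]
    refine Finset.sum_congr rfl fun i _ => ?_
    rw [Finset.sum_const (b := (c : ℂ) • pureOp (Ξ i)), Finset.card_univ,
      ← Nat.cast_smul_eq_nsmul ℂ, smul_smul, hc_def]
    simp
  rwa [sum_eq] at key

end Preparation

/-! ### The trace norm -/

section TraceNorm

variable {ι : Type} [Fintype ι]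

theorem re_trace_nonneg {P : Matrix ι ι ℂ} (hP : P.PosSemidef) : 0 ≤ P.trace.re :=
  (Complex.le_def.1 hP.trace_nonneg).1

theorem re_trace_mul_projection_nonneg {P Q : Matrix ι ι ℂ} (hP : P.PosSemidef)
    (hQ : Q.IsHermitian) (hQQ : IsIdempotentElem Q) : 0 ≤ (P * Q).trace.re := by
  have conj : (P * Q).trace = (Q * P * Qᴴ).trace := by
    rw [hQ.eq, Matrix.trace_mul_comm (Q * P), ← Matrix.mul_assoc, hQQ.eq, Matrix.trace_mul_comm]
  rw [conj]
  exact re_trace_nonneg (hP.mul_mul_conjTranspose_same Q)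

theorem re_trace_mul_projection_le {P Q : Matrix ι ι ℂ} (hP : P.PosSemidef)
    (hQ : Q.IsHermitian) (hQQ : IsIdempotentElem Q) : (P * Q).trace.re ≤ P.trace.re := by
  classical
  have compl := re_trace_mul_projection_nonneg hP (Matrix.isHermitian_one.sub hQ) hQQ.one_sub
  rw [Matrix.mul_sub, Matrix.mul_one, Matrix.trace_sub, Complex.sub_re] at compl
  linarith

theorem sum_sum_norm_sq_eq_trace {ι κ : Type*} [Fintype ι] [Fintype κ] (X : Matrix ι κ ℂ) :
    ∑ i, ∑ k, ‖X i k‖ ^ 2 = (X * Xᴴ).trace.re := by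
  have mul_star_re (z : ℂ) : (z * star z).re = ‖z‖ ^ 2 := by
    rw [Complex.star_def, Complex.mul_conj']
    norm_cast
  simp only [Matrix.trace, Matrix.diag, Matrix.mul_apply, Matrix.conjTranspose_apply,
    Complex.re_sum, mul_star_re]

theorem norm_trace_mul_sq_le {ι κ : Type*} [Fintype ι] [Fintype κ]
    (X : Matrix ι κ ℂ) (Y : Matrix κ ι ℂ) :
    ‖(X * Y).trace‖ ^ 2 ≤ (X * Xᴴ).trace.re * (Y * Yᴴ).trace.re := by
  have trace_eq : (X * Y).trace = ∑ p : ι × κ, X p.1 p.2 * Y p.2 p.1 := by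
    simp only [Matrix.trace, Matrix.diag, Matrix.mul_apply, Fintype.sum_prod_type]
  rw [trace_eq, ← sum_sum_norm_sq_eq_trace X, ← sum_sum_norm_sq_eq_trace Y,
    Finset.sum_comm (f := fun k i => ‖Y k i‖ ^ 2), ← Fintype.sum_prod_type',
    ← Fintype.sum_prod_type']
  calc ‖∑ p : ι × κ, X p.1 p.2 * Y p.2 p.1‖ ^ 2
      ≤ (∑ p : ι × κ, ‖X p.1 p.2‖ * ‖Y p.2 p.1‖) ^ 2 := by
        gcongr
        exact (norm_sum_le _ _).trans_eq (Finset.sum_congr rfl fun p _ => norm_mul _ _)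
    _ ≤ _ := Finset.sum_mul_sq_le_sq_mul_sq _ _ _

variable [DecidableEq ι]

theorem trace_cfc {X : Matrix ι ι ℂ} (hX : X.IsHermitian) (f : ℝ → ℝ) :
    (cfc f X).trace = ∑ i, (f (hX.eigenvalues i) : ℂ) := by
  rw [hX.cfc_eq f, Matrix.IsHermitian.cfc, Unitary.conjStarAlgAut_apply, Matrix.trace_mul_comm,
    ← Matrix.mul_assoc, Unitary.coe_star_mul_self, Matrix.one_mul, Matrix.trace_diagonal]
  rfl

theorem traceNorm_eq_re_trace_cfc_sqrt (X : Matrix ι ι ℂ) :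
    traceNorm X = (cfc Real.sqrt (Xᴴ * X)).trace.re := by
  rw [trace_cfc (Matrix.isHermitian_conjTranspose_mul_self X), ← Complex.ofReal_sum,
    Complex.ofReal_re, traceNorm]

theorem cfc_sqrt_mul_self {X : Matrix ι ι ℂ} (hX : X.IsHermitian) :
    cfc Real.sqrt (X * X) = cfc (fun x : ℝ => |x|) X := by
  have hsa : IsSelfAdjoint X := hX
  rw [← pow_two, ← cfc_comp_pow Real.sqrt 2 X (((X.finite_real_spectrum).image _).continuousOn _)]
  simp only [Real.sqrt_sq_eq_abs]

theorem traceNorm_eq_re_trace_cfc_abs {X : Matrix ι ι ℂ} (hX : X.IsHermitian) :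
    traceNorm X = (cfc (fun x : ℝ => |x|) X).trace.re := by
  rw [traceNorm_eq_re_trace_cfc_sqrt, hX.eq, cfc_sqrt_mul_self hX]

theorem exists_posSemidef_sub {X : Matrix ι ι ℂ} (hX : X.IsHermitian) :
    ∃ P N : Matrix ι ι ℂ, P.PosSemidef ∧ N.PosSemidef ∧ X = P - N ∧
      P.trace.re + N.trace.re = traceNorm X := by
  have hsa : IsSelfAdjoint X := hX
  have cont (f : ℝ → ℝ) : ContinuousOn f (spectrum ℝ X) := X.finite_real_spectrum.continuousOn f
  have posSemidef (f : ℝ → ℝ) (hf : ∀ x, 0 ≤ f x) : (cfc f X).PosSemidef := by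
    open scoped MatrixOrder in
    exact Matrix.nonneg_iff_posSemidef.1 (cfc_nonneg fun x _ => hf x)
  refine ⟨cfc (fun x : ℝ => x⁺) X, cfc (fun x : ℝ => x⁻) X, posSemidef _ posPart_nonneg,
    posSemidef _ negPart_nonneg, ?_, ?_⟩
  · rw [← cfc_sub _ _ X (cont _) (cont _)]
    simp only [posPart_sub_negPart]
    exact (cfc_id' ℝ X).symm
  · rw [← Complex.add_re, ← Matrix.trace_add, ← cfc_add X _ _ (cont _) (cont _),
      traceNorm_eq_re_trace_cfc_abs hX]
    simp only [posPart_add_negPart]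

-- With `Q` the projection onto the nonnegative eigenspaces of `X`, `|X| = X (2 Q - 1)`.
theorem exists_projection_traceNorm_eq {X : Matrix ι ι ℂ} (hX : X.IsHermitian) :
    ∃ Q : Matrix ι ι ℂ, Q.IsHermitian ∧ IsIdempotentElem Q ∧
      traceNorm X = 2 * (X * Q).trace.re - X.trace.re := by
  have hsa : IsSelfAdjoint X := hX
  have cont (f : ℝ → ℝ) : ContinuousOn f (spectrum ℝ X) := X.finite_real_spectrum.continuousOn f
  set Q := cfc (fun x : ℝ => if 0 ≤ x then 1 else 0) X with hQ
  have abs_eq : cfc (fun x : ℝ => |x|) X = X * Q + X * Q - X := by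
    have hXQ : X * Q = cfc (fun x : ℝ => x * if 0 ≤ x then 1 else 0) X := by
      rw [hQ, ← cfc_mul_cfc, cfc_id' ℝ X]
    rw [hXQ, ← cfc_add X _ _ (cont _) (cont _)]
    nth_rw 3 [← cfc_id' ℝ X]
    rw [← cfc_sub _ _ X (cont _) (cont _)]
    refine congrArg (cfc · X) (funext fun x => ?_)
    split_ifs with h
    · rw [abs_of_nonneg h]; ring
    · rw [abs_of_neg (not_le.1 h)]; ring
  refine ⟨Q, cfc_predicate _ X, ?_, ?_⟩
  · rw [IsIdempotentElem, hQ, cfc_mul_cfc]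
    exact congrArg (cfc · X) (funext fun x => by split_ifs <;> simp)
  · rw [traceNorm_eq_re_trace_cfc_abs hX, abs_eq, Matrix.trace_sub, Matrix.trace_add,
      Complex.sub_re, Complex.add_re, two_mul]

theorem traceNorm_sub_le {P N : Matrix ι ι ℂ} (hP : P.PosSemidef) (hN : N.PosSemidef) :
    traceNorm (P - N) ≤ P.trace.re + N.trace.re := by
  obtain ⟨Q, hQ, hQQ, traceNorm_eq⟩ := exists_projection_traceNorm_eq (hP.1.sub hN.1)
  rw [traceNorm_eq, Matrix.sub_mul, Matrix.trace_sub, Matrix.trace_sub, Complex.sub_re,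
    Complex.sub_re]
  linarith [re_trace_mul_projection_le hP hQ hQQ, re_trace_mul_projection_nonneg hN hQ hQQ]

theorem IsLOCC.traceNorm_le {A B A' B' : Type} [Fintype A] [DecidableEq A] [Fintype B]
    [DecidableEq B] [Fintype A'] [DecidableEq A'] [Fintype B'] [DecidableEq B']
    {Λ : Matrix (A × B) (A × B) ℂ → Matrix (A' × B') (A' × B') ℂ} (h : IsLOCC Λ)
    {X : Matrix (A × B) (A × B) ℂ} (hX : X.IsHermitian) : traceNorm (Λ X) ≤ traceNorm X := by
  obtain ⟨P, N, hP, hN, rfl, trace_add⟩ := exists_posSemidef_sub hX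
  rw [h.map_sub, ← trace_add, ← h.trace_apply P, ← h.trace_apply N]
  exact traceNorm_sub_le (h.posSemidef hP) (h.posSemidef hN)

theorem traceNorm_nonneg (X : Matrix ι ι ℂ) : 0 ≤ traceNorm X :=
  Finset.sum_nonneg fun _ _ => Real.sqrt_nonneg _

theorem traceNorm_zero : traceNorm (0 : Matrix ι ι ℂ) = 0 := by
  refine le_antisymm ?_ (traceNorm_nonneg _)
  simpa using traceNorm_sub_le (Matrix.PosSemidef.zero (n := ι) (R := ℂ)) .zero

theorem re_trace_mul_projection_sub_le {ρ σ Q : Matrix ι ι ℂ} (hρ : ρ.IsHermitian)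
    (hσ : σ.IsHermitian) (hQ : Q.IsHermitian) (hQQ : IsIdempotentElem Q) :
    (ρ * Q).trace.re - (σ * Q).trace.re ≤ traceNorm (σ - ρ) := by
  obtain ⟨P, N, hP, hN, sub_eq, trace_add⟩ := exists_posSemidef_sub (hσ.sub hρ)
  have hNP : (ρ * Q).trace.re - (σ * Q).trace.re = (N * Q).trace.re - (P * Q).trace.re := by
    have h := congrArg (fun Z => (Z * Q).trace.re) sub_eq
    simp only [Matrix.sub_mul, Matrix.trace_sub, Complex.sub_re] at h
    linarith
  rw [hNP, ← trace_add]
  linarith [re_trace_mul_projection_nonneg hP hQ hQQ, re_trace_mul_projection_le hN hQ hQQ,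
    re_trace_nonneg hP]

theorem trace_supportProj {X : Matrix ι ι ℂ} (hX : X.IsHermitian) :
    (supportProj X).trace = X.rank := by
  rw [supportProj, trace_cfc hX, hX.rank_eq_card_non_zero_eigs, Fintype.card_subtype,
    Finset.card_filter, Nat.cast_sum]
  refine Finset.sum_congr rfl fun i _ => ?_
  split_ifs <;> simp_all

end TraceNorm

theorem norm_trace_sq_le_rank_mul {ι : Type} [Fintype ι] (Y : Matrix ι ι ℂ) :
    ‖Y.trace‖ ^ 2 ≤ Y.rank * (Y * Yᴴ).trace.re := by
  classical
  have herm : (Y * Yᴴ).IsHermitian := Matrix.isHermitian_mul_conjTranspose_self Y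
  set Q := supportProj (Y * Yᴴ) with hQ
  have proj : Q * Qᴴ = Q := by
    have hQ_herm : IsSelfAdjoint Q := cfc_predicate _ _
    rw [← Matrix.star_eq_conjTranspose, hQ_herm.star_eq]
    exact isIdempotentElem_supportProj _
  calc ‖Y.trace‖ ^ 2 = ‖(Q * Y).trace‖ ^ 2 := by rw [supportProj_mul_eq_self rfl]
    _ ≤ (Q * Qᴴ).trace.re * (Y * Yᴴ).trace.re := norm_trace_mul_sq_le Q Y
    _ = Y.rank * (Y * Yᴴ).trace.re := by
        rw [proj, hQ, trace_supportProj herm, Matrix.rank_self_mul_conjTranspose,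
          Complex.natCast_re]


/-! ### Tensor products of LOCC maps -/

/-- The tensor product of two bipartite operators on `A ⊗ B` and `C ⊗ D`, as an operator on the
bipartite system `(A ⊗ C) ⊗ (B ⊗ D)`. -/
def bipartiteTensor {A B C D : Type*} (ρ : Matrix (A × B) (A × B) ℂ)
    (ω : Matrix (C × D) (C × D) ℂ) : Matrix ((A × C) × (B × D)) ((A × C) × (B × D)) ℂ :=
  (ρ ⊗ₖ ω).submatrix (Equiv.prodProdProdComm A C B D) (Equiv.prodProdProdComm A C B D)

theorem bipartiteTensor_sum {A B C D ι : Type*} (s : Finset ι)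
    (ρ : ι → Matrix (A × B) (A × B) ℂ) (ω : Matrix (C × D) (C × D) ℂ) :
    bipartiteTensor (∑ i ∈ s, ρ i) ω = ∑ i ∈ s, bipartiteTensor (ρ i) ω := by
  ext x y
  simp [bipartiteTensor, Matrix.sum_apply, Finset.sum_mul]

theorem isDensity_bipartiteTensor {A B C D : Type} [Fintype A] [Fintype B] [Fintype C] [Fintype D]
    {ρ : Matrix (A × B) (A × B) ℂ} {ω : Matrix (C × D) (C × D) ℂ}
    (hρ : IsDensity ρ) (hω : IsDensity ω) : IsDensity (bipartiteTensor ρ ω) := by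
  refine ⟨(hρ.1.kronecker hω.1).submatrix _, ?_⟩
  have trace_eq : (bipartiteTensor ρ ω).trace = (ρ ⊗ₖ ω).trace :=
    Fintype.sum_equiv (Equiv.prodProdProdComm A C B D) _ _ fun _ => rfl
  rw [trace_eq, Matrix.trace_kronecker, hρ.2, hω.2, one_mul]

theorem conj_bipartiteTensor {A B A' B' C D : Type*} [Fintype A] [Fintype B] [Fintype C]
    [DecidableEq C] [Fintype D] [DecidableEq D] (K : Matrix A' A ℂ) (L : Matrix B' B ℂ)
    (ρ : Matrix (A × B) (A × B) ℂ) (ω : Matrix (C × D) (C × D) ℂ) :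
    ((K ⊗ₖ (1 : Matrix C C ℂ)) ⊗ₖ (L ⊗ₖ (1 : Matrix D D ℂ))) * bipartiteTensor ρ ω *
      ((K ⊗ₖ (1 : Matrix C C ℂ)) ⊗ₖ (L ⊗ₖ (1 : Matrix D D ℂ)))ᴴ =
    bipartiteTensor ((K ⊗ₖ L) * ρ * (K ⊗ₖ L)ᴴ) ω := by
  have regroup : (K ⊗ₖ (1 : Matrix C C ℂ)) ⊗ₖ (L ⊗ₖ (1 : Matrix D D ℂ)) =
      ((K ⊗ₖ L) ⊗ₖ (1 : Matrix (C × D) (C × D) ℂ)).submatrix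
        (Equiv.prodProdProdComm A' C B' D) (Equiv.prodProdProdComm A C B D) := by
    rw [← Matrix.one_kronecker_one]
    ext ⟨⟨a, c⟩, b, d⟩ ⟨⟨a', c'⟩, b', d'⟩
    exact mul_mul_mul_comm (K a a') _ _ _
  rw [regroup, bipartiteTensor, bipartiteTensor, Matrix.conjTranspose_submatrix,
    Matrix.submatrix_mul_equiv, Matrix.submatrix_mul_equiv, Matrix.conjTranspose_kronecker _ 1,
    ← Matrix.mul_kronecker_mul, ← Matrix.mul_kronecker_mul, Matrix.conjTranspose_one,
    Matrix.mul_one, Matrix.one_mul]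

section LOCC

variable {A B A' B' C D : Type} [Fintype A] [DecidableEq A] [Fintype B] [DecidableEq B]
  [Fintype A'] [DecidableEq A'] [Fintype B'] [DecidableEq B'] [Fintype C] [DecidableEq C]
  [Fintype D] [DecidableEq D]

theorem LOCCConvertible.relabel (e : A' ≃ A) (f : B' ≃ B) (ρ : Matrix (A × B) (A × B) ℂ) :
    LOCCConvertible ρ (ρ.submatrix (Prod.map e f) (Prod.map e f)) := by
  have isometry {X X' : Type} [Fintype X] [DecidableEq X] [Fintype X'] [DecidableEq X']
      (g : X' ≃ X) :
      ((1 : Matrix X X ℂ).submatrix g id)ᴴ * (1 : Matrix X X ℂ).submatrix g id = 1 := by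
    rw [Matrix.conjTranspose_submatrix, Matrix.submatrix_mul_equiv, Matrix.conjTranspose_one,
      Matrix.mul_one, Matrix.submatrix_id_id]
  have conj : ((1 : Matrix (A × B) (A × B) ℂ).submatrix (Prod.map e f) id) * ρ *
      ((1 : Matrix (A × B) (A × B) ℂ).submatrix (Prod.map e f) id)ᴴ =
      ρ.submatrix (Prod.map e f) (Prod.map e f) := by
    ext x y
    simp [Matrix.mul_apply, Matrix.one_apply]
  rw [← conj, ← Matrix.one_kronecker_one]
  exact .local_isometry (isometry e) (isometry f) ρ

theorem IsLOCC.convertible_bipartiteTensor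
    {Λ : Matrix (A × B) (A × B) ℂ → Matrix (A' × B') (A' × B') ℂ} (h : IsLOCC Λ)
    (ρ : Matrix (A × B) (A × B) ℂ) (ω : Matrix (C × D) (C × D) ℂ) :
    LOCCConvertible (bipartiteTensor ρ ω) (bipartiteTensor (Λ ρ) ω) := by
  induction h with
  | done => exact .refl _
  | @alice A B _ _ _ _ ι _ A₁ _ _ K hK Λ _ ih =>
    choose Γ hΓ hΓρ using fun i => ih i
      ((K i ⊗ₖ (1 : Matrix B B ℂ)) * ρ * (K i ⊗ₖ (1 : Matrix B B ℂ))ᴴ)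
    refine ⟨_, IsLOCC.alice (fun i => A₁ i × C) (fun i => K i ⊗ₖ (1 : Matrix C C ℂ))
      (sum_kronecker_one_conjTranspose_mul_self hK) Γ hΓ, ?_⟩
    rw [← Matrix.one_kronecker_one (m := B) (n := D)]
    simp only [conj_bipartiteTensor, hΓρ, bipartiteTensor_sum]
  | @bob A B _ _ _ _ ι _ B₁ _ _ K hK Λ _ ih =>
    choose Γ hΓ hΓρ using fun i => ih i
      (((1 : Matrix A A ℂ) ⊗ₖ K i) * ρ * ((1 : Matrix A A ℂ) ⊗ₖ K i)ᴴ)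
    refine ⟨_, IsLOCC.bob (fun i => B₁ i × D) (fun i => K i ⊗ₖ (1 : Matrix D D ℂ))
      (sum_kronecker_one_conjTranspose_mul_self hK) Γ hΓ, ?_⟩
    rw [← Matrix.one_kronecker_one (m := A) (n := C)]
    simp only [conj_bipartiteTensor, hΓρ, bipartiteTensor_sum]

theorem LOCCConvertible.bipartiteTensor_left {ρ : Matrix (A × B) (A × B) ℂ}
    {σ : Matrix (A' × B') (A' × B') ℂ} (h : LOCCConvertible ρ σ) (ω : Matrix (C × D) (C × D) ℂ) :
    LOCCConvertible (bipartiteTensor ρ ω) (bipartiteTensor σ ω) := by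
  obtain ⟨Λ, hΛ, rfl⟩ := h
  exact hΛ.convertible_bipartiteTensor ρ ω

theorem LOCCConvertible.bipartiteTensor_swap (ρ : Matrix (A × B) (A × B) ℂ)
    (ω : Matrix (C × D) (C × D) ℂ) :
    LOCCConvertible (bipartiteTensor ρ ω) (bipartiteTensor ω ρ) := by
  convert LOCCConvertible.relabel (Equiv.prodComm C A) (Equiv.prodComm D B) (bipartiteTensor ρ ω)
    using 1
  ext ⟨⟨a, c⟩, b, d⟩ ⟨⟨a', c'⟩, b', d'⟩
  simp [bipartiteTensor, mul_comm]

theorem LOCCConvertible.bipartiteTensor_right {ρ : Matrix (A × B) (A × B) ℂ}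
    {σ : Matrix (A' × B') (A' × B') ℂ} (h : LOCCConvertible ρ σ) (ω : Matrix (C × D) (C × D) ℂ) :
    LOCCConvertible (bipartiteTensor ω ρ) (bipartiteTensor ω σ) :=
  ((bipartiteTensor_swap ω ρ).trans (h.bipartiteTensor_left ω)).trans (bipartiteTensor_swap σ ω)

theorem LOCCConvertible.tensorPower_succ (ρ : Matrix (A × B) (A × B) ℂ) (n : ℕ) :
    LOCCConvertible (tensorPower ρ (n + 1)) (bipartiteTensor ρ (tensorPower ρ n)) := by
  convert LOCCConvertible.relabel (Fin.consEquiv fun _ => A) (Fin.consEquiv fun _ => B)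
    (tensorPower ρ (n + 1)) using 1
  ext ⟨⟨a, c⟩, b, d⟩ ⟨⟨a', c'⟩, b', d'⟩
  simp [bipartiteTensor, tensorPower, Fin.prod_univ_succ]

theorem LOCCConvertible.succ_tensorPower (ρ : Matrix (A × B) (A × B) ℂ) (n : ℕ) :
    LOCCConvertible (bipartiteTensor ρ (tensorPower ρ n)) (tensorPower ρ (n + 1)) := by
  convert LOCCConvertible.relabel (Fin.consEquiv fun _ => A).symm (Fin.consEquiv fun _ => B).symm
    (bipartiteTensor ρ (tensorPower ρ n)) using 1
  ext ⟨x, y⟩ ⟨x', y'⟩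
  simp [bipartiteTensor, tensorPower, Fin.prod_univ_succ, Fin.consEquiv, Fin.tail]

theorem LOCCConvertible.tensorPower {ρ : Matrix (A × B) (A × B) ℂ}
    {σ : Matrix (A' × B') (A' × B') ℂ} (h : LOCCConvertible ρ σ) (n : ℕ) :
    LOCCConvertible (tensorPower ρ n) (tensorPower σ n) := by
  induction n with
  | zero =>
    convert LOCCConvertible.relabel (Equiv.ofUnique (Fin 0 → A') (Fin 0 → A))
      (Equiv.ofUnique (Fin 0 → B') (Fin 0 → B)) (RealMasking.tensorPower ρ 0) using 1
    ext x y
    simp [RealMasking.tensorPower]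
  | succ n ih =>
    exact (((tensorPower_succ ρ n).trans (h.bipartiteTensor_left _)).trans
      (ih.bipartiteTensor_right _)).trans (succ_tensorPower σ n)

end LOCC

theorem isDensity_tensorPower {A B : Type} [Fintype A] [Fintype B] {ρ : Matrix (A × B) (A × B) ℂ}
    (hρ : IsDensity ρ) (n : ℕ) : IsDensity (tensorPower ρ n) := by
  classical
  induction n with
  | zero =>
    have eq_one : tensorPower ρ 0 = 1 := by
      ext x y
      rw [Subsingleton.elim x y]
      simp [tensorPower]
    rw [eq_one]
    exact ⟨.one, by simp [Matrix.trace]⟩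
  | succ n ih =>
    exact (LOCCConvertible.succ_tensorPower ρ n).isDensity (isDensity_bipartiteTensor hρ ih)

/-! ### The entanglement cost -/

section UniformCoeff

variable {B : Type} [Fintype B] [DecidableEq B]

theorem trace_uniformCoeff [Nonempty B] : (uniformCoeff B * (uniformCoeff B)ᴴ).trace = 1 := by
  rw [uniformCoeff_mul_conjTranspose, Matrix.trace_smul, Matrix.trace_one]
  simp

theorem isMaxEntangled_uniformCoeff :
    IsMaxEntangled (Fintype.card B) fun p : B × B => uniformCoeff B p.1 p.2 := by
  let e := (Fintype.equivFin B).symm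
  have isometry := conjTranspose_submatrix_one_mul_self (A := B) e.injective
  refine ⟨_, _, isometry, isometry, fun a b => ?_⟩
  have sum_eq : ∑ j, (1 : Matrix B B ℂ).submatrix id e a j *
      (1 : Matrix B B ℂ).submatrix id e b j = (1 : Matrix B B ℂ) a b := by
    refine (e.sum_comp fun x => (1 : Matrix B B ℂ) a x * (1 : Matrix B B ℂ) b x).trans ?_
    simp [Matrix.one_apply]
  rw [sum_eq]
  simp [uniformCoeff]

theorem isMaxEntangled_stdMaxEntangled (m : ℕ) : IsMaxEntangled m (stdMaxEntangled m) := by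
  have h := isMaxEntangled_uniformCoeff (B := Fin m)
  rw [Fintype.card_fin] at h
  convert h using 1
  ext p
  simp [stdMaxEntangled, uniformCoeff, Matrix.one_apply]

theorem isDensity_stdMaxEntangled {m : ℕ} (hm : 0 < m) :
    IsDensity (ketBra (stdMaxEntangled m)) := by
  have : NeZero m := ⟨hm.ne'⟩
  rw [ketBra_stdMaxEntangled]
  exact isDensity_pureOp trace_uniformCoeff

theorem LOCCConvertible.maxEntangled_of_uniformCoeff [Nonempty B] {A' B' : Type} [Fintype A']
    [DecidableEq A'] [Fintype B'] [DecidableEq B'] {k : ℕ} (hk : 0 < k)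
    (hkB : k ≤ Fintype.card B) {Φ : A' × B' → ℂ} (hΦ : IsMaxEntangled k Φ) :
    LOCCConvertible (pureOp (uniformCoeff B)) (ketBra Φ) := by
  refine .maxEntangled hk trace_uniformCoeff (fun x hx => ?_) hΦ
  have scalar : uniformCoeff B * (uniformCoeff B)ᴴ =
      algebraMap ℝ (Matrix B B ℂ) (Fintype.card B : ℝ)⁻¹ := by
    rw [uniformCoeff_mul_conjTranspose, Algebra.algebraMap_eq_smul_one, ← Complex.coe_smul,
      Complex.ofReal_inv]
  rw [scalar, spectrum.scalar_eq, Set.mem_singleton_iff] at hx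
  rw [hx, one_div]
  gcongr

theorem prod_uniformCoeff (n : ℕ) (x y : Fin n → B) :
    ∏ k, uniformCoeff B (x k) (y k) = uniformCoeff (Fin n → B) x y := by
  rcases eq_or_ne x y with rfl | hxy
  · have sqrt_pow : √((Fintype.card B : ℝ) ^ n) = √(Fintype.card B : ℝ) ^ n := by
      rw [Real.sqrt_eq_iff_mul_self_eq (by positivity) (by positivity), ← mul_pow,
        Real.mul_self_sqrt (Nat.cast_nonneg _)]
    simp [uniformCoeff, sqrt_pow]
  · obtain ⟨k, hk⟩ := Function.ne_iff.1 hxy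
    rw [Finset.prod_eq_zero (Finset.mem_univ k) (by simp [uniformCoeff, hk])]
    simp [uniformCoeff, hxy]

theorem tensorPower_uniformCoeff (n : ℕ) :
    tensorPower (pureOp (uniformCoeff B)) n = pureOp (uniformCoeff (Fin n → B)) := by
  ext ⟨x, y⟩ ⟨x', y'⟩
  simp only [tensorPower, pureOp, ketBra, Matrix.of_apply, Matrix.vecMulVec_apply, Pi.star_apply,
    Finset.prod_mul_distrib, ← star_prod, prod_uniformCoeff]

end UniformCoeff

section Fidelity

theorem trace_pureOp_mul_pureOp {A B : Type} [Fintype A] [Fintype B] (X Y : Matrix A B ℂ) :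
    (pureOp X * pureOp Y).trace = (X * Yᴴ).trace * star (X * Yᴴ).trace := by
  have inner_eq : (fun p : A × B => X p.1 p.2) ⬝ᵥ (star fun p : A × B => Y p.1 p.2) =
      (X * Yᴴ).trace := by
    simp [dotProduct, Matrix.trace, Matrix.mul_apply, Fintype.sum_prod_type]
  have star_inner_eq : (star fun p : A × B => X p.1 p.2) ⬝ᵥ (fun p : A × B => Y p.1 p.2) =
      star (X * Yᴴ).trace := by
    rw [Matrix.star_dotProduct, dotProduct_comm, inner_eq]
  rw [pureOp, pureOp, ketBra, ketBra, Matrix.vecMulVec_mul_vecMulVec, Matrix.trace_vecMulVec,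
    dotProduct_smul, inner_eq, star_inner_eq, smul_eq_mul, mul_comm]

theorem re_trace_pureOp_mul_uniformCoeff {B : Type} [Fintype B] [DecidableEq B]
    (Y : Matrix B B ℂ) :
    (pureOp Y * pureOp (uniformCoeff B)).trace.re = ‖Y.trace‖ ^ 2 / Fintype.card B := by
  rw [trace_pureOp_mul_pureOp, Complex.star_def, Complex.mul_conj', uniformCoeff,
    Matrix.conjTranspose_smul, Matrix.conjTranspose_one, Matrix.mul_smul, Matrix.mul_one,
    Matrix.trace_smul, smul_eq_mul, norm_mul, ← Complex.ofReal_pow, Complex.ofReal_re, mul_pow,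
    norm_star, Complex.norm_real, Real.norm_eq_abs, sq_abs, div_pow, one_pow,
    Real.sq_sqrt (Nat.cast_nonneg _), one_div_mul_eq_div]

theorem isHermitian_pureOp {A B : Type} (X : Matrix A B ℂ) : (pureOp X).IsHermitian := by
  rw [Matrix.IsHermitian, pureOp, ketBra, Matrix.conjTranspose_vecMulVec, star_star]

theorem isIdempotentElem_pureOp {A B : Type} [Fintype A] [Fintype B] {X : Matrix A B ℂ}
    (hX : (X * Xᴴ).trace = 1) : IsIdempotentElem (pureOp X) := by
  have norm_eq : (star fun p : A × B => X p.1 p.2) ⬝ᵥ (fun p : A × B => X p.1 p.2) = 1 := by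
    rw [← hX, ← trace_pureOp, pureOp, ketBra, Matrix.trace_vecMulVec, dotProduct_comm]
  rw [IsIdempotentElem, pureOp, ketBra, Matrix.vecMulVec_mul_vecMulVec, norm_eq, one_smul]

variable {A B : Type} [Fintype A] [DecidableEq A] [Fintype B] [DecidableEq B]

-- A product Kraus operator cannot raise the Schmidt rank, and a ket of Schmidt rank `r` has
-- fidelity at most `r / card B` with the maximally entangled ket.
theorem IsLOCC.fidelity_le {Λ : Matrix (A × A) (A × A) ℂ → Matrix (B × B) (B × B) ℂ}
    (h : IsLOCC Λ) {X : Matrix A A ℂ} (hX : (X * Xᴴ).trace = 1) :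
    (Λ (pureOp X) * pureOp (uniformCoeff B)).trace.re ≤ Fintype.card A / Fintype.card B := by
  have trace_eq := h.trace_apply (pureOp X)
  obtain ⟨κ, _, a, b, -, hΛ⟩ := h.exists_product_kraus
  simp only [hΛ, kronecker_mul_pureOp_mul] at trace_eq ⊢
  rw [trace_pureOp, hX, Matrix.trace_sum] at trace_eq
  simp only [trace_pureOp] at trace_eq
  rw [Finset.sum_mul, Matrix.trace_sum, Complex.re_sum]
  simp only [re_trace_pureOp_mul_uniformCoeff]
  rw [← Finset.sum_div]
  refine div_le_div_of_nonneg_right ?_ (Nat.cast_nonneg _)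
  have rank_le (s : κ) : (a s * X * (b s)ᵀ).rank ≤ Fintype.card A :=
    (Matrix.rank_mul_le_right _ _).trans (Matrix.rank_le_card_height _)
  calc ∑ s, ‖(a s * X * (b s)ᵀ).trace‖ ^ 2
      ≤ ∑ s, (Fintype.card A : ℝ) * ((a s * X * (b s)ᵀ) * (a s * X * (b s)ᵀ)ᴴ).trace.re := by
        refine Finset.sum_le_sum fun s _ => (norm_trace_sq_le_rank_mul _).trans ?_
        gcongr
        · exact re_trace_nonneg (Matrix.posSemidef_self_mul_conjTranspose _)
        · exact rank_le s
    _ = Fintype.card A := by rw [← Finset.mul_sum, ← Complex.re_sum, trace_eq, Complex.one_re,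
        mul_one]

theorem IsLOCC.one_sub_le_traceNorm_sub [Nonempty A] [Nonempty B]
    {Λ : Matrix (A × A) (A × A) ℂ → Matrix (B × B) (B × B) ℂ} (h : IsLOCC Λ) :
    1 - (Fintype.card A : ℝ) / Fintype.card B ≤
      traceNorm (Λ (pureOp (uniformCoeff A)) - pureOp (uniformCoeff B)) := by
  have isDensity := isDensity_pureOp (trace_uniformCoeff (B := B))
  have proj := isIdempotentElem_pureOp (trace_uniformCoeff (B := B))
  have trace_sub_le := re_trace_mul_projection_sub_le isDensity.1.1
    (h.isDensity (isDensity_pureOp trace_uniformCoeff)).1.1 (isHermitian_pureOp _) proj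
  rw [proj.eq, isDensity.2, Complex.one_re] at trace_sub_le
  linarith [h.fidelity_le (trace_uniformCoeff (B := A))]

end Fidelity

section Cost

theorem isAchievableRate_of_card_le {A B : Type} [Fintype A] [DecidableEq A] [Fintype B]
    [DecidableEq B] {ρ : Matrix (A × B) (A × B) ℂ} (hρ : IsDensity ρ) {s : ℕ}
    (hs : Fintype.card B ≤ 2 ^ s) : IsAchievableRate ρ s := by
  have : Nonempty B := by
    by_contra! isEmpty
    simpa [Matrix.trace] using hρ.2
  have : NeZero (Fintype.card B) := ⟨Fintype.card_ne_zero⟩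
  let _ : AddCommGroup B := (Fintype.equivFin B).addCommGroup
  have floor_eq (N : ℕ) : ⌊(s : ℝ) * N⌋₊ = s * N := by rw [← Nat.cast_mul, Nat.floor_natCast]
  have convertible (N : ℕ) :
      LOCCConvertible (ketBra (stdMaxEntangled (2 ^ ⌊(s : ℝ) * N⌋₊))) (tensorPower ρ N) := by
    have : NeZero (2 ^ (s * N)) := ⟨by positivity⟩
    have card_le : Fintype.card (Fin N → B) ≤ Fintype.card (Fin (2 ^ (s * N))) := by
      rw [Fintype.card_fun, Fintype.card_fin, Fintype.card_fin, pow_mul]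
      exact Nat.pow_le_pow_left hs N
    rw [floor_eq, ketBra_stdMaxEntangled]
    exact (LOCCConvertible.maxEntangled_of_uniformCoeff Fintype.card_pos card_le
      isMaxEntangled_uniformCoeff).trans (.of_uniformCoeff (isDensity_tensorPower hρ N))
  choose Λ hΛ hΛρ using convertible
  refine ⟨Nat.cast_nonneg _, Λ, hΛ, ?_⟩
  simp only [hΛρ, sub_self, traceNorm_zero]
  exact tendsto_const_nhds

theorem IsAchievableRate.of_convertible {A B A' B' : Type} [Fintype A] [DecidableEq A] [Fintype B]
    [DecidableEq B] [Fintype A'] [DecidableEq A'] [Fintype B'] [DecidableEq B']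
    {ρ : Matrix (A × B) (A × B) ℂ} {σ : Matrix (A' × B') (A' × B') ℂ} (hρ : IsDensity ρ)
    (h : LOCCConvertible ρ σ) {r : ℝ} (hr : IsAchievableRate ρ r) : IsAchievableRate σ r := by
  obtain ⟨r_nonneg, Λ, hΛ, tendsto⟩ := hr
  choose Γ hΓ hΓρ using fun n => h.tensorPower n
  refine ⟨r_nonneg, fun n ω => Γ n (Λ n ω), fun n => (hΓ n).comp (hΛ n), ?_⟩
  refine squeeze_zero (fun n => traceNorm_nonneg _) (fun n => ?_) tendsto
  rw [← hΓρ n, ← (hΓ n).map_sub]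
  refine (hΓ n).traceNorm_le ?_
  exact ((hΛ n).isDensity (isDensity_stdMaxEntangled (by positivity))).1.1.sub
    (isDensity_tensorPower hρ n).1.1

theorem isEntanglementMonotone_entanglementCost : IsEntanglementMonotone entanglementCost := by
  intro m n m' n' Λ hΛ ρ hρ
  refine csInf_le_csInf ⟨0, fun r hr => hr.1⟩ ⟨_, isAchievableRate_of_card_le hρ (s := n) ?_⟩
    fun r hr => hr.of_convertible hρ (hΛ.convertible ρ)
  rw [Fintype.card_fin]
  exact Nat.lt_two_pow_self.le

theorem IsAchievableRate.le_of_stdMaxEntangled {p : ℕ} {r : ℝ}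
    (hr : IsAchievableRate (ketBra (stdMaxEntangled (2 ^ p))) r) : p ≤ r := by
  obtain ⟨r_nonneg, Λ, hΛ, tendsto⟩ := hr
  by_contra! r_lt
  have ratio_le (n : ℕ) :
      (Fintype.card (Fin (2 ^ ⌊r * n⌋₊)) : ℝ) / Fintype.card (Fin n → Fin (2 ^ p)) ≤
        ((2 : ℝ) ^ (r - p)) ^ n := by
    have floor_le := Nat.floor_le (mul_nonneg r_nonneg n.cast_nonneg)
    rw [Fintype.card_fin, Fintype.card_fun, Fintype.card_fin, Fintype.card_fin]
    push_cast
    rw [← pow_mul, ← Real.rpow_natCast, ← Real.rpow_natCast, ← Real.rpow_sub two_pos,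
      ← Real.rpow_natCast, ← Real.rpow_mul two_pos.le]
    refine Real.rpow_le_rpow_of_exponent_le one_le_two ?_
    push_cast
    linarith
  have le_traceNorm (n : ℕ) : 1 - ((2 : ℝ) ^ (r - p)) ^ n ≤
      traceNorm (Λ n (ketBra (stdMaxEntangled (2 ^ ⌊r * n⌋₊))) -
        tensorPower (ketBra (stdMaxEntangled (2 ^ p))) n) := by
    have : NeZero (2 ^ ⌊r * n⌋₊) := ⟨by positivity⟩
    have : NeZero (2 ^ p) := ⟨by positivity⟩
    rw [ketBra_stdMaxEntangled, ketBra_stdMaxEntangled, tensorPower_uniformCoeff]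
    linarith [(hΛ n).one_sub_le_traceNorm_sub, ratio_le n]
  have pow_tendsto := tendsto_pow_atTop_nhds_zero_of_lt_one (Real.rpow_nonneg two_pos.le _)
    (Real.rpow_lt_one_of_one_lt_of_neg one_lt_two (sub_neg.2 r_lt))
  have one_le_zero := le_of_tendsto_of_tendsto' (pow_tendsto.const_sub 1) tendsto le_traceNorm
  norm_num at one_le_zero

theorem entanglementCost_stdMaxEntangled (p : ℕ) :
    entanglementCost (2 ^ p) (2 ^ p) (ketBra (stdMaxEntangled (2 ^ p))) = p := by
  have isDensity : IsDensity (ketBra (stdMaxEntangled (2 ^ p))) :=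
    isDensity_stdMaxEntangled (by positivity)
  exact IsLeast.csInf_eq ⟨isAchievableRate_of_card_le isDensity (Fintype.card_fin _).le,
    fun r hr => hr.le_of_stdMaxEntangled⟩

end Cost

/-! ### Clifford families -/

section Clifford

variable {R : Type*} [CommRing R] {κ κ' ι ι' l m n p : Type*}

theorem neg_kronecker (A : Matrix l m R) (B : Matrix n p R) : (-A) ⊗ₖ B = -(A ⊗ₖ B) := by
  ext; simp

theorem kronecker_neg (A : Matrix l m R) (B : Matrix n p R) : A ⊗ₖ (-B) = -(A ⊗ₖ B) := by
  ext; simp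

theorem kronecker_submatrix_prodComm (A : Matrix l l R) (B : Matrix m m R) :
    (A ⊗ₖ B).submatrix (Equiv.prodComm m l) (Equiv.prodComm m l) = B ⊗ₖ A := by
  ext; simp [mul_comm]

variable (R) in
/-- The Pauli matrix `diag(1, -1)`. -/
def pauliZ : Matrix (Fin 2) (Fin 2) R := !![1, 0; 0, -1]

variable (R) in
/-- The Pauli matrix that exchanges the two basis vectors. -/
def pauliX : Matrix (Fin 2) (Fin 2) R := !![0, 1; 1, 0]

variable (R) in
/-- The rotation of the plane by a right angle. -/
def rotation : Matrix (Fin 2) (Fin 2) R := !![0, 1; -1, 0]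

theorem pauliZ_mul_self : pauliZ R * pauliZ R = 1 := by
  ext i j; fin_cases i <;> fin_cases j <;> simp [pauliZ]

theorem pauliX_mul_self : pauliX R * pauliX R = 1 := by
  ext i j; fin_cases i <;> fin_cases j <;> simp [pauliX]

theorem rotation_mul_self : rotation R * rotation R = -1 := by
  ext i j; fin_cases i <;> fin_cases j <;> simp [rotation]

theorem pauliX_mul_pauliZ : pauliX R * pauliZ R = -(pauliZ R * pauliX R) := by
  ext i j; fin_cases i <;> fin_cases j <;> simp [pauliX, pauliZ]

theorem rotation_mul_pauliZ : rotation R * pauliZ R = -(pauliZ R * rotation R) := by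
  ext i j; fin_cases i <;> fin_cases j <;> simp [rotation, pauliZ]

theorem rotation_mul_pauliX : rotation R * pauliX R = -(pauliX R * rotation R) := by
  ext i j; fin_cases i <;> fin_cases j <;> simp [rotation, pauliX]

variable [StarRing R]

theorem conjTranspose_pauliZ : (pauliZ R)ᴴ = pauliZ R := by
  ext i j; fin_cases i <;> fin_cases j <;> simp [pauliZ, Matrix.conjTranspose_apply]

theorem conjTranspose_pauliX : (pauliX R)ᴴ = pauliX R := by
  ext i j; fin_cases i <;> fin_cases j <;> simp [pauliX, Matrix.conjTranspose_apply]

theorem conjTranspose_rotation : (rotation R)ᴴ = -rotation R := by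
  ext i j; fin_cases i <;> fin_cases j <;> simp [rotation, Matrix.conjTranspose_apply]

variable [Fintype ι] [DecidableEq ι] [Fintype ι'] [DecidableEq ι']

/-- A family of pairwise anticommuting skew-Hermitian matrices that square to `-1`. -/
structure IsCliffordFamily (J : κ → Matrix ι ι R) : Prop where
  conjTranspose : ∀ i, (J i)ᴴ = -J i
  mul_self : ∀ i, J i * J i = -1
  anticomm : ∀ i j, i ≠ j → J i * J j = -(J j * J i)

theorem isCliffordFamily_unit {A : Matrix ι ι R} (hA : Aᴴ = -A) (hAA : A * A = -1) :
    IsCliffordFamily fun _ : Unit => A :=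
  ⟨fun _ => hA, fun _ => hAA, fun _ _ h => absurd rfl h⟩

/-- The Clifford family built from two commuting Clifford families of the same size. -/
def doubling (L : κ → Matrix ι ι R) (L' : κ' → Matrix ι ι R) :
    (κ ⊕ κ') ⊕ Unit → Matrix (ι × Fin 2) (ι × Fin 2) R :=
  Sum.elim (Sum.elim (fun k => L k ⊗ₖ pauliZ R) fun k => L' k ⊗ₖ pauliX R) fun _ => 1 ⊗ₖ rotation R

namespace IsCliffordFamily

theorem comp {J : κ → Matrix ι ι R} (hJ : IsCliffordFamily J) (f : κ' ↪ κ) :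
    IsCliffordFamily fun k => J (f k) :=
  ⟨fun _ => hJ.conjTranspose _, fun _ => hJ.mul_self _,
    fun _ _ h => hJ.anticomm _ _ (f.injective.ne h)⟩

theorem submatrix {J : κ → Matrix ι ι R} (hJ : IsCliffordFamily J) (e : ι' ≃ ι) :
    IsCliffordFamily fun k => (J k).submatrix e e := by
  refine ⟨fun i => ?_, fun i => ?_, fun i j hij => ?_⟩
  · rw [Matrix.conjTranspose_submatrix, hJ.conjTranspose, Matrix.submatrix_neg, Pi.neg_apply,
      Pi.neg_apply]
  · rw [Matrix.submatrix_mul_equiv, hJ.mul_self, Matrix.submatrix_neg, Pi.neg_apply, Pi.neg_apply,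
      Matrix.submatrix_one_equiv]
  · rw [Matrix.submatrix_mul_equiv, Matrix.submatrix_mul_equiv, hJ.anticomm i j hij,
      Matrix.submatrix_neg, Pi.neg_apply, Pi.neg_apply]

theorem kronecker_one {J : κ → Matrix ι ι R} (hJ : IsCliffordFamily J) :
    IsCliffordFamily fun k => J k ⊗ₖ (1 : Matrix ι' ι' R) := by
  refine ⟨fun i => ?_, fun i => ?_, fun i j hij => ?_⟩
  · rw [Matrix.conjTranspose_kronecker, hJ.conjTranspose, Matrix.conjTranspose_one, neg_kronecker]
  · rw [← Matrix.mul_kronecker_mul, hJ.mul_self, neg_kronecker, Matrix.one_mul,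
      Matrix.one_kronecker_one]
  · rw [← Matrix.mul_kronecker_mul, ← Matrix.mul_kronecker_mul, hJ.anticomm i j hij, neg_kronecker]

theorem one_kronecker {J : κ → Matrix ι ι R} (hJ : IsCliffordFamily J) :
    IsCliffordFamily fun k => (1 : Matrix ι' ι' R) ⊗ₖ J k := by
  simpa only [kronecker_submatrix_prodComm] using
    (hJ.kronecker_one (ι' := ι')).submatrix (Equiv.prodComm ι' ι)

theorem doubling {L : κ → Matrix ι ι R} {L' : κ' → Matrix ι ι R} (hL : IsCliffordFamily L)
    (hL' : IsCliffordFamily L') (h : ∀ i j, Commute (L i) (L' j)) :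
    IsCliffordFamily (doubling L L') := by
  refine ⟨?_, ?_, ?_⟩
  · rintro ((i | i) | i) <;>
    simp only [RealMasking.doubling, Sum.elim_inl, Sum.elim_inr, Matrix.conjTranspose_kronecker,
      hL.conjTranspose, hL'.conjTranspose, conjTranspose_pauliZ, conjTranspose_pauliX,
      conjTranspose_rotation, Matrix.conjTranspose_one, neg_kronecker, kronecker_neg]
  · rintro ((i | i) | i) <;>
    simp only [RealMasking.doubling, Sum.elim_inl, Sum.elim_inr, ← Matrix.mul_kronecker_mul,
      hL.mul_self, hL'.mul_self, pauliZ_mul_self, pauliX_mul_self, rotation_mul_self,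
      Matrix.one_mul, neg_kronecker, kronecker_neg, Matrix.one_kronecker_one]
  · rintro ((i | i) | i) ((j | j) | j) hij <;>
    simp only [RealMasking.doubling, Sum.elim_inl, Sum.elim_inr, ← Matrix.mul_kronecker_mul,
      Matrix.one_mul, Matrix.mul_one, kronecker_neg, pauliX_mul_pauliZ,
      rotation_mul_pauliZ, rotation_mul_pauliX, neg_neg, (h _ _).eq]
    · rw [hL.anticomm i j (by simpa using hij), neg_kronecker]
    · rw [hL'.anticomm i j (by simpa using hij), neg_kronecker]
    · exact absurd rfl hij

end IsCliffordFamily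

end Clifford

section HurwitzRadon

variable {R : Type*} [CommRing R]

variable (R) in
/-- The left multiplications by the imaginary units of the quaternions. -/
def quaternionLeft : (Unit ⊕ Unit) ⊕ Unit → Matrix (Fin 2 × Fin 2) (Fin 2 × Fin 2) R :=
  doubling (fun _ : Unit => rotation R) fun _ : Unit => rotation R

variable (R) in
/-- The right multiplications by the imaginary units of the quaternions. -/
def quaternionRight : (Unit ⊕ Unit) ⊕ Unit → Matrix (Fin 2 × Fin 2) (Fin 2 × Fin 2) R :=
  fun k => (quaternionLeft R k).submatrix (Equiv.prodComm _ _) (Equiv.prodComm _ _)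

theorem commute_quaternionLeft_quaternionRight (i j : (Unit ⊕ Unit) ⊕ Unit) :
    Commute (quaternionLeft R i) (quaternionRight R j) := by
  rcases i with ((i | i) | i) <;> rcases j with ((j | j) | j) <;>
  simp only [Commute, SemiconjBy, quaternionRight, quaternionLeft, doubling, Sum.elim_inl,
    Sum.elim_inr, kronecker_submatrix_prodComm, ← Matrix.mul_kronecker_mul, Matrix.one_mul,
    Matrix.mul_one, rotation_mul_pauliZ, rotation_mul_pauliX, neg_kronecker, kronecker_neg]

variable [StarRing R] {κ ι : Type*} [Fintype κ] [Fintype ι] [DecidableEq ι]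

variable (R) in
/-- There are `n` anticommuting complex structures on `R ^ r`. -/
def HasClifford (n r : ℕ) : Prop :=
  ∃ J : Fin n → Matrix (Fin r) (Fin r) R, IsCliffordFamily J

theorem IsCliffordFamily.hasClifford {J : κ → Matrix ι ι R} (hJ : IsCliffordFamily J) {n r : ℕ}
    (hn : n ≤ Fintype.card κ) (hr : Fintype.card ι = r) : HasClifford R n r := by
  obtain ⟨f⟩ : Nonempty (Fin n ↪ κ) := Function.Embedding.nonempty_of_card_le (by simpa using hn)
  exact ⟨_, (hJ.comp f).submatrix (Fintype.equivFinOfCardEq hr).symm⟩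

theorem HasClifford.mono {n n' r : ℕ} (h : HasClifford R n r) (hn : n' ≤ n) :
    HasClifford R n' r := by
  obtain ⟨J, hJ⟩ := h
  exact hJ.hasClifford (by simpa using hn) (by simp)

theorem isCliffordFamily_I (ι : Type*) [Fintype ι] [DecidableEq ι] :
    IsCliffordFamily fun _ : Unit => Complex.I • (1 : Matrix ι ι ℂ) :=
  isCliffordFamily_unit (by simp) (by simp [smul_smul])

theorem hasClifford_complex (p : ℕ) : HasClifford ℂ (2 * p + 1) (2 ^ p) := by
  induction p with
  | zero => exact (isCliffordFamily_I (Fin 1)).hasClifford (by simp) (by simp)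
  | succ p ih =>
    obtain ⟨J, hJ⟩ := ih
    exact (hJ.doubling (isCliffordFamily_I _) fun _ _ => (Commute.one_right _).smul_right _)
      |>.hasClifford (by simp; omega) (by simp [pow_succ])

variable (R) in
theorem isCliffordFamily_rotation : IsCliffordFamily fun _ : Unit => rotation R :=
  isCliffordFamily_unit conjTranspose_rotation rotation_mul_self

variable (R) in
theorem isCliffordFamily_quaternionLeft : IsCliffordFamily (quaternionLeft R) :=
  (isCliffordFamily_rotation R).doubling (isCliffordFamily_rotation R) fun _ _ => rfl

variable (R) in
theorem isCliffordFamily_quaternionRight : IsCliffordFamily (quaternionRight R) :=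
  (isCliffordFamily_quaternionLeft R).submatrix _

variable (R) in
/-- Seven anticommuting complex structures on `R ^ 8`. -/
def octonionLeft : (((Unit ⊕ Unit) ⊕ Unit) ⊕ ((Unit ⊕ Unit) ⊕ Unit)) ⊕ Unit →
    Matrix ((Fin 2 × Fin 2) × Fin 2) ((Fin 2 × Fin 2) × Fin 2) R :=
  doubling (quaternionLeft R) (quaternionRight R)

variable (R) in
theorem isCliffordFamily_octonionLeft : IsCliffordFamily (octonionLeft R) :=
  (isCliffordFamily_quaternionLeft R).doubling (isCliffordFamily_quaternionRight R)
    commute_quaternionLeft_quaternionRight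

-- Bott periodicity.
theorem HasClifford.add_eight {n r : ℕ} (h : HasClifford R n r) :
    HasClifford R (n + 8) (16 * r) := by
  obtain ⟨J, hJ⟩ := h
  have left := hJ.kronecker_one (ι' := (Fin 2 × Fin 2) × Fin 2)
  have right := (isCliffordFamily_octonionLeft R).one_kronecker (ι' := Fin r)
  refine (left.doubling right fun i j => ?_).hasClifford (by simp) (by simp; ring)
  rw [Commute, SemiconjBy, ← Matrix.mul_kronecker_mul, ← Matrix.mul_kronecker_mul]
  simp

theorem kappa_add_eight {d : ℕ} (hd : 1 ≤ d) : kappa (d + 8) = 16 * kappa d := by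
  have half_eq : (d + 8 - 1) / 2 = 4 + (d - 1) / 2 := by omega
  rw [kappa, kappa, half_eq, pow_add]
  norm_num

theorem kappaReal_add_eight {d : ℕ} (hd : 1 ≤ d) : kappaReal (d + 8) = 16 * kappaReal d := by
  simp only [kappaReal, kappa_add_eight hd, Nat.add_mod_right]
  split_ifs <;> ring

theorem hasClifford_kappaReal {d : ℕ} (hd : 1 ≤ d) : HasClifford R (d - 1) (kappaReal d) := by
  induction d using Nat.strong_induction_on with
  | _ d ih =>
    rcases Nat.lt_or_ge 8 d with h | h
    · obtain ⟨c, rfl⟩ := Nat.exists_eq_add_of_lt h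
      have step := (ih (c + 1) (by omega) (by omega)).add_eight
      rw [← kappaReal_add_eight (by omega)] at step
      convert step using 2 <;> omega
    · have on_one : HasClifford R 0 1 :=
        ⟨fun i => i.elim0, fun i => i.elim0, fun i => i.elim0, fun i => i.elim0⟩
      have on_two : HasClifford R 1 2 :=
        (isCliffordFamily_rotation R).hasClifford (by simp) (by simp)
      have on_four : HasClifford R 3 4 :=
        (isCliffordFamily_quaternionLeft R).hasClifford (by simp) (by simp)
      have on_eight : HasClifford R 7 8 :=
        (isCliffordFamily_octonionLeft R).hasClifford (by simp) (by simp)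
      interval_cases d
      exacts [on_one, on_two, on_four.mono (by norm_num), on_four, on_eight.mono (by norm_num),
        on_eight.mono (by norm_num), on_eight.mono (by norm_num), on_eight]

end HurwitzRadon

/-! ### Dimensions of Clifford representations -/

section Rank

variable {ι : Type*} [Fintype ι]

theorem trace_eq_rank_of_isIdempotentElem {P : Matrix ι ι ℂ} (hP : IsIdempotentElem P) :
    P.trace = P.rank := by
  classical
  have idem : IsIdempotentElem (Matrix.toLin' P) := by
    rw [IsIdempotentElem, Module.End.mul_eq_comp, ← Matrix.toLin'_mul, hP.eq]
  rw [← Matrix.trace_toLin'_eq, (LinearMap.IsIdempotentElem.isProj_range _ idem).trace]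
  rfl

/-- Entrywise complex conjugation. -/
def conjMatrix [DecidableEq ι] : Matrix ι ι ℂ →+* Matrix ι ι ℂ := (starRingEnd ℂ).mapMatrix

variable [DecidableEq ι]

theorem conjMatrix_smul (c : ℂ) (P : Matrix ι ι ℂ) :
    conjMatrix (c • P) = star c • conjMatrix P := by
  ext i j
  simp [conjMatrix]

theorem star_mulVec_eq_conjMatrix_mulVec (N : Matrix ι ι ℂ) (y : ι → ℂ) :
    star (N *ᵥ y) = conjMatrix N *ᵥ star y := by
  ext i
  simp [Matrix.mulVec, dotProduct, conjMatrix]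

-- The antiunitary operator `y ↦ L *ᵥ star y` is a quaternionic structure on the range of `P`. On a
-- line it would map `v` to `c • v`, hence its square would be `‖c‖ ^ 2` and not `-1`.
theorem rank_ne_one_of_quaternionic {P L : Matrix ι ι ℂ} (hP : IsIdempotentElem P)
    (hL : L * conjMatrix P = P * L) (hLL : L * conjMatrix L * P = -P) : P.rank ≠ 1 := by
  intro rank_eq
  have finrank_eq : Module.finrank ℂ (LinearMap.range P.mulVecLin) = 1 := rank_eq
  obtain ⟨⟨v, x, hxv⟩, v_ne, spans⟩ := finrank_eq_one_iff'.1 finrank_eq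
  have v_ne : v ≠ 0 := fun h => v_ne (Subtype.ext h)
  have fixed : P *ᵥ v = v := by
    rw [← hxv, Matrix.mulVecLin_apply, Matrix.mulVec_mulVec, hP.eq]
  have image_fixed : P *ᵥ (L *ᵥ star v) = L *ᵥ star v := by
    rw [Matrix.mulVec_mulVec, ← hL, ← Matrix.mulVec_mulVec, ← star_mulVec_eq_conjMatrix_mulVec,
      fixed]
  obtain ⟨c, hc⟩ := spans ⟨L *ᵥ star v, L *ᵥ star v, image_fixed⟩
  have hc : c • v = L *ᵥ star v := congrArg Subtype.val hc
  have square : L *ᵥ star (L *ᵥ star v) = -v := by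
    rw [star_mulVec_eq_conjMatrix_mulVec, star_star, Matrix.mulVec_mulVec]
    conv_lhs => rw [← fixed, Matrix.mulVec_mulVec, hLL, Matrix.neg_mulVec, fixed]
  rw [← hc, star_smul, Matrix.mulVec_smul, ← hc, smul_smul] at square
  have smul_eq_zero' : (star c * c + 1) • v = 0 := by
    rw [add_smul, square, one_smul, neg_add_cancel]
  have norm_sq_add_one : star c * c + 1 = 0 := (smul_eq_zero.1 smul_eq_zero').resolve_right v_ne
  rw [Complex.star_def, Complex.conj_mul'] at norm_sq_add_one
  have : ‖c‖ ^ 2 + 1 = 0 := by exact_mod_cast norm_sq_add_one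
  linarith [sq_nonneg ‖c‖]

end Rank

theorem commute_mul_of_anticomm {R : Type*} [NonUnitalRing R] {x a b : R} (ha : x * a = -(a * x))
    (hb : x * b = -(b * x)) : Commute x (a * b) := by
  rw [Commute, SemiconjBy, ← mul_assoc, ha, neg_mul, mul_assoc, hb, mul_neg, neg_neg, mul_assoc]

section Clifford

variable {ι : Type*} [Fintype ι] {Q : Matrix ι ι ℂ} {J : ℕ → Matrix ι ι ℂ} {n : ℕ}

/-- `J 0, …, J (n - 1)` are pairwise anticommuting complex structures on the range of the
idempotent `Q`. They vanish on its kernel. -/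
structure IsCliffordOn (Q : Matrix ι ι ℂ) (J : ℕ → Matrix ι ι ℂ) (n : ℕ) : Prop where
  isIdempotentElem : IsIdempotentElem Q
  mul_proj : ∀ i < n, J i * Q = J i
  proj_mul : ∀ i < n, Q * J i = J i
  mul_self : ∀ i < n, J i * J i = -Q
  anticomm : ∀ i < n, ∀ j < n, i ≠ j → J i * J j = -(J j * J i)

/-- The involution `i J_(2 k) J_(2 k + 1)`. For different `k` these commute. -/
def cliffordInvolution (J : ℕ → Matrix ι ι ℂ) (k : ℕ) : Matrix ι ι ℂ :=
  Complex.I • (J (2 * k) * J (2 * k + 1))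

namespace IsCliffordOn

theorem commute_proj (h : IsCliffordOn Q J n) {i : ℕ} (hi : i < n) : Commute (J i) Q := by
  rw [Commute, SemiconjBy, h.mul_proj i hi, h.proj_mul i hi]

theorem commute_involution (h : IsCliffordOn Q J n) {i k : ℕ} (hi : i < n) (hk : 2 * k + 1 < n)
    (h1 : i ≠ 2 * k) (h2 : i ≠ 2 * k + 1) : Commute (J i) (cliffordInvolution J k) := by
  rw [cliffordInvolution]
  exact (commute_mul_of_anticomm (R := Matrix ι ι ℂ) (h.anticomm i hi _ (by omega) h1)
    (h.anticomm i hi _ (by omega) h2)).smul_right Complex.I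

theorem anticomm_involution (h : IsCliffordOn Q J n) {k : ℕ} (hk : 2 * k + 1 < n) :
    J (2 * k + 1) * cliffordInvolution J k = -(cliffordInvolution J k * J (2 * k + 1)) := by
  rw [cliffordInvolution, mul_smul_comm, smul_mul_assoc, ← mul_assoc,
    h.anticomm (2 * k + 1) hk (2 * k) (by omega) (by omega), neg_mul, smul_neg]

theorem involution_mul_self (h : IsCliffordOn Q J n) {k : ℕ} (hk : 2 * k + 1 < n) :
    cliffordInvolution J k * cliffordInvolution J k = Q := by
  have product_sq : J (2 * k) * J (2 * k + 1) * (J (2 * k) * J (2 * k + 1)) = -Q := by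
    calc _ = J (2 * k) * (J (2 * k + 1) * J (2 * k)) * J (2 * k + 1) := by
          simp only [mul_assoc]
      _ = -(J (2 * k) * J (2 * k)) * (J (2 * k + 1) * J (2 * k + 1)) := by
          rw [h.anticomm (2 * k + 1) hk (2 * k) (by omega) (by omega)]
          noncomm_ring
      _ = -Q := by
          rw [h.mul_self _ (by omega), h.mul_self _ hk, neg_neg, mul_neg, h.isIdempotentElem.eq]
  rw [cliffordInvolution, smul_mul_smul_comm, product_sq, Complex.I_mul_I, neg_one_smul, neg_neg]

theorem involution_mul_proj (h : IsCliffordOn Q J n) {k : ℕ} (hk : 2 * k + 1 < n) :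
    cliffordInvolution J k * Q = cliffordInvolution J k := by
  rw [cliffordInvolution, smul_mul_assoc, mul_assoc, h.mul_proj _ hk]

theorem proj_mul_involution (h : IsCliffordOn Q J n) {k : ℕ} (hk : 2 * k + 1 < n) :
    Q * cliffordInvolution J k = cliffordInvolution J k := by
  rw [cliffordInvolution, mul_smul_comm, ← mul_assoc, h.proj_mul _ (by omega)]

theorem commute_proj_involution (h : IsCliffordOn Q J n) {k : ℕ} (hk : 2 * k + 1 < n) :
    Commute Q (cliffordInvolution J k) :=
  (h.proj_mul_involution hk).trans (h.involution_mul_proj hk).symm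

theorem commute_involution_involution (h : IsCliffordOn Q J n) {j k : ℕ} (hj : 2 * j + 1 < n)
    (hk : 2 * k + 1 < n) : Commute (cliffordInvolution J j) (cliffordInvolution J k) := by
  rcases eq_or_ne j k with rfl | hjk
  · rfl
  · exact ((h.commute_involution (by omega) hk (by omega) (by omega)).mul_left
      (h.commute_involution hj hk (by omega) (by omega))).smul_left _

end IsCliffordOn

variable [DecidableEq ι]

/-- The joint spectral projection, inside the range of `Q`, of the first `p` of the commuting
involutions `cliffordInvolution J k` for the eigenvalue `1`. -/
def cliffordProjection (Q : Matrix ι ι ℂ) (J : ℕ → Matrix ι ι ℂ) : ℕ → Matrix ι ι ℂ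
  | 0 => Q
  | k + 1 => cliffordProjection Q J k * ((2⁻¹ : ℂ) • (1 + cliffordInvolution J k))

theorem commute_cliffordProjection {Z : Matrix ι ι ℂ} (hQ : Commute Z Q) {p : ℕ}
    (hG : ∀ k < p, Commute Z (cliffordInvolution J k)) : Commute Z (cliffordProjection Q J p) := by
  induction p with
  | zero => exact hQ
  | succ p ih =>
    exact (ih fun k hk => hG k (by omega)).mul_right
      (((Commute.one_right Z).add_right (hG p (by omega))).smul_right _)

namespace IsCliffordOn

theorem projection_mul_proj (h : IsCliffordOn Q J n) {p : ℕ} (hp : 2 * p ≤ n) :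
    cliffordProjection Q J p * Q = cliffordProjection Q J p := by
  induction p with
  | zero => exact h.isIdempotentElem
  | succ p ih =>
    rw [cliffordProjection, mul_assoc, smul_mul_assoc, add_mul, one_mul,
      h.involution_mul_proj (by omega)]
    conv_rhs => rw [← ih (by omega), mul_assoc, mul_smul_comm, mul_add, mul_one,
      h.proj_mul_involution (by omega)]

theorem proj_mul_projection (h : IsCliffordOn Q J n) {p : ℕ} (hp : 2 * p ≤ n) :
    Q * cliffordProjection Q J p = cliffordProjection Q J p := by
  rw [(commute_cliffordProjection rfl fun k hk => h.commute_proj_involution (by omega)).eq,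
    h.projection_mul_proj hp]

theorem isIdempotentElem_projection (h : IsCliffordOn Q J n) {p : ℕ} (hp : 2 * p ≤ n) :
    IsIdempotentElem (cliffordProjection Q J p) := by
  induction p with
  | zero => exact h.isIdempotentElem
  | succ p ih =>
    have comm : Commute (cliffordInvolution J p) (cliffordProjection Q J p) :=
      commute_cliffordProjection (h.commute_proj_involution (by omega)).symm
        fun k hk => h.commute_involution_involution (by omega) (by omega)
    have proj_eq := h.projection_mul_proj (p := p) (by omega)
    have sq_eq := h.involution_mul_self (k := p) (by omega)
    have ih := ih (by omega)
    rw [IsIdempotentElem, cliffordProjection]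
    set P := cliffordProjection Q J p
    set G := cliffordInvolution J p
    have product_eq : P * (1 + G) * (P * (1 + G)) = (2 : ℂ) • (P * (1 + G)) := by
      calc P * (1 + G) * (P * (1 + G)) = P * P + P * P * G + P * (G * P) + P * (G * P) * G := by
            noncomm_ring
        _ = P + P * G + P * G + P * (G * G) := by
            rw [comm.eq, ← mul_assoc P P G, ih.eq, mul_assoc P G G]
        _ = (2 : ℂ) • (P * (1 + G)) := by
            rw [sq_eq, proj_eq, two_smul, mul_add, mul_one]
            abel
    rw [mul_smul_comm, smul_mul_smul_comm, product_eq, smul_smul]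
    norm_num

-- `J (2 p + 1)` commutes with the projection and anticommutes with the involution.
theorem trace_projection_mul_involution (h : IsCliffordOn Q J n) {p : ℕ} (hp : 2 * p + 1 < n) :
    (cliffordProjection Q J p * cliffordInvolution J p).trace = 0 := by
  have comm : Commute (J (2 * p + 1)) (cliffordProjection Q J p) :=
    commute_cliffordProjection (h.commute_proj (by omega)) fun k hk =>
      h.commute_involution (by omega) (by omega) (by omega) (by omega)
  have inv_eq := h.involution_mul_proj hp
  have anticomm := h.anticomm_involution hp
  have sq_eq := h.mul_self (2 * p + 1) hp
  set P := cliffordProjection Q J p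
  set G := cliffordInvolution J p
  set B := J (2 * p + 1)
  have trace_eq : (P * G).trace = -(P * G * (B * B)).trace := by
    rw [sq_eq, mul_neg, Matrix.trace_neg, neg_neg, mul_assoc, inv_eq]
  have trace_eq_neg : (P * G * (B * B)).trace = -(P * G * (B * B)).trace := by
    calc (P * G * (B * B)).trace = (B * (P * G) * B).trace := by
          rw [← mul_assoc, Matrix.trace_mul_comm, ← mul_assoc]
      _ = (P * (B * G) * B).trace := by rw [← mul_assoc, comm.eq, mul_assoc P B G]
      _ = -(P * G * (B * B)).trace := by
          rw [anticomm, mul_neg, neg_mul, Matrix.trace_neg]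
          simp only [mul_assoc]
  rw [trace_eq, neg_eq_zero]
  exact self_eq_neg.1 trace_eq_neg

theorem two_pow_mul_trace_projection (h : IsCliffordOn Q J n) {p : ℕ} (hp : 2 * p ≤ n) :
    2 ^ p * (cliffordProjection Q J p).trace = Q.trace := by
  induction p with
  | zero => simp [cliffordProjection]
  | succ p ih =>
    rw [← ih (by omega), cliffordProjection, mul_smul_comm, Matrix.trace_smul, mul_add, mul_one,
      Matrix.trace_add, h.trace_projection_mul_involution (by omega), smul_eq_mul, pow_succ]
    ring

theorem two_pow_mul_rank_projection (h : IsCliffordOn Q J n) {p : ℕ} (hp : 2 * p ≤ n) :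
    2 ^ p * (cliffordProjection Q J p).rank = Q.rank := by
  have trace_eq := h.two_pow_mul_trace_projection hp
  rw [trace_eq_rank_of_isIdempotentElem (h.isIdempotentElem_projection hp),
    trace_eq_rank_of_isIdempotentElem h.isIdempotentElem] at trace_eq
  exact_mod_cast trace_eq

end IsCliffordOn

end Clifford

theorem IsCliffordOn.two_pow_le_rank {ι : Type*} [Fintype ι] {Q : Matrix ι ι ℂ}
    {J : ℕ → Matrix ι ι ℂ} {n p : ℕ} (h : IsCliffordOn Q J n) (hp : 2 * p ≤ n)
    (hQ : 0 < Q.rank) : 2 ^ p ≤ Q.rank := by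
  classical
  rw [← h.two_pow_mul_rank_projection hp] at hQ ⊢
  exact Nat.le_mul_of_pos_right _ (Nat.pos_of_mul_pos_left hQ)

/-! ### Real Clifford representations -/

section RealClifford

variable {ι : Type*} [Fintype ι] {Q : Matrix ι ι ℂ} {J : ℕ → Matrix ι ι ℂ} {n : ℕ}

/-- The generator that is used as the `k`-th factor of `cliffordFlip`: the second one of the
`k`-th pair if `k < p`, and the first one of the pair otherwise. -/
def flipIndex (p k : ℕ) : ℕ := if k < p then 2 * k + 1 else 2 * k

theorem flipIndex_injective (p : ℕ) : Function.Injective (flipIndex p) := by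
  intro i j h
  unfold flipIndex at h
  split_ifs at h <;> omega

/-- A product of generators that anticommutes with the first `p` involutions. Composed with
complex conjugation, it preserves their joint spectral projection if the generators are real. -/
def cliffordFlip (Q : Matrix ι ι ℂ) (J : ℕ → Matrix ι ι ℂ) (p : ℕ) : ℕ → Matrix ι ι ℂ
  | 0 => Q
  | k + 1 => cliffordFlip Q J p k * J (flipIndex p k)

namespace IsCliffordOn

theorem mul_flip (h : IsCliffordOn Q J n) {p r k : ℕ} (hr : ∀ j < r, flipIndex p j < n)
    (hk : flipIndex p k < n) (hrk : r ≤ k) : J (flipIndex p k) * cliffordFlip Q J p r =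
      (-1 : ℂ) ^ r • (cliffordFlip Q J p r * J (flipIndex p k)) := by
  induction r with
  | zero => simpa [cliffordFlip] using (h.commute_proj hk).eq
  | succ r ih =>
    rw [cliffordFlip, ← mul_assoc, ih (fun j hj => hr j (by omega)) (by omega), smul_mul_assoc,
      mul_assoc, h.anticomm _ hk _ (hr r (by omega)) ((flipIndex_injective p).ne (by omega)),
      mul_neg, ← mul_assoc, pow_succ, mul_neg_one, neg_smul, smul_neg]

theorem flip_mul_self (h : IsCliffordOn Q J n) {p q : ℕ} (hq : ∀ k < q, flipIndex p k < n) :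
    cliffordFlip Q J p q * cliffordFlip Q J p q = (-1 : ℂ) ^ (q * (q + 1) / 2) • Q := by
  induction q with
  | zero => simp [cliffordFlip, h.isIdempotentElem.eq]
  | succ q ih =>
    have hq' : ∀ k < q, flipIndex p k < n := fun k hk => hq k (by omega)
    have triangle_succ : (q + 1) * (q + 1 + 1) / 2 = q * (q + 1) / 2 + (q + 1) := by
      rw [← Nat.add_mul_div_right _ _ two_pos]
      ring_nf
    calc cliffordFlip Q J p (q + 1) * cliffordFlip Q J p (q + 1)
        = cliffordFlip Q J p q * (J (flipIndex p q) * cliffordFlip Q J p q) *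
            J (flipIndex p q) := by simp only [cliffordFlip, mul_assoc]
      _ = (-1 : ℂ) ^ q • (cliffordFlip Q J p q * cliffordFlip Q J p q *
            (J (flipIndex p q) * J (flipIndex p q))) := by
          rw [h.mul_flip hq' (hq q (by omega)) le_rfl, mul_smul_comm, smul_mul_assoc]
          simp only [mul_assoc]
      _ = (-1 : ℂ) ^ ((q + 1) * (q + 1 + 1) / 2) • Q := by
          rw [ih hq', h.mul_self _ (hq q (by omega)), triangle_succ, smul_mul_assoc, mul_neg,
            h.isIdempotentElem.eq, smul_smul, smul_neg, ← neg_smul, pow_add, pow_succ]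
          ring_nf

theorem commute_flip_proj (h : IsCliffordOn Q J n) {p q : ℕ} (hq : ∀ k < q, flipIndex p k < n) :
    Commute (cliffordFlip Q J p q) Q := by
  induction q with
  | zero => rfl
  | succ q ih =>
    exact (ih fun k hk => hq k (by omega)).mul_left (h.commute_proj (hq q (by omega)))

theorem commute_flipIndex_involution (h : IsCliffordOn Q J n) {p j k : ℕ} (hp : 2 * p ≤ n)
    (hj : j < p) (hkj : k ≠ j) (hk : flipIndex p k < n) :
    Commute (J (flipIndex p k)) (cliffordInvolution J j) := by
  refine h.commute_involution hk (by omega) ?_ ?_ <;>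
  · unfold flipIndex
    split_ifs <;> omega

theorem commute_flip_involution (h : IsCliffordOn Q J n) {p r j : ℕ} (hp : 2 * p ≤ n)
    (hj : j < p) (hr : r ≤ j) : Commute (cliffordFlip Q J p r) (cliffordInvolution J j) := by
  induction r with
  | zero => exact h.commute_proj_involution (by omega)
  | succ r ih =>
    have index_lt : flipIndex p r < n := by
      rw [flipIndex, if_pos (by omega)]
      omega
    exact (ih (by omega)).mul_left (h.commute_flipIndex_involution hp hj (by omega) index_lt)

theorem flip_mul_involution (h : IsCliffordOn Q J n) {p q j : ℕ} (hp : 2 * p ≤ n)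
    (hq : ∀ k < q, flipIndex p k < n) (hj : j < p) (hjq : j < q) :
    cliffordFlip Q J p q * cliffordInvolution J j =
      -(cliffordInvolution J j * cliffordFlip Q J p q) := by
  induction q, hjq using Nat.le_induction with
  | base =>
    rw [Nat.succ_eq_add_one, cliffordFlip, flipIndex, if_pos hj, mul_assoc,
      h.anticomm_involution (by omega), mul_neg, ← mul_assoc,
      (h.commute_flip_involution hp hj le_rfl).eq, mul_assoc]
  | succ q hjq ih =>
    rw [cliffordFlip, mul_assoc,
      (h.commute_flipIndex_involution hp hj (by omega) (hq q (by omega))).eq, ← mul_assoc,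
      ih fun k hk => hq k (by omega), neg_mul, mul_assoc]

end IsCliffordOn

theorem neg_one_pow_triangle {q : ℕ} (hq : q % 4 = 1 ∨ q % 4 = 2) :
    (-1 : ℂ) ^ (q * (q + 1) / 2) = -1 := by
  obtain ⟨t, rfl | rfl⟩ : ∃ t, q = 4 * t + 1 ∨ q = 4 * t + 2 := ⟨q / 4, by omega⟩
  · exact Odd.neg_one_pow
      ⟨4 * t * t + 3 * t, Nat.div_eq_of_eq_mul_left two_pos (by ring)⟩
  · exact Odd.neg_one_pow
      ⟨4 * t * t + 5 * t + 1, Nat.div_eq_of_eq_mul_left two_pos (by ring)⟩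

variable [DecidableEq ι]

theorem conjMatrix_cliffordInvolution {k : ℕ} (h1 : conjMatrix (J (2 * k)) = J (2 * k))
    (h2 : conjMatrix (J (2 * k + 1)) = J (2 * k + 1)) :
    conjMatrix (cliffordInvolution J k) = -cliffordInvolution J k := by
  rw [cliffordInvolution, conjMatrix_smul, map_mul, h1, h2, Complex.star_def, Complex.conj_I,
    neg_smul]

theorem conjMatrix_cliffordFlip (hQ : conjMatrix Q = Q) {p q : ℕ}
    (hJ : ∀ k < q, conjMatrix (J (flipIndex p k)) = J (flipIndex p k)) :
    conjMatrix (cliffordFlip Q J p q) = cliffordFlip Q J p q := by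
  induction q with
  | zero => exact hQ
  | succ q ih => rw [cliffordFlip, map_mul, ih fun k hk => hJ k (by omega), hJ q (by omega)]

namespace IsCliffordOn

theorem flip_mul_conjMatrix_projection (h : IsCliffordOn Q J n) {p q r : ℕ} (hp : 2 * p ≤ n)
    (hpq : p ≤ q) (hq : ∀ k < q, flipIndex p k < n) (hQ : conjMatrix Q = Q)
    (hJ : ∀ i < n, conjMatrix (J i) = J i) (hr : r ≤ p) :
    cliffordFlip Q J p q * conjMatrix (cliffordProjection Q J r) =
      cliffordProjection Q J r * cliffordFlip Q J p q := by
  induction r with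
  | zero => rw [cliffordProjection, hQ, (h.commute_flip_proj hq).eq]
  | succ r ih =>
    have star_half : star (2⁻¹ : ℂ) = 2⁻¹ := by simp
    rw [cliffordProjection, map_mul, ← mul_assoc, ih (by omega), conjMatrix_smul, star_half,
      map_add, map_one, conjMatrix_cliffordInvolution (hJ _ (by omega)) (hJ _ (by omega)),
      mul_assoc, mul_assoc, mul_smul_comm, smul_mul_assoc, mul_add, mul_neg,
      h.flip_mul_involution hp hq (by omega : r < p) (by omega), neg_neg, mul_one, add_mul,
      one_mul]

theorem two_pow_succ_le_rank (h : IsCliffordOn Q J n) {p q : ℕ} (hp : 2 * p ≤ n)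
    (hpq : p ≤ q) (hq : ∀ k < q, flipIndex p k < n) (hsign : q % 4 = 1 ∨ q % 4 = 2)
    (hrank : 0 < Q.rank) (hQ : conjMatrix Q = Q) (hJ : ∀ i < n, conjMatrix (J i) = J i) :
    2 ^ (p + 1) ≤ Q.rank := by
  have quaternionic : cliffordFlip Q J p q * conjMatrix (cliffordFlip Q J p q) *
      cliffordProjection Q J p = -cliffordProjection Q J p := by
    rw [conjMatrix_cliffordFlip hQ fun k hk => hJ _ (hq k hk), h.flip_mul_self hq,
      neg_one_pow_triangle hsign, smul_mul_assoc, h.proj_mul_projection hp, neg_one_smul]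
  have rank_ne_one := rank_ne_one_of_quaternionic (h.isIdempotentElem_projection hp)
    (h.flip_mul_conjMatrix_projection hp hpq hq hQ hJ le_rfl) quaternionic
  rw [← h.two_pow_mul_rank_projection hp] at hrank ⊢
  have rank_pos := Nat.pos_of_mul_pos_left hrank
  rw [pow_succ]
  exact Nat.mul_le_mul_left _ (by omega)

end IsCliffordOn

end RealClifford

/-! ### Schmidt coefficients of maskers -/

section EigenProjection

variable {A : Type} [Fintype A] [DecidableEq A] {τ : Matrix A A ℂ}

/-- The orthogonal projection onto the eigenspace of the Hermitian matrix `τ` for the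
eigenvalue `c`. -/
def eigenProjection (τ : Matrix A A ℂ) (c : ℝ) : Matrix A A ℂ :=
  cfc (fun x : ℝ => if x = c then 1 else 0) τ

theorem isIdempotentElem_eigenProjection (τ : Matrix A A ℂ) (c : ℝ) :
    IsIdempotentElem (eigenProjection τ c) := by
  rw [IsIdempotentElem, eigenProjection, cfc_mul_cfc]
  simp only [mul_ite, mul_one, mul_zero, ← ite_and, and_self]

theorem isHermitian_eigenProjection (τ : Matrix A A ℂ) (c : ℝ) :
    (eigenProjection τ c).IsHermitian :=
  cfc_predicate _ τ

theorem mul_eigenProjection (hτ : τ.IsHermitian) (c : ℝ) :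
    τ * eigenProjection τ c = (c : ℂ) • eigenProjection τ c := by
  have hsa : IsSelfAdjoint τ := hτ
  have mul_eq := cfc_mul_cfc (fun x : ℝ => x) (fun x => if x = c then 1 else 0) τ
  rw [cfc_id' ℝ τ] at mul_eq
  rw [eigenProjection, mul_eq, Complex.coe_smul,
    ← cfc_smul c _ τ (τ.finite_real_spectrum.continuousOn _)]
  congr 1
  ext x
  split_ifs with hx <;> simp [hx]

theorem commute_eigenProjection {Z : Matrix A A ℂ} (hZ : Commute Z τ) (c : ℝ) :
    Commute Z (eigenProjection τ c) :=
  (hZ.symm.cfc_real _).symm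

theorem rank_eigenProjection_pos (hτ : τ.IsHermitian) {c : ℝ} (hc : c ∈ spectrum ℝ τ) :
    0 < (eigenProjection τ c).rank := by
  have projection_ne_zero : eigenProjection τ c ≠ 0 := fun eq_zero => by
    have eqOn := eqOn_of_cfc_eq_cfc (eq_zero.trans (cfc_const_zero ℝ τ).symm)
      (τ.finite_real_spectrum.continuousOn _) continuousOn_const hτ
    simpa using eqOn hc
  rw [Matrix.rank, Module.finrank_pos_iff, Submodule.nontrivial_iff_ne_bot, Ne,
    LinearMap.range_eq_bot]
  exact fun eq_zero => projection_ne_zero (Matrix.toLin'.map_eq_zero_iff.1 eq_zero)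

theorem conjMatrix_eigenProjection (hτ : τ.IsHermitian) (hreal : conjMatrix τ = τ) (c : ℝ) :
    conjMatrix (eigenProjection τ c) = eigenProjection τ c := by
  let φ : Matrix A A ℂ →⋆ₐ[ℝ] Matrix A A ℂ :=
    { Complex.conjAe.toAlgHom.mapMatrix with
      map_star' := fun Z => by ext i j; simp [Matrix.star_apply] }
  have map_cfc := StarAlgHomClass.map_cfc (S := ℝ) φ (fun x : ℝ => if x = c then 1 else 0) τ
    (τ.finite_real_spectrum.continuousOn _)
    (continuous_matrix fun i j => Complex.continuous_conj.comp (continuous_id.matrix_elem i j))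
    hτ (show IsSelfAdjoint (conjMatrix τ) from hreal.symm ▸ hτ)
  exact map_cfc.trans (congrArg (eigenProjection · c) hreal)

theorem le_one_div_of_le_rank_eigenProjection (hτ : τ.PosSemidef) (htr : τ.trace = 1) {c : ℝ}
    (hc : 0 < c) {k : ℕ} (hk : 0 < k) (hrank : k ≤ (eigenProjection τ c).rank) : c ≤ 1 / k := by
  have trace_le := re_trace_mul_projection_le hτ (isHermitian_eigenProjection τ c)
    (isIdempotentElem_eigenProjection τ c)
  rw [mul_eigenProjection hτ.1, Matrix.trace_smul, htr,
    trace_eq_rank_of_isIdempotentElem (isIdempotentElem_eigenProjection τ c), smul_eq_mul,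
    Complex.re_ofReal_mul, Complex.natCast_re, Complex.one_re] at trace_le
  have k_le : (k : ℝ) ≤ (eigenProjection τ c).rank := by exact_mod_cast hrank
  rw [le_div_iff₀ (by exact_mod_cast hk)]
  exact (mul_le_mul_of_nonneg_left k_le hc.le).trans trace_le

end EigenProjection

theorem fin_ofNat_ne {n j k : ℕ} (hj : j < n + 1) (hk : k < n + 1) (h : j ≠ k) :
    Fin.ofNat (n + 1) j ≠ Fin.ofNat (n + 1) k := by
  rw [Ne, Fin.ext_iff, Fin.val_ofNat, Fin.val_ofNat, Nat.mod_eq_of_lt hj, Nat.mod_eq_of_lt hk]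
  exact h

section MaskFamily

variable {A B : Type} [Fintype A] [Fintype B]

/-- The algebraic relations satisfied by the coefficient matrices `X j` of the kets `M |j⟩`, when
`M` masks the real states. The matrices `τ` and `τ'` are the two constant reduced states, up to a
transpose of the second one. -/
structure IsMaskFamily {d : ℕ} (X : Fin d → Matrix A B ℂ) (τ : Matrix A A ℂ)
    (τ' : Matrix B B ℂ) : Prop where
  left : ∀ j, X j * (X j)ᴴ = τ
  right : ∀ j, (X j)ᴴ * X j = τ'
  left_cross : ∀ j k, j ≠ k → X j * (X k)ᴴ = -(X k * (X j)ᴴ)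
  right_cross : ∀ j k, j ≠ k → (X j)ᴴ * X k = -((X k)ᴴ * X j)

variable {n : ℕ} {X : Fin (n + 1) → Matrix A B ℂ} {τ : Matrix A A ℂ} {τ' : Matrix B B ℂ}

namespace IsMaskFamily

theorem posSemidef (h : IsMaskFamily X τ τ') : τ.PosSemidef := by
  rw [← h.left 0]
  exact Matrix.posSemidef_self_mul_conjTranspose _

theorem commute (h : IsMaskFamily X τ τ') (j k : Fin (n + 1)) : Commute (X j * (X k)ᴴ) τ := by
  calc X j * (X k)ᴴ * τ = X j * ((X k)ᴴ * X k) * (X k)ᴴ := by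
        rw [← h.left k]
        simp only [Matrix.mul_assoc]
    _ = X j * (X j)ᴴ * (X j * (X k)ᴴ) := by
        rw [h.right k, ← h.right j]
        simp only [Matrix.mul_assoc]
    _ = τ * (X j * (X k)ᴴ) := by rw [h.left j]

end IsMaskFamily

variable [DecidableEq A]

/-- The complex structures that a masker induces on the eigenspace of the reduced state `τ` for the
eigenvalue `c`. -/
def maskGenerator (X : Fin (n + 1) → Matrix A B ℂ) (τ : Matrix A A ℂ) (c : ℝ) (k : ℕ) :
    Matrix A A ℂ :=
  (c⁻¹ : ℂ) • (X (Fin.ofNat (n + 1) (k + 1)) * (X 0)ᴴ * eigenProjection τ c)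

namespace IsMaskFamily

theorem maskGenerator_mul_maskGenerator (h : IsMaskFamily X τ τ') {c : ℝ} (hc : c ≠ 0) (j : ℕ)
    {k : ℕ} (hk : k < n) : maskGenerator X τ c j * maskGenerator X τ c k =
      -((c⁻¹ : ℂ) • (X (Fin.ofNat (n + 1) (j + 1)) * (X (Fin.ofNat (n + 1) (k + 1)))ᴴ *
        eigenProjection τ c)) := by
  have cross := h.right_cross 0 (Fin.ofNat (n + 1) (k + 1))
    (fin_ofNat_ne (j := 0) (by omega) (by omega) (by omega))
  have commute := (commute_eigenProjection (h.commute (Fin.ofNat (n + 1) (k + 1)) 0) c).eq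
  have idem := (isIdempotentElem_eigenProjection τ c).eq
  have eigen := mul_eigenProjection h.posSemidef.1 c
  unfold maskGenerator
  set Q := eigenProjection τ c
  set Y := X (Fin.ofNat (n + 1) (j + 1))
  set Z := X (Fin.ofNat (n + 1) (k + 1))
  calc (c⁻¹ : ℂ) • (Y * (X 0)ᴴ * Q) * ((c⁻¹ : ℂ) • (Z * (X 0)ᴴ * Q))
      = ((c⁻¹ : ℂ) * (c⁻¹ : ℂ)) • (Y * (X 0)ᴴ * (Q * (Z * (X 0)ᴴ)) * Q) := by
        rw [smul_mul_smul_comm]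
        simp only [Matrix.mul_assoc]
    _ = ((c⁻¹ : ℂ) * (c⁻¹ : ℂ)) • (Y * ((X 0)ᴴ * Z) * (X 0)ᴴ * Q) := by
        rw [← commute]
        simp only [Matrix.mul_assoc, idem]
    _ = ((c⁻¹ : ℂ) * (c⁻¹ : ℂ)) • -(Y * Zᴴ * ((X 0 * (X 0)ᴴ) * Q)) := by
        rw [cross]
        simp only [Matrix.mul_neg, Matrix.neg_mul, Matrix.mul_assoc]
    _ = -((c⁻¹ : ℂ) • (Y * Zᴴ * Q)) := by
        rw [h.left 0, eigen, Matrix.mul_smul, smul_neg, smul_smul, mul_assoc,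
          inv_mul_cancel₀ (Complex.ofReal_ne_zero.2 hc), mul_one]

theorem isCliffordOn (h : IsMaskFamily X τ τ') {c : ℝ} (hc : c ≠ 0) :
    IsCliffordOn (eigenProjection τ c) (maskGenerator X τ c) n where
  isIdempotentElem := isIdempotentElem_eigenProjection τ c
  mul_proj i _ := by
    rw [maskGenerator, Matrix.smul_mul, Matrix.mul_assoc,
      (isIdempotentElem_eigenProjection τ c).eq]
  proj_mul i _ := by
    rw [maskGenerator, Matrix.mul_smul, (commute_eigenProjection (h.commute _ 0) c).eq,
      ← Matrix.mul_assoc, (isIdempotentElem_eigenProjection τ c).eq]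
  mul_self i hi := by
    rw [h.maskGenerator_mul_maskGenerator hc i hi, h.left, mul_eigenProjection h.posSemidef.1,
      smul_smul, inv_mul_cancel₀ (Complex.ofReal_ne_zero.2 hc), one_smul]
  anticomm i hi j hj hij := by
    rw [h.maskGenerator_mul_maskGenerator hc i hj, h.maskGenerator_mul_maskGenerator hc j hi,
      h.left_cross _ _ (fin_ofNat_ne (by omega) (by omega) (by omega)), Matrix.neg_mul, smul_neg]

theorem spectrum_le_kappa (h : IsMaskFamily X τ τ') (htr : τ.trace = 1) {c : ℝ}
    (hc : c ∈ spectrum ℝ τ) : c ≤ 1 / kappa (n + 1) := by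
  rcases le_or_gt c 0 with nonpos | pos
  · exact nonpos.trans (by positivity)
  · exact le_one_div_of_le_rank_eigenProjection h.posSemidef htr pos (by unfold kappa; positivity)
      ((h.isCliffordOn pos.ne').two_pow_le_rank (by rw [Nat.add_sub_cancel]; omega)
        (rank_eigenProjection_pos h.posSemidef.1 hc))

theorem two_pow_succ_le_rank (h : IsMaskFamily X τ τ')
    (hreal : ∀ j k, conjMatrix (X j * (X k)ᴴ) = X j * (X k)ᴴ)
    (hd : ¬((n + 1) % 8 = 0 ∨ (n + 1) % 8 = 1 ∨ (n + 1) % 8 = 7)) {c : ℝ} (hc : c ≠ 0)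
    (hcτ : c ∈ spectrum ℝ τ) : 2 ^ (n / 2 + 1) ≤ (eigenProjection τ c).rank := by
  have rank_pos := rank_eigenProjection_pos h.posSemidef.1 hcτ
  have real_proj : conjMatrix (eigenProjection τ c) = eigenProjection τ c :=
    conjMatrix_eigenProjection h.posSemidef.1 (h.left 0 ▸ hreal 0 0) c
  have real_generator (k : ℕ) (_ : k < n) :
      conjMatrix (maskGenerator X τ c k) = maskGenerator X τ c k := by
    rw [maskGenerator, conjMatrix_smul, map_mul, hreal, real_proj, star_inv₀, Complex.star_def,
      Complex.conj_ofReal]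
  by_cases hd2 : (n + 1) % 8 = 2
  · refine (h.isCliffordOn hc).two_pow_succ_le_rank (q := n / 2 + 1) (by omega) (by omega)
      (fun k hk => ?_) (by omega) rank_pos real_proj real_generator
    unfold flipIndex
    split_ifs <;> omega
  · refine (h.isCliffordOn hc).two_pow_succ_le_rank (q := n / 2) (by omega) le_rfl
      (fun k hk => ?_) (by omega) rank_pos real_proj real_generator
    rw [flipIndex, if_pos hk]
    omega

theorem spectrum_le_kappaReal (h : IsMaskFamily X τ τ') (htr : τ.trace = 1)
    (hreal : ∀ j k, conjMatrix (X j * (X k)ᴴ) = X j * (X k)ᴴ) {c : ℝ}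
    (hc : c ∈ spectrum ℝ τ) : c ≤ 1 / kappaReal (n + 1) := by
  rcases le_or_gt c 0 with nonpos | pos
  · exact nonpos.trans (by positivity)
  unfold kappaReal
  split_ifs with hd
  · exact h.spectrum_le_kappa htr hc
  · rw [kappa, Nat.add_sub_cancel, mul_comm, ← pow_succ]
    exact le_one_div_of_le_rank_eigenProjection h.posSemidef htr pos (by positivity)
      (h.two_pow_succ_le_rank hreal hd pos.ne' hc)

end IsMaskFamily

theorem cfc_abs_eq_of_mul_self_eq {H τ : Matrix A A ℂ} (hH : H.IsHermitian) (hτ : τ.PosSemidef)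
    (h : H * H = τ * τ) : cfc (fun x : ℝ => |x|) H = τ := by
  have hsa : IsSelfAdjoint τ := hτ.1
  have abs_eqOn : (spectrum ℝ τ).EqOn (fun x : ℝ => |x|) (fun x => x) := fun x hx =>
    abs_of_nonneg (by open scoped MatrixOrder in exact spectrum_nonneg_of_nonneg hτ.nonneg hx)
  rw [← cfc_sqrt_mul_self hH, h, cfc_sqrt_mul_self hτ.1, cfc_congr abs_eqOn, cfc_id' ℝ τ]

theorem two_mul_le_trace_cfc_abs {H : Matrix A A ℂ} (hH : H.IsHermitian) (htr : H.trace = 0)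
    {c : ℝ} (hc : c ∈ spectrum ℝ (cfc (fun x : ℝ => |x|) H)) :
    2 * c ≤ (cfc (fun x : ℝ => |x|) H).trace.re := by
  have spectrum_eq := cfc_map_spectrum (fun x : ℝ => |x|) H hH
  rw [spectrum_eq, hH.spectrum_real_eq_range_eigenvalues] at hc
  obtain ⟨-, ⟨j, rfl⟩, rfl⟩ := hc
  have sum_eq : ∑ i, hH.eigenvalues i = 0 := by
    rw [hH.trace_eq_sum_eigenvalues, ← RCLike.ofReal_sum] at htr
    exact RCLike.ofReal_eq_zero.1 htr
  rw [trace_cfc hH, ← Complex.ofReal_sum, Complex.ofReal_re,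
    ← Finset.add_sum_erase _ _ (Finset.mem_univ j)]
  rw [← Finset.add_sum_erase _ _ (Finset.mem_univ j)] at sum_eq
  have abs_le := Finset.abs_sum_le_sum_abs hH.eigenvalues (Finset.univ.erase j)
  rw [← abs_neg, ← eq_neg_of_add_eq_zero_left sum_eq] at abs_le
  simp only
  linarith

-- `H = i X₁ X₀†` is Hermitian and traceless with `H² = τ²`, hence `τ = |H|`: each eigenvalue of `τ`
-- is balanced by the eigenvalues of `H` of the opposite sign.
theorem IsMaskFamily.spectrum_le_half (h : IsMaskFamily X τ τ') (hn : 1 ≤ n) (htr : τ.trace = 1)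
    (horth : ∀ j k, j ≠ k → (X j * (X k)ᴴ).trace = 0) {c : ℝ} (hc : c ∈ spectrum ℝ τ) :
    c ≤ 1 / 2 := by
  obtain ⟨k, hk⟩ : ∃ k : Fin (n + 1), k ≠ 0 :=
    ⟨Fin.ofNat (n + 1) 1, fin_ofNat_ne (k := 0) (by omega) (by omega) (by omega)⟩
  set H : Matrix A A ℂ := Complex.I • (X k * (X 0)ᴴ) with hHdef
  have hermitian : H.IsHermitian := by
    rw [Matrix.IsHermitian, hHdef, Matrix.conjTranspose_smul, Matrix.conjTranspose_mul,
      Matrix.conjTranspose_conjTranspose, h.left_cross _ _ hk.symm, Complex.star_def,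
      Complex.conj_I, neg_smul_neg]
  have mul_self : H * H = τ * τ := by
    calc H * H = -(X k * ((X 0)ᴴ * X k) * (X 0)ᴴ) := by
          rw [hHdef, smul_mul_smul_comm, Complex.I_mul_I, neg_one_smul]
          simp only [Matrix.mul_assoc]
      _ = (X k * (X k)ᴴ) * (X 0 * (X 0)ᴴ) := by
          rw [h.right_cross 0 k hk.symm]
          simp only [Matrix.mul_neg, Matrix.neg_mul, neg_neg, Matrix.mul_assoc]
      _ = τ * τ := by rw [h.left, h.left]
  have trace_eq : H.trace = 0 := by
    rw [hHdef, Matrix.trace_smul, horth _ _ hk, smul_zero]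
  have abs_eq := cfc_abs_eq_of_mul_self_eq hermitian h.posSemidef mul_self
  have two_mul_le := two_mul_le_trace_cfc_abs hermitian trace_eq (abs_eq.symm ▸ hc)
  rw [abs_eq, htr, Complex.one_re] at two_mul_le
  linarith

end MaskFamily

/-! ### Maskers of the real states -/

section RealKet

variable {ι : Type}

/-- The ket with real amplitudes `c`. -/
def realKet (c : ι → ℝ) : ι → ℂ := fun j => c j

theorem ketBra_realKet_smul (s : ℝ) (c : ι → ℝ) :
    ketBra (realKet (s • c)) = ((s ^ 2 : ℝ) : ℂ) • ketBra (realKet c) := by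
  ext i j
  simp only [ketBra, realKet, Matrix.vecMulVec_apply, Matrix.smul_apply, Pi.smul_apply,
    Pi.star_apply, smul_eq_mul, Complex.star_def, Complex.conj_ofReal]
  push_cast
  ring

variable [Fintype ι]

theorem trace_ketBra_realKet (c : ι → ℝ) :
    (ketBra (realKet c)).trace = ((∑ j, c j ^ 2 : ℝ) : ℂ) := by
  simp [ketBra, Matrix.trace_vecMulVec, dotProduct, realKet, sq]

theorem ketBra_realKet_mem_realPureStates {c : ι → ℝ} (hc : ∑ j, c j ^ 2 = 1) :
    ketBra (realKet c) ∈ realPureStates ι := by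
  have isDensity : IsDensity (ketBra (realKet c)) :=
    ⟨Matrix.posSemidef_vecMulVec_self_star _, by rw [trace_ketBra_realKet, hc, Complex.ofReal_one]⟩
  refine ⟨⟨isDensity, fun i j => ?_⟩, isDensity, _, rfl⟩
  simp [ketBra, Matrix.vecMulVec_apply, realKet]

theorem exists_ketBra_realKet_eq_smul {c : ι → ℝ} (hc : c ≠ 0) :
    ∃ ρ ∈ realPureStates ι, ketBra (realKet c) = ((∑ j, c j ^ 2 : ℝ) : ℂ) • ρ := by
  obtain ⟨j, hj⟩ := Function.ne_iff.1 hc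
  have sum_pos : 0 < ∑ j, c j ^ 2 :=
    Finset.sum_pos' (fun _ _ => sq_nonneg _) ⟨j, Finset.mem_univ j, sq_pos_of_ne_zero hj⟩
  set s := ∑ j, c j ^ 2
  refine ⟨ketBra (realKet ((√s)⁻¹ • c)), ketBra_realKet_mem_realPureStates ?_, ?_⟩
  · simp only [Pi.smul_apply, smul_eq_mul, mul_pow, ← Finset.mul_sum, inv_pow,
      Real.sq_sqrt sum_pos.le]
    exact inv_mul_cancel₀ sum_pos.ne'
  · rw [ketBra_realKet_smul, smul_smul, ← Complex.ofReal_mul, inv_pow, Real.sq_sqrt sum_pos.le,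
      mul_inv_cancel₀ sum_pos.ne', Complex.ofReal_one, one_smul]

theorem exists_sum_ketBra_realKet_eq {ρ : Matrix ι ι ℂ} (hρ : ρ ∈ realStates ι) :
    ∃ (m : ℕ) (r : Fin m ⊕ Fin m → ι → ℝ),
      ∑ i, ketBra (realKet (r i)) = ρ ∧ ∑ i, ∑ j, r i j ^ 2 = 1 := by
  obtain ⟨⟨posSemidef, trace_eq⟩, im_eq_zero⟩ := hρ
  obtain ⟨m, ξ, hξ⟩ := Matrix.posSemidef_iff_eq_sum_vecMulVec.1 posSemidef
  let r : Fin m ⊕ Fin m → ι → ℝ := Sum.elim (fun i j => (ξ i j).re) fun i j => (ξ i j).im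
  have sum_eq : ∑ i, ketBra (realKet (r i)) = ρ := by
    ext j k
    rw [← Complex.re_add_im (ρ j k), im_eq_zero, hξ]
    simp only [Matrix.sum_apply, ketBra, Matrix.vecMulVec_apply, Fintype.sum_sum_type, r, realKet,
      Sum.elim_inl, Sum.elim_inr, Pi.star_apply, Complex.star_def, Complex.conj_ofReal,
      Complex.re_sum, Complex.mul_re, Complex.conj_re, Complex.conj_im]
    rw [← Finset.sum_add_distrib]
    push_cast
    simp only [zero_mul, add_zero, mul_neg, sub_neg_eq_add]
  refine ⟨m, r, sum_eq, ?_⟩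
  rw [← sum_eq, Matrix.trace_sum] at trace_eq
  simp only [trace_ketBra_realKet] at trace_eq
  exact_mod_cast trace_eq

end RealKet

section PartialTrace

variable {A B : Type}

theorem traceB_pureOp [Fintype B] (X : Matrix A B ℂ) : traceB (pureOp X) = X * Xᴴ := by
  ext a a'
  simp [traceB, pureOp, ketBra, Matrix.vecMulVec_apply, Matrix.mul_apply]

theorem traceA_pureOp [Fintype A] (X : Matrix A B ℂ) : traceA (pureOp X) = (Xᴴ * X)ᵀ := by
  ext b b'
  simp [traceA, pureOp, ketBra, Matrix.vecMulVec_apply, Matrix.mul_apply, mul_comm]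

theorem traceB_sum [Fintype B] {ι : Type*} (s : Finset ι) (ρ : ι → Matrix (A × B) (A × B) ℂ) :
    traceB (∑ i ∈ s, ρ i) = ∑ i ∈ s, traceB (ρ i) := by
  ext a a'
  simp only [traceB, Matrix.of_apply, Matrix.sum_apply]
  exact Finset.sum_comm

theorem traceA_sum [Fintype A] {ι : Type*} (s : Finset ι) (ρ : ι → Matrix (A × B) (A × B) ℂ) :
    traceA (∑ i ∈ s, ρ i) = ∑ i ∈ s, traceA (ρ i) := by
  ext b b'
  simp only [traceA, Matrix.of_apply, Matrix.sum_apply]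
  exact Finset.sum_comm

theorem traceB_smul [Fintype B] (z : ℂ) (ρ : Matrix (A × B) (A × B) ℂ) :
    traceB (z • ρ) = z • traceB ρ := by
  ext a a'
  simp [traceB, Finset.mul_sum]

theorem traceA_smul [Fintype A] (z : ℂ) (ρ : Matrix (A × B) (A × B) ℂ) :
    traceA (z • ρ) = z • traceA ρ := by
  ext b b'
  simp [traceA, Finset.mul_sum]

end PartialTrace

section Polarization

variable {A B : Type} {ι : Type*} [Fintype ι]

theorem conjTranspose_linearCombination (X : ι → Matrix A B ℂ) (c : ι → ℝ) :
    (Fintype.linearCombination ℝ X c)ᴴ = Fintype.linearCombination ℝ (fun j => (X j)ᴴ) c := by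
  simp [Fintype.linearCombination_apply, Matrix.conjTranspose_sum]

variable [Fintype B]

theorem linearCombination_mul_conjTranspose {X : ι → Matrix A B ℂ} {τ : Matrix A A ℂ}
    (hX : ∀ j, X j * (X j)ᴴ = τ) (hcross : ∀ j k, j ≠ k → X j * (X k)ᴴ = -(X k * (X j)ᴴ))
    (c : ι → ℝ) : Fintype.linearCombination ℝ X c * (Fintype.linearCombination ℝ X c)ᴴ =
      (∑ j, c j ^ 2) • τ := by
  classical
  have add_swap (j k : ι) : (c j * c k) • (X j * (X k)ᴴ) + (c k * c j) • (X k * (X j)ᴴ) =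
      if j = k then (2 : ℝ) • c j ^ 2 • τ else 0 := by
    split_ifs with hjk
    · rw [hjk, hX, ← two_smul ℝ, sq]
    · rw [hcross j k hjk, mul_comm (c k), smul_neg, neg_add_cancel]
  have expand : Fintype.linearCombination ℝ X c * (Fintype.linearCombination ℝ X c)ᴴ =
      ∑ j, ∑ k, (c j * c k) • (X j * (X k)ᴴ) := by
    rw [conjTranspose_linearCombination]
    simp only [Fintype.linearCombination_apply, Matrix.sum_mul, Matrix.mul_sum, Matrix.smul_mul,
      Matrix.mul_smul, smul_smul, Finset.smul_sum]
    exact Finset.sum_comm.trans (by simp only [mul_comm])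
  have two_smul_eq : (2 : ℝ) • ∑ j, ∑ k, (c j * c k) • (X j * (X k)ᴴ) =
      (2 : ℝ) • (∑ j, c j ^ 2) • τ := by
    rw [two_smul]
    nth_rewrite 2 [Finset.sum_comm]
    simp only [← Finset.sum_add_distrib, add_swap, Finset.sum_ite_eq, Finset.mem_univ, if_true,
      ← Finset.smul_sum, ← Finset.sum_smul]
  rw [expand]
  exact smul_right_injective _ (two_ne_zero' ℝ) two_smul_eq

theorem forall_linearCombination_mul_conjTranspose_iff {X : ι → Matrix A B ℂ} {τ : Matrix A A ℂ} :
    (∀ c : ι → ℝ, Fintype.linearCombination ℝ X c * (Fintype.linearCombination ℝ X c)ᴴ =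
      (∑ j, c j ^ 2) • τ) ↔
    (∀ j, X j * (X j)ᴴ = τ) ∧ ∀ j k, j ≠ k → X j * (X k)ᴴ = -(X k * (X j)ᴴ) := by
  classical
  refine ⟨fun h => ?_, fun ⟨hX, hcross⟩ => linearCombination_mul_conjTranspose hX hcross⟩
  have diag (j : ι) : X j * (X j)ᴴ = τ := by
    have single := h (Pi.single j 1)
    simpa [Fintype.linearCombination_apply_single, Pi.single_apply] using single
  refine ⟨diag, fun j k hjk => ?_⟩
  have pair := h (Pi.single j 1 + Pi.single k 1)
  have sum_sq : ∑ i, (Pi.single j 1 + Pi.single k 1 : ι → ℝ) i ^ 2 = 2 := by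
    simp [add_sq, Finset.sum_add_distrib, Pi.single_apply, hjk.symm, one_add_one_eq_two]
  rw [sum_sq, map_add, Fintype.linearCombination_apply_single,
    Fintype.linearCombination_apply_single, one_smul, one_smul, Matrix.conjTranspose_add,
    Matrix.add_mul, Matrix.mul_add, Matrix.mul_add, diag, diag, two_smul, add_assoc,
    add_right_inj, ← add_assoc, add_eq_right] at pair
  exact eq_neg_of_add_eq_zero_left pair

end Polarization

section Coeff

variable {A B : Type} {d : ℕ}

theorem isMaskFamily_iff [Fintype A] [Fintype B] {X : Fin d → Matrix A B ℂ} {τ : Matrix A A ℂ}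
    {τ' : Matrix B B ℂ} : IsMaskFamily X τ τ' ↔ ∀ c : Fin d → ℝ,
      Fintype.linearCombination ℝ X c * (Fintype.linearCombination ℝ X c)ᴴ = (∑ j, c j ^ 2) • τ ∧
      (Fintype.linearCombination ℝ X c)ᴴ * Fintype.linearCombination ℝ X c =
        (∑ j, c j ^ 2) • τ' := by
  have left_iff := forall_linearCombination_mul_conjTranspose_iff (X := X) (τ := τ)
  have right_iff := forall_linearCombination_mul_conjTranspose_iff (X := fun j => (X j)ᴴ) (τ := τ')
  simp only [← conjTranspose_linearCombination, Matrix.conjTranspose_conjTranspose] at right_iff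
  rw [forall_and, left_iff, right_iff]
  exact ⟨fun h => ⟨⟨h.left, h.left_cross⟩, h.right, h.right_cross⟩,
    fun h => ⟨h.1.1, h.2.1, h.1.2, h.2.2⟩⟩

/-- The coefficient matrix of the bipartite ket `M |j⟩`. -/
def coeff (M : Matrix (A × B) (Fin d) ℂ) (j : Fin d) : Matrix A B ℂ :=
  Matrix.of fun a b => M (a, b) j

theorem mul_ketBra_realKet_mul (M : Matrix (A × B) (Fin d) ℂ) (c : Fin d → ℝ) :
    M * ketBra (realKet c) * Mᴴ = pureOp (Fintype.linearCombination ℝ (coeff M) c) := by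
  have mulVec_eq : M *ᵥ realKet c =
      fun p => Fintype.linearCombination ℝ (coeff M) c p.1 p.2 := by
    ext p
    simp [Fintype.linearCombination_apply, Matrix.mulVec, dotProduct, Matrix.sum_apply, coeff,
      realKet, mul_comm]
  rw [pureOp, ketBra, ketBra, Matrix.mul_vecMulVec, Matrix.vecMulVec_mul, ← Matrix.star_mulVec,
    mulVec_eq]

variable [Fintype B]

theorem coeff_mul_conjTranspose_eq_traceB (M : Matrix (A × B) (Fin d) ℂ) (j k : Fin d) :
    coeff M j * (coeff M k)ᴴ = traceB (M * Matrix.single j k (1 : ℂ) * Mᴴ) := by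
  ext a a'
  simp [coeff, traceB, Matrix.mul_apply, Matrix.single_apply, ite_and]

variable [Fintype A]

theorem trace_coeff_mul_conjTranspose (M : Matrix (A × B) (Fin d) ℂ) (j k : Fin d) :
    (coeff M j * (coeff M k)ᴴ).trace = (Mᴴ * M) k j := by
  simp [Matrix.trace, Matrix.mul_apply, coeff, Fintype.sum_prod_type, mul_comm]

variable [DecidableEq A] [DecidableEq B]

theorem LOCCConvertible.of_mul_conjTranspose_eq_smul {B' ι : Type} [Fintype B'] [DecidableEq B']
    [Nonempty B'] [Fintype ι] {X : Matrix A B ℂ} {T : ι → Matrix A B' ℂ} {p : ι → ℝ}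
    (hp : ∀ i, 0 ≤ p i) (hsum : ∑ i, p i = 1)
    (hT : ∀ i, T i * (T i)ᴴ = p i • (X * Xᴴ)) :
    LOCCConvertible (pureOp X) (∑ i, pureOp (T i)) := by
  let K (i : ι) : Matrix A A ℂ := ((√(p i) : ℝ) : ℂ) • 1
  have sum_K : ∑ i, (K i)ᴴ * K i = 1 := by
    simp only [K, conjTranspose_sqrt_smul_mul (hp _), Matrix.conjTranspose_one, Matrix.mul_one,
      ← Finset.sum_smul, ← Complex.ofReal_sum, hsum, Complex.ofReal_one, one_smul]
  have after_K (i : ι) : K i * X * (K i * X)ᴴ = T i * (T i)ᴴ := by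
    rw [hT, Matrix.smul_mul, Matrix.one_mul, sqrt_smul_mul_conjTranspose (hp i), Complex.coe_smul]
  choose Λ hΛ hΛT using fun i => of_mul_conjTranspose_eq (after_K i)
  exact ⟨_, IsLOCC.alice _ K sum_K Λ hΛ, by simp only [kronecker_one_mul_pureOp_mul, hΛT]⟩

theorem IsMaskFamily.convertible [Nonempty B] {M : Matrix (A × B) (Fin d) ℂ} {τ : Matrix A A ℂ}
    {τ' : Matrix B B ℂ} (h : IsMaskFamily (coeff M) τ τ') (j : Fin d)
    {ρ : Matrix (Fin d) (Fin d) ℂ} (hρ : ρ ∈ realStates (Fin d)) :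
    LOCCConvertible (pureOp (coeff M j)) (M * ρ * Mᴴ) := by
  obtain ⟨m, r, rfl, sum_sq⟩ := exists_sum_ketBra_realKet_eq hρ
  simp only [Matrix.mul_sum, Matrix.sum_mul, mul_ketBra_realKet_mul]
  refine .of_mul_conjTranspose_eq_smul (fun i => Finset.sum_nonneg fun k _ => sq_nonneg (r i k))
    sum_sq fun i => ?_
  rw [(isMaskFamily_iff.1 h (r i)).1, h.left j]

end Coeff

section Masker

variable {d m n : ℕ} {M : Matrix (Fin m × Fin n) (Fin d) ℂ}

theorem IsMasker.isMaskFamily (h : IsMasker (realPureStates (Fin d)) M) :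
    ∃ τ τ', IsMaskFamily (coeff M) τ τ' := by
  obtain ⟨-, τ, τ', masks⟩ := h
  refine ⟨τ, τ'ᵀ, isMaskFamily_iff.2 fun c => ?_⟩
  rcases eq_or_ne c 0 with rfl | hc
  · simp
  obtain ⟨ρ, hρ, ketBra_eq⟩ := exists_ketBra_realKet_eq_smul hc
  have pureOp_eq := mul_ketBra_realKet_mul M c
  rw [ketBra_eq, Matrix.mul_smul, Matrix.smul_mul] at pureOp_eq
  rw [← traceB_pureOp, ← Matrix.transpose_transpose (_ᴴ * _), ← traceA_pureOp, ← pureOp_eq,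
    traceB_smul, traceA_smul, (masks ρ hρ).1, (masks ρ hρ).2, Matrix.transpose_smul,
    Complex.coe_smul, Complex.coe_smul]
  exact ⟨rfl, rfl⟩

theorem IsMaskFamily.isMasker {τ : Matrix (Fin m) (Fin m) ℂ} {τ' : Matrix (Fin n) (Fin n) ℂ}
    (h : IsMaskFamily (coeff M) τ τ') (hM : Mᴴ * M = 1) : IsMasker (realStates (Fin d)) M := by
  refine ⟨hM, τ, τ'ᵀ, fun ρ hρ => ?_⟩
  obtain ⟨k, r, rfl, sum_sq⟩ := exists_sum_ketBra_realKet_eq hρ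
  simp only [Matrix.mul_sum, Matrix.sum_mul, mul_ketBra_realKet_mul, traceB_sum, traceA_sum,
    traceB_pureOp, traceA_pureOp, isMaskFamily_iff.1 h, Matrix.transpose_smul, ← Finset.sum_smul,
    sum_sq, one_smul, and_self]

theorem IsRealMasker.conjMatrix_mul_ketBra_realKet_mul
    (h : IsRealMasker (realPureStates (Fin d)) M) (c : Fin d → ℝ) :
    conjMatrix (M * ketBra (realKet c) * Mᴴ) = M * ketBra (realKet c) * Mᴴ := by
  rcases eq_or_ne c 0 with rfl | hc
  · simp [mul_ketBra_realKet_mul, pureOp_zero]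
  obtain ⟨ρ, hρ, ketBra_eq⟩ := exists_ketBra_realKet_eq_smul hc
  have conj_eq : conjMatrix (M * ρ * Mᴴ) = M * ρ * Mᴴ := by
    ext x y
    exact Complex.conj_eq_iff_im.2 ((h.2 ρ hρ).2 x y)
  rw [ketBra_eq, Matrix.mul_smul, Matrix.smul_mul, conjMatrix_smul, conj_eq, Complex.star_def,
    Complex.conj_ofReal]

theorem single_eq_ketBra_mul_ketBra_mul_ketBra (j k : Fin d) :
    Matrix.single j k (1 : ℂ) = ketBra (realKet (Pi.single j 1)) * ketBra (realKet 1) *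
      ketBra (realKet (Pi.single k 1)) := by
  have ketBra_single (i : Fin d) : ketBra (realKet (Pi.single i 1)) = Matrix.single i i 1 := by
    have realKet_single : realKet (Pi.single i 1) = Pi.single i 1 :=
      funext fun a => by by_cases h : a = i <;> simp [realKet, h]
    rw [ketBra, realKet_single, Pi.star_single, star_one, Matrix.single_eq_single_vecMulVec_single]
  have ketBra_one : ketBra (realKet (1 : Fin d → ℝ)) j k = 1 := by
    simp [ketBra, realKet, Matrix.vecMulVec_apply]
  rw [ketBra_single, ketBra_single, Matrix.single_mul_mul_single, ketBra_one, one_mul, one_mul]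

theorem IsRealMasker.conjMatrix_coeff_mul_conjTranspose
    (h : IsRealMasker (realPureStates (Fin d)) M) (j k : Fin d) :
    conjMatrix (coeff M j * (coeff M k)ᴴ) = coeff M j * (coeff M k)ᴴ := by
  have isometry : Mᴴ * M = 1 := h.1.1
  have map_mul (P Q : Matrix (Fin d) (Fin d) ℂ) :
      M * (P * Q) * Mᴴ = M * P * Mᴴ * (M * Q * Mᴴ) := by
    calc M * (P * Q) * Mᴴ = M * P * (Mᴴ * M) * Q * Mᴴ := by
          simp only [isometry, Matrix.mul_one, Matrix.mul_assoc]
      _ = _ := by simp only [Matrix.mul_assoc]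
  have real : conjMatrix (M * Matrix.single j k (1 : ℂ) * Mᴴ) =
      M * Matrix.single j k (1 : ℂ) * Mᴴ := by
    simp only [single_eq_ketBra_mul_ketBra_mul_ketBra j k, map_mul, _root_.map_mul,
      h.conjMatrix_mul_ketBra_realKet_mul]
  rw [coeff_mul_conjTranspose_eq_traceB]
  conv_rhs => rw [← real]
  ext a a'
  simp [conjMatrix, traceB]

end Masker

/-! ### Clifford maskers -/

namespace IsCliffordFamily

variable {R R' : Type*} [CommRing R] [StarRing R] [CommRing R'] [StarRing R'] {κ ι : Type*}
  [Fintype ι] [DecidableEq ι] {J : κ → Matrix ι ι R}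

theorem map (hJ : IsCliffordFamily J) (f : R →+* R') (hf : Function.Semiconj f star star) :
    IsCliffordFamily fun i => f.mapMatrix (J i) where
  conjTranspose i := by
    rw [← map_neg, ← hJ.conjTranspose]
    exact (Matrix.conjTranspose_map f hf).symm
  mul_self i := by rw [← map_mul, hJ.mul_self, map_neg, map_one]
  anticomm i j hij := by rw [← map_mul, hJ.anticomm i j hij, map_neg, map_mul]

variable [IsAddTorsionFree R]

theorem trace_mul_eq_zero (hJ : IsCliffordFamily J) {i j : κ} (hij : i ≠ j) :
    (J i * J j).trace = 0 := by
  refine self_eq_neg.1 ?_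
  conv_lhs => rw [hJ.anticomm i j hij, Matrix.trace_neg, Matrix.trace_mul_comm]

theorem trace_eq_zero [Nontrivial κ] (hJ : IsCliffordFamily J) (i : κ) : (J i).trace = 0 := by
  obtain ⟨j, hj⟩ := exists_ne i
  have conj_eq_neg : J j * J i * J j = J i := by
    rw [hJ.anticomm j i hj, Matrix.neg_mul, Matrix.mul_assoc, hJ.mul_self, Matrix.mul_neg, neg_neg,
      Matrix.mul_one]
  refine self_eq_neg.1 ?_
  conv_lhs => rw [← conj_eq_neg, Matrix.mul_assoc, Matrix.trace_mul_comm, Matrix.mul_assoc,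
    hJ.mul_self, Matrix.mul_neg, Matrix.mul_one, Matrix.trace_neg]

theorem trace_eq_zero_of_trivialStar [TrivialStar R] (hJ : IsCliffordFamily J) (i : κ) :
    (J i).trace = 0 := by
  refine self_eq_neg.1 ?_
  rw [← Matrix.trace_neg, ← hJ.conjTranspose, Matrix.trace_conjTranspose, star_trivial]

end IsCliffordFamily

theorem IsMaskFamily.smul {A B : Type} [Fintype A] [Fintype B] {d : ℕ} {X : Fin d → Matrix A B ℂ}
    {τ : Matrix A A ℂ} {τ' : Matrix B B ℂ} (h : IsMaskFamily X τ τ') (z : ℂ) :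
    IsMaskFamily (fun j => z • X j) ((z * star z) • τ) ((z * star z) • τ') where
  left j := by
    rw [Matrix.conjTranspose_smul, Matrix.smul_mul, Matrix.mul_smul, smul_smul, h.left]
  right j := by
    rw [Matrix.conjTranspose_smul, Matrix.smul_mul, Matrix.mul_smul, smul_smul, h.right, mul_comm]
  left_cross j k hjk := by
    simp only [Matrix.conjTranspose_smul, Matrix.smul_mul, Matrix.mul_smul, h.left_cross j k hjk,
      smul_neg]
  right_cross j k hjk := by
    simp only [Matrix.conjTranspose_smul, Matrix.smul_mul, Matrix.mul_smul, h.right_cross j k hjk,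
      smul_neg]

namespace IsCliffordFamily

variable {ι : Type} [Fintype ι] [DecidableEq ι] {n : ℕ} {J : Fin n → Matrix ι ι ℂ}

theorem isMaskFamily_vecCons (hJ : IsCliffordFamily J) :
    IsMaskFamily (Matrix.vecCons 1 J) 1 1 where
  left j := by
    cases j using Fin.cases <;> simp [hJ.conjTranspose, hJ.mul_self]
  right j := by
    cases j using Fin.cases <;> simp [hJ.conjTranspose, hJ.mul_self]
  left_cross i j hij := by
    cases i using Fin.cases with
    | zero =>
      cases j using Fin.cases with
      | zero => exact absurd rfl hij
      | succ j => simp [hJ.conjTranspose]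
    | succ i =>
      cases j using Fin.cases with
      | zero => simp [hJ.conjTranspose]
      | succ j => simp [hJ.conjTranspose, hJ.anticomm i j (ne_of_apply_ne Fin.succ hij)]
  right_cross i j hij := by
    cases i using Fin.cases with
    | zero =>
      cases j using Fin.cases with
      | zero => exact absurd rfl hij
      | succ j => simp [hJ.conjTranspose]
    | succ i =>
      cases j using Fin.cases with
      | zero => simp [hJ.conjTranspose]
      | succ j => simp [hJ.conjTranspose, hJ.anticomm i j (ne_of_apply_ne Fin.succ hij)]

theorem trace_vecCons_mul_conjTranspose (hJ : IsCliffordFamily J) (htr : ∀ i, (J i).trace = 0)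
    {i j : Fin (n + 1)} (hij : i ≠ j) :
    (Matrix.vecCons 1 J i * (Matrix.vecCons 1 J j)ᴴ).trace = 0 := by
  cases i using Fin.cases with
  | zero =>
    cases j using Fin.cases with
    | zero => exact absurd rfl hij
    | succ j => simp [hJ.conjTranspose, htr]
  | succ i =>
    cases j using Fin.cases with
    | zero => simp [htr]
    | succ j => simp [hJ.conjTranspose, hJ.trace_mul_eq_zero (ne_of_apply_ne Fin.succ hij)]

end IsCliffordFamily

section CliffordMasker

variable {n k : ℕ} {J : Fin n → Matrix (Fin k) (Fin k) ℂ}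

/-- The masker defined by a Clifford family `J`: it maps the first basis vector to the standard
maximally entangled state `Φ`, and the other ones to `(J i ⊗ 1) Φ`. -/
def cliffordMasker (J : Fin n → Matrix (Fin k) (Fin k) ℂ) :
    Matrix (Fin k × Fin k) (Fin (n + 1)) ℂ :=
  Matrix.of fun x j => (Matrix.vecCons 1 J j * uniformCoeff (Fin k)) x.1 x.2

theorem pureOp_coeff_cliffordMasker_zero (J : Fin n → Matrix (Fin k) (Fin k) ℂ) :
    pureOp (coeff (cliffordMasker J) 0) = ketBra (stdMaxEntangled k) := by
  rw [ketBra_stdMaxEntangled, ← Matrix.one_mul (uniformCoeff (Fin k))]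
  rfl

theorem coeff_cliffordMasker (J : Fin n → Matrix (Fin k) (Fin k) ℂ) :
    coeff (cliffordMasker J) = fun j => ((1 / √(k : ℝ) : ℝ) : ℂ) • Matrix.vecCons 1 J j := by
  ext j a b
  simp [coeff, cliffordMasker, uniformCoeff]

theorem coeff_cliffordMasker_mul_conjTranspose (J : Fin n → Matrix (Fin k) (Fin k) ℂ)
    (i j : Fin (n + 1)) :
    coeff (cliffordMasker J) i * (coeff (cliffordMasker J) j)ᴴ =
      (k : ℂ)⁻¹ • (Matrix.vecCons 1 J i * (Matrix.vecCons 1 J j)ᴴ) := by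
  calc Matrix.vecCons 1 J i * uniformCoeff (Fin k) * (Matrix.vecCons 1 J j * uniformCoeff (Fin k))ᴴ
      = Matrix.vecCons 1 J i * (uniformCoeff (Fin k) * (uniformCoeff (Fin k))ᴴ) *
          (Matrix.vecCons 1 J j)ᴴ := by simp only [Matrix.conjTranspose_mul, Matrix.mul_assoc]
    _ = _ := by simp [uniformCoeff_mul_conjTranspose]

theorem conjTranspose_cliffordMasker_mul_self (hk : 0 < k) (hJ : IsCliffordFamily J)
    (htr : ∀ i, (J i).trace = 0) : (cliffordMasker J)ᴴ * cliffordMasker J = 1 := by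
  ext i j
  rw [← trace_coeff_mul_conjTranspose, coeff_cliffordMasker_mul_conjTranspose, Matrix.trace_smul]
  rcases eq_or_ne i j with rfl | hij
  · simp [hJ.isMaskFamily_vecCons.left, hk.ne']
  · rw [hJ.trace_vecCons_mul_conjTranspose htr hij.symm, smul_zero, Matrix.one_apply_ne hij]

theorem IsCliffordFamily.isMasker_cliffordMasker (hk : 0 < k) (hJ : IsCliffordFamily J)
    (htr : ∀ i, (J i).trace = 0) : IsMasker (realStates (Fin (n + 1))) (cliffordMasker J) :=
  ((coeff_cliffordMasker J).symm ▸ hJ.isMaskFamily_vecCons.smul _ :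
    IsMaskFamily (coeff (cliffordMasker J)) _ _).isMasker
    (conjTranspose_cliffordMasker_mul_self hk hJ htr)

end CliffordMasker

theorem IsMasker.isRealMasker {d m n : ℕ} {M : Matrix (Fin m × Fin n) (Fin d) ℂ}
    (h : IsMasker (realStates (Fin d)) M) (im_eq_zero : ∀ x j, (M x j).im = 0) :
    IsRealMasker (realStates (Fin d)) M := by
  refine ⟨h, fun ρ hρ => ⟨⟨hρ.1.1.mul_mul_conjTranspose_same M, ?_⟩, fun x y => ?_⟩⟩
  · rw [Matrix.trace_mul_comm, ← Matrix.mul_assoc, h.1, Matrix.one_mul, hρ.1.2]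
  · simp [Matrix.mul_apply, Complex.mul_im, im_eq_zero, hρ.2]

theorem kappaReal_pos (d : ℕ) : 0 < kappaReal d := by
  unfold kappaReal kappa
  split_ifs <;> positivity

theorem exists_isMasker {n : ℕ} (hn : 1 ≤ n) :
    ∃ M : Matrix (Fin (max (kappa (n + 1)) 2) × Fin (max (kappa (n + 1)) 2)) (Fin (n + 1)) ℂ,
      IsMasker (realStates (Fin (n + 1))) M ∧
      pureOp (coeff M 0) = ketBra (stdMaxEntangled (max (kappa (n + 1)) 2)) := by
  have max_eq : max (kappa (n + 1)) 2 = 2 ^ max (n / 2) 1 :=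
    ((pow_right_mono₀ (one_le_two (α := ℕ))).map_max (a := n / 2) (b := 1)).symm
  rw [max_eq]
  obtain ⟨J, hJ⟩ := hasClifford_complex (max (n / 2) 1)
  have : Nontrivial (Fin (2 * max (n / 2) 1 + 1)) := Fin.nontrivial_iff_two_le.2 (by omega)
  have restrict := hJ.comp (Fin.castLEEmb (by omega : n ≤ 2 * max (n / 2) 1 + 1))
  exact ⟨_, restrict.isMasker_cliffordMasker (by positivity) fun i => hJ.trace_eq_zero _,
    pureOp_coeff_cliffordMasker_zero _⟩

theorem exists_isRealMasker (n : ℕ) :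
    ∃ M : Matrix (Fin (kappaReal (n + 1)) × Fin (kappaReal (n + 1))) (Fin (n + 1)) ℂ,
      IsRealMasker (realStates (Fin (n + 1))) M ∧
      pureOp (coeff M 0) = ketBra (stdMaxEntangled (kappaReal (n + 1))) := by
  obtain ⟨J, hJ⟩ : HasClifford ℝ n (kappaReal (n + 1)) := hasClifford_kappaReal n.succ_pos
  have hJC := hJ.map Complex.ofRealHom fun x => (Complex.conj_ofReal x).symm
  have trace_eq_zero (i : Fin n) : (Complex.ofRealHom.mapMatrix (J i)).trace = 0 :=
    (AddMonoidHom.map_trace Complex.ofRealHom (J i)).symm.trans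
      (by rw [hJ.trace_eq_zero_of_trivialStar, map_zero])
  refine ⟨_, (hJC.isMasker_cliffordMasker (kappaReal_pos _) trace_eq_zero).isRealMasker
    fun x j => ?_, pureOp_coeff_cliffordMasker_zero _⟩
  cases j using Fin.cases <;>
    simp [cliffordMasker, uniformCoeff, Matrix.one_apply, apply_ite Complex.im]

/-! ### The entanglement of masking -/

section Masking

theorem IsMasker.mono {d m n : ℕ} {S S' : Set (Matrix (Fin d) (Fin d) ℂ)}
    {M : Matrix (Fin m × Fin n) (Fin d) ℂ} (h : IsMasker S M) (hS : S' ⊆ S) : IsMasker S' M := by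
  obtain ⟨isometry, τ, τ', masks⟩ := h
  exact ⟨isometry, τ, τ', fun ρ hρ => masks ρ (hS hρ)⟩

theorem IsRealMasker.mono {d m n : ℕ} {S S' : Set (Matrix (Fin d) (Fin d) ℂ)}
    {M : Matrix (Fin m × Fin n) (Fin d) ℂ} (h : IsRealMasker S M) (hS : S' ⊆ S) :
    IsRealMasker S' M :=
  ⟨h.1.mono hS, fun ρ hρ => h.2 ρ (hS hρ)⟩

theorem IsEntanglementMonotone.le_of_convertible {E : BipartiteFunctional}
    (hE : IsEntanglementMonotone E) {m n m' n' : ℕ} {ρ : Matrix (Fin m × Fin n) (Fin m × Fin n) ℂ}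
    {σ : Matrix (Fin m' × Fin n') (Fin m' × Fin n') ℂ} (hρ : IsDensity ρ)
    (h : LOCCConvertible ρ σ) : E m' n' σ ≤ E m n ρ := by
  obtain ⟨Λ, hΛ, rfl⟩ := h
  exact hE _ _ _ _ Λ hΛ ρ hρ

theorem IsMaxEntangled.convertible_stdMaxEntangled {A B : Type} [Fintype A] [DecidableEq A]
    [Fintype B] [DecidableEq B] {k : ℕ} (hk : 0 < k) {Φ : A × B → ℂ} (hΦ : IsMaxEntangled k Φ) :
    LOCCConvertible (ketBra Φ) (ketBra (stdMaxEntangled k)) := by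
  obtain ⟨u, v, hu, hv, ketBra_eq⟩ := hΦ.exists_isometry
  have : NeZero k := ⟨hk.ne'⟩
  have transpose_v : vᵀ * (vᵀ)ᴴ = 1 := by
    rw [← Matrix.transpose_one, ← hv, Matrix.transpose_mul]
    rfl
  have reduced : ∑ _ : Unit, u * uniformCoeff (Fin k) * (u * uniformCoeff (Fin k))ᴴ =
      u * uniformCoeff (Fin k) * vᵀ * (u * uniformCoeff (Fin k) * vᵀ)ᴴ := by
    rw [Matrix.conjTranspose_mul _ vᵀ, ← Matrix.mul_assoc, Matrix.mul_assoc _ vᵀ, transpose_v,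
      Matrix.mul_one, Fintype.sum_unique]
  have conv := LOCCConvertible.of_sum_mul_conjTranspose_eq (T := fun _ => uniformCoeff (Fin k))
    reduced fun _ => by
      rw [Matrix.conjTranspose_mul, Matrix.mul_assoc, ← Matrix.mul_assoc uᴴ, hu, Matrix.one_mul]
      simp [uniformCoeff]
  rwa [Fintype.sum_unique, ← ketBra_eq, ← ketBra_stdMaxEntangled] at conv

theorem IsMaxEntangled.isDensity {A B : Type} [Fintype A] [Fintype B] {k : ℕ} (hk : 0 < k)
    {Φ : A × B → ℂ} (hΦ : IsMaxEntangled k Φ) : IsDensity (ketBra Φ) := by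
  classical
  have : NeZero k := ⟨hk.ne'⟩
  exact (LOCCConvertible.maxEntangled_of_uniformCoeff hk (Fintype.card_fin k).ge hΦ).isDensity
    (isDensity_pureOp trace_uniformCoeff)

variable {n m m' : ℕ} {M : Matrix (Fin m × Fin m') (Fin (n + 1)) ℂ}
  {S : Set (Matrix (Fin (n + 1)) (Fin (n + 1)) ℂ)}

theorem trace_coeff_mul_conjTranspose_self (hM : Mᴴ * M = 1) (j : Fin (n + 1)) :
    (coeff M j * (coeff M j)ᴴ).trace = 1 := by
  rw [trace_coeff_mul_conjTranspose, hM, Matrix.one_apply_eq]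

theorem IsMasker.maskerEntanglementEq {E : BipartiteFunctional} (hE : IsEntanglementMonotone E)
    (hS : realPureStates (Fin (n + 1)) ⊆ S) (hS' : S ⊆ realStates (Fin (n + 1)))
    (h : IsMasker S M) : MaskerEntanglementEq E S M (E m m' (pureOp (coeff M 0))) := by
  obtain ⟨τ, τ', family⟩ := (h.mono hS).isMaskFamily
  have trace_eq := trace_coeff_mul_conjTranspose_self h.1 0
  have : Nonempty (Fin m') := by
    by_contra! empty
    simp [Matrix.trace, Matrix.mul_apply] at trace_eq
  have sum_sq : ∑ j, (Pi.single 0 1 : Fin (n + 1) → ℝ) j ^ 2 = 1 := by simp [Pi.single_apply]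
  refine ⟨⟨_, hS (ketBra_realKet_mem_realPureStates sum_sq), ?_⟩, ?_⟩
  · rw [mul_ketBra_realKet_mul, Fintype.linearCombination_apply_single, one_smul]
  · rintro _ ⟨ρ, hρ, rfl⟩
    exact hE.le_of_convertible (isDensity_pureOp trace_eq) (family.convertible 0 (hS' hρ))

theorem IsMasker.convertible_maxEntangled (hn : 1 ≤ n)
    (h : IsMasker (realPureStates (Fin (n + 1))) M) {k k' : ℕ} {Φ : Fin k × Fin k' → ℂ}
    (hΦ : IsMaxEntangled (max (kappa (n + 1)) 2) Φ) :
    LOCCConvertible (pureOp (coeff M 0)) (ketBra Φ) := by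
  obtain ⟨τ, τ', family⟩ := h.isMaskFamily
  have trace_eq := trace_coeff_mul_conjTranspose_self h.1 0
  refine .maxEntangled (by positivity) trace_eq (fun x hx => ?_) hΦ
  rw [family.left] at trace_eq hx
  rcases le_total (kappa (n + 1)) 2 with hk | hk
  · rw [max_eq_right hk]
    refine family.spectrum_le_half hn trace_eq (fun i j hij => ?_) hx
    rw [trace_coeff_mul_conjTranspose, h.1, Matrix.one_apply_ne hij.symm]
  · rw [max_eq_left hk]
    exact family.spectrum_le_kappa trace_eq hx

theorem IsRealMasker.convertible_maxEntangled
    (h : IsRealMasker (realPureStates (Fin (n + 1))) M) {k k' : ℕ} {Φ : Fin k × Fin k' → ℂ}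
    (hΦ : IsMaxEntangled (kappaReal (n + 1)) Φ) :
    LOCCConvertible (pureOp (coeff M 0)) (ketBra Φ) := by
  obtain ⟨τ, τ', family⟩ := h.1.isMaskFamily
  have trace_eq := trace_coeff_mul_conjTranspose_self h.1.1 0
  refine .maxEntangled (kappaReal_pos _) trace_eq (fun x hx => ?_) hΦ
  rw [family.left] at trace_eq hx
  exact family.spectrum_le_kappaReal trace_eq h.conjMatrix_coeff_mul_conjTranspose hx

theorem isLeast_maskerEntanglement {E : BipartiteFunctional} (hE : IsEntanglementMonotone E)
    (hS : realPureStates (Fin (n + 1)) ⊆ S) (hS' : S ⊆ realStates (Fin (n + 1)))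
    {P : ∀ {m m' : ℕ}, Matrix (Fin m × Fin m') (Fin (n + 1)) ℂ → Prop}
    (hP : ∀ {m m' : ℕ} {M : Matrix (Fin m × Fin m') (Fin (n + 1)) ℂ}, P M → IsMasker S M)
    {k : ℕ} (hk : 0 < k) {l l' : ℕ} {Φ : Fin l × Fin l' → ℂ} (hΦ : IsMaxEntangled k Φ)
    (hconv : ∀ {m m' : ℕ} {M : Matrix (Fin m × Fin m') (Fin (n + 1)) ℂ}, P M →
      LOCCConvertible (pureOp (coeff M 0)) (ketBra Φ))
    {M₀ : Matrix (Fin k × Fin k) (Fin (n + 1)) ℂ} (hM₀ : P M₀)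
    (hstd : pureOp (coeff M₀ 0) = ketBra (stdMaxEntangled k)) :
    (∀ (m m' : ℕ) (M : Matrix (Fin m × Fin m') (Fin (n + 1)) ℂ), P M →
      ∃ x, MaskerEntanglementEq E S M x) ∧
    IsLeast {x | ∃ (m m' : ℕ) (M : Matrix (Fin m × Fin m') (Fin (n + 1)) ℂ),
      P M ∧ MaskerEntanglementEq E S M x} (E l l' (ketBra Φ)) := by
  have attained {m m' : ℕ} {M : Matrix (Fin m × Fin m') (Fin (n + 1)) ℂ} (hM : P M) :
      MaskerEntanglementEq E S M (E m m' (pureOp (coeff M 0))) :=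
    (hP hM).maskerEntanglementEq hE hS hS'
  have le {m m' : ℕ} {M : Matrix (Fin m × Fin m') (Fin (n + 1)) ℂ} (hM : P M) :
      E l l' (ketBra Φ) ≤ E m m' (pureOp (coeff M 0)) :=
    hE.le_of_convertible (isDensity_pureOp (trace_coeff_mul_conjTranspose_self (hP hM).1 0))
      (hconv hM)
  have ge : E k k (pureOp (coeff M₀ 0)) ≤ E l l' (ketBra Φ) :=
    hE.le_of_convertible (hΦ.isDensity hk) (hstd ▸ hΦ.convertible_stdMaxEntangled hk)
  refine ⟨fun m m' M hM => ⟨_, attained hM⟩, ⟨k, k, M₀, hM₀, ?_⟩, ?_⟩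
  · rw [(le hM₀).antisymm ge]
    exact attained hM₀
  · rintro x ⟨m, m', M, hM, hx⟩
    rw [hx.unique (attained hM)]
    exact le hM

theorem maskingEntanglementEq {E : BipartiteFunctional} (hE : IsEntanglementMonotone E)
    (hn : 1 ≤ n) (hS : realPureStates (Fin (n + 1)) ⊆ S) (hS' : S ⊆ realStates (Fin (n + 1)))
    {l l' : ℕ} {Φ : Fin l × Fin l' → ℂ} (hΦ : IsMaxEntangled (max (kappa (n + 1)) 2) Φ) :
    MaskingEntanglementEq E S (E l l' (ketBra Φ)) := by
  obtain ⟨M₀, hM₀, hstd⟩ := exists_isMasker hn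
  exact isLeast_maskerEntanglement hE hS hS' (P := fun M => IsMasker S M) id (by positivity) hΦ
    (fun hM => (hM.mono hS).convertible_maxEntangled hn hΦ) (hM₀.mono hS') hstd

theorem realMaskingEntanglementEq {E : BipartiteFunctional} (hE : IsEntanglementMonotone E)
    (hS : realPureStates (Fin (n + 1)) ⊆ S) (hS' : S ⊆ realStates (Fin (n + 1)))
    {l l' : ℕ} {Φ : Fin l × Fin l' → ℂ} (hΦ : IsMaxEntangled (kappaReal (n + 1)) Φ) :
    RealMaskingEntanglementEq E S (E l l' (ketBra Φ)) := by
  obtain ⟨M₀, hM₀, hstd⟩ := exists_isRealMasker n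
  exact isLeast_maskerEntanglement hE hS hS' (P := fun M => IsRealMasker S M) (fun h => h.1)
    (kappaReal_pos _) hΦ (fun hM => (hM.mono hS).convertible_maxEntangled hΦ) (hM₀.mono hS') hstd

theorem max_kappa_two {d : ℕ} (hd : 2 ≤ d) :
    max (kappa d) 2 = 2 ^ (if d = 2 then 1 else (d - 1) / 2) := by
  unfold kappa
  split_ifs with h
  · simp [h]
  · exact max_eq_left (le_self_pow₀ one_le_two (by omega))

theorem kappaReal_eq_two_pow (d : ℕ) :
    kappaReal d = 2 ^ (if d % 8 = 0 ∨ d % 8 = 1 ∨ d % 8 = 7 then (d - 1) / 2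
      else (d - 1) / 2 + 1) := by
  unfold kappaReal kappa
  split_ifs
  · rfl
  · rw [pow_succ, mul_comm]

theorem maskingEntanglementEq_entanglementCost (hn : 1 ≤ n)
    (hS : realPureStates (Fin (n + 1)) ⊆ S) (hS' : S ⊆ realStates (Fin (n + 1))) :
    MaskingEntanglementEq entanglementCost S
      (if n + 1 = 2 then 1 else (((n + 1 - 1) / 2 : ℕ) : ℝ)) := by
  have general := maskingEntanglementEq isEntanglementMonotone_entanglementCost hn hS hS'
    (isMaxEntangled_stdMaxEntangled _)
  rw [max_kappa_two (by omega), entanglementCost_stdMaxEntangled] at general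
  convert general using 1
  split_ifs <;> simp

theorem realMaskingEntanglementEq_entanglementCost
    (hS : realPureStates (Fin (n + 1)) ⊆ S) (hS' : S ⊆ realStates (Fin (n + 1))) :
    RealMaskingEntanglementEq entanglementCost S
      (if (n + 1) % 8 = 0 ∨ (n + 1) % 8 = 1 ∨ (n + 1) % 8 = 7 then (((n + 1 - 1) / 2 : ℕ) : ℝ)
        else (((n + 1 - 1) / 2 : ℕ) : ℝ) + 1) := by
  have general := realMaskingEntanglementEq isEntanglementMonotone_entanglementCost hS hS'
    (isMaxEntangled_stdMaxEntangled _)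
  rw [kappaReal_eq_two_pow, entanglementCost_stdMaxEntangled] at general
  convert general using 1
  split_ifs <;> simp

end Masking

end

end RealMasking

theorem corollary7 (d : ℕ) (hd : 2 ≤ d) :
    (∀ E : BipartiteFunctional, IsEntanglementMonotone E →
      (∀ (m n : ℕ) (Φ : Fin m × Fin n → ℂ), IsMaxEntangled (max (kappa d) 2) Φ →
        MaskingEntanglementEq E (realStates (Fin d)) (E m n (ketBra Φ)) ∧
        MaskingEntanglementEq E (realPureStates (Fin d)) (E m n (ketBra Φ))) ∧
      (∀ (m n : ℕ) (Φ : Fin m × Fin n → ℂ), IsMaxEntangled (kappaReal d) Φ →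
        RealMaskingEntanglementEq E (realStates (Fin d)) (E m n (ketBra Φ)) ∧
        RealMaskingEntanglementEq E (realPureStates (Fin d)) (E m n (ketBra Φ)))) ∧
    MaskingEntanglementEq entanglementCost (realStates (Fin d))
      (if d = 2 then 1 else (((d - 1) / 2 : ℕ) : ℝ)) ∧
    MaskingEntanglementEq entanglementCost (realPureStates (Fin d))
      (if d = 2 then 1 else (((d - 1) / 2 : ℕ) : ℝ)) ∧
    RealMaskingEntanglementEq entanglementCost (realStates (Fin d))
      (if d % 8 = 0 ∨ d % 8 = 1 ∨ d % 8 = 7 then (((d - 1) / 2 : ℕ) : ℝ)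
        else (((d - 1) / 2 : ℕ) : ℝ) + 1) ∧
    RealMaskingEntanglementEq entanglementCost (realPureStates (Fin d))
      (if d % 8 = 0 ∨ d % 8 = 1 ∨ d % 8 = 7 then (((d - 1) / 2 : ℕ) : ℝ)
        else (((d - 1) / 2 : ℕ) : ℝ) + 1) := by
  obtain ⟨n, rfl⟩ : ∃ n, d = n + 1 := ⟨d - 1, by omega⟩
  have hn : 1 ≤ n := by omega
  have pure_subset : realPureStates (Fin (n + 1)) ⊆ realStates (Fin (n + 1)) := fun _ h => h.1
  exact ⟨fun E hE =>
      ⟨fun _ _ Φ hΦ => ⟨maskingEntanglementEq hE hn pure_subset subset_rfl hΦ,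
        maskingEntanglementEq hE hn subset_rfl pure_subset hΦ⟩,
      fun _ _ Φ hΦ => ⟨realMaskingEntanglementEq hE pure_subset subset_rfl hΦ,
        realMaskingEntanglementEq hE subset_rfl pure_subset hΦ⟩⟩,
    maskingEntanglementEq_entanglementCost hn pure_subset subset_rfl,
    maskingEntanglementEq_entanglementCost hn subset_rfl pure_subset,
    realMaskingEntanglementEq_entanglementCost pure_subset subset_rfl,
    realMaskingEntanglementEq_entanglementCost subset_rfl pure_subset⟩
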